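/- Let $n\ge 0$ and let $M$ be a smooth (Hausdorff, second countable) manifold of dimension $4n+3$ with an almost contact metric $3$-structure $(\phi_\alpha,\xi_\alpha,\eta_\alpha,g)_{\alpha=1,2,3}$: $\phi_\alpha$ is a smooth field of endomorphisms of $TM$, $\xi_\alpha$ a smooth vector field, $\eta_\alpha$ a smooth $1$-form and $g$ a Riemannian metric such that, for all $\alpha,\beta$, $$\phi_\alpha^2=-I+\eta_\alpha\otimes\xi_\alpha,\qquad \eta_\alpha(\xi_\alpha)=1,\qquad \phi_\alpha\phi_\beta-\eta_\beta\otimes\xi_\alpha=\sum_{\gamma}\epsilon_{\alpha\beta\gamma}\phi_\gamma-\delta_{\alpha\beta}I,$$ $$\phi_\alpha\xi_\beta=\sum_\gamma\epsilon_{\alpha\beta\gamma}\xi_\gamma,\qquad \eta_\alpha\circ\phi_\beta=\sum_\gamma\epsilon_{\alpha\beta\gamma}\eta_\gamma,\qquad g(\phi_\alpha E,\phi_\alpha F)=g(E,F)-\eta_\alpha(E)\eta_\alpha(F).$$ Assume the structure is $3$-cosymplectic: for every $\alpha$, the forms $\eta_\alpha$ and $\Phi_\alpha=g(\cdot,\phi_\alpha\cdot)$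 are closed and $[\phi_\alpha,\phi_\alpha]+2d\eta_\alpha\otimes\xi_\alpha=0$. Let $\mathcal F$ be the Reeb foliation, tangent to $\langle\xi_1,\xi_2,\xi_3\rangle$; the leaf of a point consists of the points reached from it by finite chains of smooth curves tangent to $\langle\xi_1,\xi_2,\xi_3\rangle$. Put $\mathcal H=\bigcap_\alpha\ker\eta_\alpha$. A hyper-Kähler structure on a $4n$-dimensional smooth manifold $N$ consists of a Riemannian metric $G$ and smooth endomorphism fields $J_1,J_2,J_3$ of $TN$ with $J_\alpha J_\beta=\sum_\gamma\epsilon_{\alpha\beta\gamma}J_\gamma-\delta_{\alpha\beta}I$, $G(J_\alpha\cdot,J_\alpha\cdot)=G$, vanishing Nijenhuis tensors $[J_\alpha,J_\alpha]=0$, and closed fundamental forms $\Omega_\alpha=G(\cdot,J_\alpha\cdot)$. The structure of $M$ is said to project to it under a map $f$ from an open set $U\subseteq M$ to $N$ if $f$ is a smooth submersion with $\ker df=\langle\xi_1,\xi_2,\xi_3\rangle$, $G(df\,X,df\,Y)=g(X,Y)$ for all $X,Y\in\mathcal H$, and $df\circ\phi_\alpha=J_\alpha\circ df$ for every $\alpha$.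 1. Suppose that the structure is regular: every point of $M$ is the centre of a cubical foliated chart that each leaf of $\mathcal F$ meets in at most one plaque. Then the leaf space $M/\mathcal F$ with its quotient topology is second countable and carries a structure of smooth $4n$-dimensional manifold (Hausdorff if and only if the quotient topology is; this is not asserted) and a hyper-Kähler structure on it, to which the $3$-cosymplectic structure projects under the canonical projection $M\to M/\mathcal F$. 2. Without the regularity assumption, there are a (Hausdorff, second countable) smooth $4n$-dimensional manifold $M'$ with a hyper-Kähler structure, an open covering $\{U_i\}_{i\in I}$ of $M$, and maps $f_i:U_i\to M'$ such that the $3$-cosymplectic structure projects under each $f_i$ to the hyper-Kähler structure of $M'$. -/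

import Mathlib

open scoped Manifold ContDiff Topology

universe u v

noncomputable section

namespace ThreeCosymp

/-! ### Tensor calculus on a smooth `m`-dimensional manifold -/

section Tensors

variable {m : ℕ} {M : Type u} [TopologicalSpace M] [ChartedSpace (EuclideanSpace ℝ (Fin m)) M]

/-- A (rough) vector field. -/
abbrev VField (m : ℕ) (M : Type u) [TopologicalSpace M]
    [ChartedSpace (EuclideanSpace ℝ (Fin m)) M] : Type u :=
  (x : M) → TangentSpace (𝓡 m) x

/-- A (rough) differential `1`-form. -/
abbrev OneForm (m : ℕ) (M : Type u) [TopologicalSpace M]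
    [ChartedSpace (EuclideanSpace ℝ (Fin m)) M] : Type u :=
  (x : M) → TangentSpace (𝓡 m) x →L[ℝ] ℝ

/-- A (rough) field of endomorphisms of the tangent spaces. -/
abbrev EndoField (m : ℕ) (M : Type u) [TopologicalSpace M]
    [ChartedSpace (EuclideanSpace ℝ (Fin m)) M] : Type u :=
  (x : M) → TangentSpace (𝓡 m) x →L[ℝ] TangentSpace (𝓡 m) x

/-- A (rough) field of real-valued bilinear maps on the tangent spaces. -/
abbrev BilinField (m : ℕ) (M : Type u) [TopologicalSpace M]
    [ChartedSpace (EuclideanSpace ℝ (Fin m)) M] : Type u :=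
  (x : M) → TangentSpace (𝓡 m) x → TangentSpace (𝓡 m) x → ℝ

/-- The vector field `X` is smooth near the point `x`. -/
def SmoothVFieldAt [IsManifold (𝓡 m) ∞ M] (X : VField m M) (x : M) : Prop :=
  ContMDiffAt (𝓡 m) ((𝓡 m).prod 𝓘(ℝ, EuclideanSpace ℝ (Fin m))) ∞
    (fun y => Bundle.TotalSpace.mk' (EuclideanSpace ℝ (Fin m))
      (E := fun y : M => TangentSpace (𝓡 m) y) y (X y)) x

/-- Smoothness of a `1`-form, as a section of the cotangent bundle. -/
def SmoothOneForm [IsManifold (𝓡 m) ∞ M] (η : OneForm m M) : Prop :=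
  ContMDiff (𝓡 m) ((𝓡 m).prod 𝓘(ℝ, EuclideanSpace ℝ (Fin m) →L[ℝ] ℝ)) ∞
    (fun y => Bundle.TotalSpace.mk' (EuclideanSpace ℝ (Fin m) →L[ℝ] ℝ)
      (E := fun y : M => TangentSpace (𝓡 m) y →L[ℝ] ℝ) y (η y))

/-- Smoothness of an endomorphism field, as a section of the endomorphism bundle of `TM`. -/
def SmoothEndoField [IsManifold (𝓡 m) ∞ M] (φ : EndoField m M) : Prop :=
  ContMDiff (𝓡 m)
    ((𝓡 m).prod 𝓘(ℝ, EuclideanSpace ℝ (Fin m) →L[ℝ] EuclideanSpace ℝ (Fin m))) ∞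
    (fun y => Bundle.TotalSpace.mk' (EuclideanSpace ℝ (Fin m) →L[ℝ] EuclideanSpace ℝ (Fin m))
      (E := fun y : M => TangentSpace (𝓡 m) y →L[ℝ] TangentSpace (𝓡 m) y) y (φ y))

/-- The Lie bracket `[X, Y]`. -/
abbrev bracket (X Y : VField m M) : VField m M := VectorField.mlieBracket (𝓡 m) X Y

/-- The derivative `X(h)` of a function `h` along a vector field `X`. -/
abbrev dirDeriv (X : VField m M) (h : M → ℝ) (x : M) : ℝ := mvfderiv (𝓡 m) h x (X x)

/-- The exterior derivative of a `1`-form evaluated on vector fields, normalised by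
`2 dη(X, Y) = X(η(Y)) - Y(η(X)) - η([X, Y])`. -/
def extD1 (η : OneForm m M) (X Y : VField m M) (x : M) : ℝ :=
  (1 / 2 : ℝ) * (dirDeriv X (fun y => η y (Y y)) x - dirDeriv Y (fun y => η y (X y)) x
    - η x (bracket X Y x))

/-- The exterior derivative of a `2`-form evaluated on vector fields, normalised by
`3 dθ(X, Y, Z) = X(θ(Y, Z)) + Y(θ(Z, X)) + Z(θ(X, Y)) - θ([X, Y], Z) - θ([Y, Z], X) - θ([Z, X], Y)`.
-/
def extD2 (θ : BilinField m M) (X Y Z : VField m M) (x : M) : ℝ :=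
  (1 / 3 : ℝ) * (dirDeriv X (fun y => θ y (Y y) (Z y)) x
    + dirDeriv Y (fun y => θ y (Z y) (X y)) x
    + dirDeriv Z (fun y => θ y (X y) (Y y)) x
    - θ x (bracket X Y x) (Z x) - θ x (bracket Y Z x) (X x) - θ x (bracket Z X x) (Y x))

/-- A closed `1`-form: `dη = 0`, tested on locally defined smooth vector fields. -/
def IsClosed1 [IsManifold (𝓡 m) ∞ M] (η : OneForm m M) : Prop :=
  ∀ (x : M) (X Y : VField m M), SmoothVFieldAt X x → SmoothVFieldAt Y x → extD1 η X Y x = 0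

/-- A closed `2`-form: `dθ = 0`, tested on locally defined smooth vector fields. -/
def IsClosed2 [IsManifold (𝓡 m) ∞ M] (θ : BilinField m M) : Prop :=
  ∀ (x : M) (X Y Z : VField m M), SmoothVFieldAt X x → SmoothVFieldAt Y x →
    SmoothVFieldAt Z x → extD2 θ X Y Z x = 0

/-- The Nijenhuis tensor
`[φ, φ](X, Y) = φ²[X, Y] + [φX, φY] - φ[φX, Y] - φ[X, φY]`. -/
def nijenhuis (φ : EndoField m M) (X Y : VField m M) : VField m M := fun x =>
  φ x (φ x (bracket X Y x)) + bracket (fun y => φ y (X y)) (fun y => φ y (Y y)) x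
    - φ x (bracket (fun y => φ y (X y)) Y x) - φ x (bracket X (fun y => φ y (Y y)) x)

/-- Normality of an almost contact structure: `[φ, φ] + 2 dη ⊗ ξ = 0`. -/
def IsNormal [IsManifold (𝓡 m) ∞ M] (φ : EndoField m M) (ξ : VField m M) (η : OneForm m M) :
    Prop :=
  ∀ (x : M) (X Y : VField m M), SmoothVFieldAt X x → SmoothVFieldAt Y x →
    nijenhuis φ X Y x + (2 * extD1 η X Y x) • ξ x = 0

/-- Integrability of an almost complex structure: its Nijenhuis tensor vanishes. -/
def IsIntegrableACS [IsManifold (𝓡 m) ∞ M] (J : EndoField m M) : Prop :=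
  ∀ (x : M) (X Y : VField m M), SmoothVFieldAt X x → SmoothVFieldAt Y x → nijenhuis J X Y x = 0

end Tensors

/-- The totally antisymmetric symbol `ε_{αβγ}` on three indices, with `ε_{012} = 1`. -/
def eps (α β γ : Fin 3) : ℝ :=
  (((β : ℕ) : ℝ) - ((α : ℕ) : ℝ)) * (((γ : ℕ) : ℝ) - ((α : ℕ) : ℝ))
    * (((γ : ℕ) : ℝ) - ((β : ℕ) : ℝ)) / 2

/-- The Kronecker symbol. -/
def kron (α β : Fin 3) : ℝ := if α = β then 1 else 0

/-! ### Almost contact metric 3-structures -/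

/-- An almost contact metric `3`-structure `(φ_α, ξ_α, η_α, g)` on a `(4n+3)`-dimensional
manifold. -/
structure AlmostContactMetric3 (n : ℕ) (M : Type u) [TopologicalSpace M]
    [ChartedSpace (EuclideanSpace ℝ (Fin (4 * n + 3))) M]
    [IsManifold (𝓡 (4 * n + 3)) ∞ M] where
  φ : Fin 3 → EndoField (4 * n + 3) M
  ξ : Fin 3 → VField (4 * n + 3) M
  η : Fin 3 → OneForm (4 * n + 3) M
  g : Bundle.ContMDiffRiemannianMetric (𝓡 (4 * n + 3)) ∞
    (EuclideanSpace ℝ (Fin (4 * n + 3))) (fun x : M => TangentSpace (𝓡 (4 * n + 3)) x)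
  smooth_φ : ∀ α, SmoothEndoField (φ α)
  smooth_ξ : ∀ α x, SmoothVFieldAt (ξ α) x
  smooth_η : ∀ α, SmoothOneForm (η α)
  /-- `φ_α² = -I + η_α ⊗ ξ_α` -/
  φ_sq : ∀ α x v, φ α x (φ α x v) = -v + η α x v • ξ α x
  η_ξ : ∀ α x, η α x (ξ α x) = 1
  /-- `φ_α φ_β - η_β ⊗ ξ_α = ∑ ε_{αβγ} φ_γ - δ_{αβ} I` -/
  φ_φ : ∀ α β x v, φ α x (φ β x v) - η β x v • ξ α x
    = ∑ γ, eps α β γ • φ γ x v - kron α β • v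
  φ_ξ : ∀ α β x, φ α x (ξ β x) = ∑ γ, eps α β γ • ξ γ x
  η_φ : ∀ α β x v, η α x (φ β x v) = ∑ γ, eps α β γ * η γ x v
  /-- `g` is compatible with each of the three almost contact structures. -/
  compat : ∀ α x v w,
    g.inner x (φ α x v) (φ α x w) = g.inner x v w - η α x v * η α x w

namespace AlmostContactMetric3

variable {n : ℕ} {M : Type u} [TopologicalSpace M]
  [ChartedSpace (EuclideanSpace ℝ (Fin (4 * n + 3))) M] [IsManifold (𝓡 (4 * n + 3)) ∞ M]
  (S : AlmostContactMetric3 n M)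

/-- The fundamental `2`-form `Φ_α(E, F) = g(E, φ_α F)`. -/
def Φ (α : Fin 3) : BilinField (4 * n + 3) M := fun x v w => S.g.inner x v (S.φ α x w)

/-- The structure is `3`-cosymplectic: each `(φ_α, ξ_α, η_α, g)` is almost cosymplectic
(`dη_α = 0`, `dΦ_α = 0`) and normal. -/
def Is3Cosymplectic : Prop :=
  ∀ α, IsClosed1 (S.η α) ∧ IsClosed2 (S.Φ α) ∧ IsNormal (S.φ α) (S.ξ α) (S.η α)

/-- The vertical (Reeb) distribution, spanned by `ξ_1, ξ_2, ξ_3`. -/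
def vertical (x : M) : Submodule ℝ (TangentSpace (𝓡 (4 * n + 3)) x) :=
  Submodule.span ℝ (Set.range fun α => S.ξ α x)

/-- The horizontal distribution, the intersection of the kernels of `η_1, η_2, η_3`. -/
def horizontal (x : M) : Submodule ℝ (TangentSpace (𝓡 (4 * n + 3)) x) :=
  ⨅ α, LinearMap.ker (S.η α x).toLinearMap

/-- `x` and `y` are joined by a smooth curve that is everywhere tangent to the Reeb distribution. -/
def VerticallyJoined (x y : M) : Prop :=
  ∃ c : ℝ → M, ContMDiff 𝓘(ℝ, ℝ) (𝓡 (4 * n + 3)) ∞ c ∧ c 0 = x ∧ c 1 = y ∧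
    ∀ t : ℝ, mfderiv 𝓘(ℝ, ℝ) (𝓡 (4 * n + 3)) c t (1 : ℝ) ∈ S.vertical (c t)

/-- Two points are equivalent when they lie on the same leaf of the Reeb foliation, that is, when
they are joined by a finite chain of smooth vertical curves. -/
def leafSetoid : Setoid M := Relation.EqvGen.setoid S.VerticallyJoined

/-- The leaf space of the Reeb foliation, with the quotient topology. -/
abbrev LeafSpace : Type u := Quotient S.leafSetoid

/-- The projection onto the leaf space. -/
def leafProj : M → S.LeafSpace := Quotient.mk S.leafSetoid

/-- `e` is a cubical foliated chart: its image is the cube `(-r, r)^{4n+3}`, and its plaques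
(the slices on which the last `4n` coordinates are constant) are tangent to the Reeb
distribution. -/
def IsFoliatedChart (e : OpenPartialHomeomorph M (EuclideanSpace ℝ (Fin (4 * n + 3)))) : Prop :=
  e ∈ IsManifold.maximalAtlas (𝓡 (4 * n + 3)) ∞ M ∧
  (∃ r : ℝ, 0 < r ∧ e.target = {w | ∀ i, |w i| < r}) ∧
  ∀ y ∈ e.source, ∀ v : TangentSpace (𝓡 (4 * n + 3)) y, v ∈ S.vertical y ↔
    ∀ i : Fin (4 * n + 3), 3 ≤ (i : ℕ) →
      (mvfderiv (𝓡 (4 * n + 3)) e y v) i = 0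

/-- The Reeb foliation is regular: every point is the centre of a cubical foliated chart that each
leaf meets in at most one plaque. -/
def IsRegular : Prop :=
  ∀ x : M, ∃ e : OpenPartialHomeomorph M (EuclideanSpace ℝ (Fin (4 * n + 3))),
    x ∈ e.source ∧ e x = 0 ∧ S.IsFoliatedChart e ∧
    ∀ y ∈ e.source, ∀ z ∈ e.source, S.leafSetoid y z →
      ∀ i : Fin (4 * n + 3), 3 ≤ (i : ℕ) → e y i = e z i

end AlmostContactMetric3

/-! ### Hyper-Kähler structures -/

/-- An almost hyper-Hermitian structure `(J_α, G)` on a `4n`-dimensional manifold. -/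
structure AlmostHyperHermitian (n : ℕ) (N : Type u) [TopologicalSpace N]
    [ChartedSpace (EuclideanSpace ℝ (Fin (4 * n))) N] [IsManifold (𝓡 (4 * n)) ∞ N] where
  J : Fin 3 → EndoField (4 * n) N
  G : Bundle.ContMDiffRiemannianMetric (𝓡 (4 * n)) ∞
    (EuclideanSpace ℝ (Fin (4 * n))) (fun x : N => TangentSpace (𝓡 (4 * n)) x)
  smooth_J : ∀ α, SmoothEndoField (J α)
  /-- `J_α J_β = ∑ ε_{αβγ} J_γ - δ_{αβ} I` -/
  J_J : ∀ α β x v, J α x (J β x v) = ∑ γ, eps α β γ • J γ x v - kron α β • v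
  compat : ∀ α x v w, G.inner x (J α x v) (J α x w) = G.inner x v w

namespace AlmostHyperHermitian

variable {n : ℕ} {N : Type v} [TopologicalSpace N]
  [ChartedSpace (EuclideanSpace ℝ (Fin (4 * n))) N] [IsManifold (𝓡 (4 * n)) ∞ N]
  (K : AlmostHyperHermitian n N)

/-- The fundamental `2`-form `Ω_α(X, Y) = G(X, J_α Y)`. -/
def Ω (α : Fin 3) : BilinField (4 * n) N := fun x v w => K.G.inner x v (K.J α x w)

/-- The structure is hyper-Kähler: each `(J_α, G)` is Kähler, i.e. `J_α` is integrable and its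
fundamental form is closed. -/
def IsHyperKahler : Prop := ∀ α, IsIntegrableACS (K.J α) ∧ IsClosed2 (K.Ω α)

end AlmostHyperHermitian

/-- The map `f`, restricted to the open set `U`, is a smooth submersion defining the Reeb foliation
(the kernel of its differential is the Reeb distribution), under which `g` projects to `G` (as a
Riemannian submersion) and each `φ_α` projects to `J_α`. Only the values of `f` on `U` matter. -/
structure ProjectsOn {n : ℕ} {M : Type u} [TopologicalSpace M]
    [ChartedSpace (EuclideanSpace ℝ (Fin (4 * n + 3))) M] [IsManifold (𝓡 (4 * n + 3)) ∞ M]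
    (S : AlmostContactMetric3 n M) {N : Type v} [TopologicalSpace N]
    [ChartedSpace (EuclideanSpace ℝ (Fin (4 * n))) N] [IsManifold (𝓡 (4 * n)) ∞ N]
    (K : AlmostHyperHermitian n N) (U : TopologicalSpace.Opens M) (f : M → N) : Prop where
  submersion : ∀ x ∈ U, Manifold.IsSubmersionAt (𝓡 (4 * n + 3)) (𝓡 (4 * n)) ∞ f x
  ker_eq : ∀ x ∈ U, ∀ v : TangentSpace (𝓡 (4 * n + 3)) x,
    mfderiv (𝓡 (4 * n + 3)) (𝓡 (4 * n)) f x v = 0 ↔ v ∈ S.vertical x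
  metric : ∀ x ∈ U, ∀ v ∈ S.horizontal x, ∀ w ∈ S.horizontal x,
    K.G.inner (f x) (mfderiv (𝓡 (4 * n + 3)) (𝓡 (4 * n)) f x v)
      (mfderiv (𝓡 (4 * n + 3)) (𝓡 (4 * n)) f x w) = S.g.inner x v w
  endo : ∀ α, ∀ x ∈ U, ∀ v : TangentSpace (𝓡 (4 * n + 3)) x,
    mfderiv (𝓡 (4 * n + 3)) (𝓡 (4 * n)) f x (S.φ α x v)
      = K.J α (f x) (mfderiv (𝓡 (4 * n + 3)) (𝓡 (4 * n)) f x v)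

end ThreeCosymp

end

universe w

noncomputable section

set_option linter.unusedSectionVars false

namespace ThreeCosymp

/-! The heart of the matter is that the Reeb fields leave the whole structure invariant. Normality
together with `dη_α = 0` gives `L_{ξ_α} φ_α = 0` (`lie_φ_self`). Cartan's formula gives `L_{ξ_α} η_β
= 0` and `L_{ξ_α} Φ_β = 0`, because `η_β(ξ_α)` is constant and the contraction of `Φ_β` with `ξ_α`
is a combination of the closed forms `η_γ`. Since `g` is expressed through `Φ_α`, `φ_α` and `η_α`,
also `L_{ξ_α} g = 0`. Then `ξ_β`, the metric dual of `η_β`, is invariant, so the Reeb fields commute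
(`ξ_commute`); and `φ_β`, determined by `g` and `Φ_β`, is invariant for mixed indices too (`lie_φ`).

Commuting independent fields can be straightened (`exists_straightening`). Their joint flow comes
from the inverse function theorem in a Banach space of curves, applied to the integral equation with
the times as parameters. In the resulting adapted charts, with leaf coordinates in `ℝ³` and
transverse coordinates in `ℝ⁴ⁿ`, all tensors depend on the transverse coordinates only. The
endomorphisms `φ_α` preserve the vertical space and induce `J_α`; the form `g - ∑ η_γ ⊗ η_γ` kills
vertical vectors and induces `G`; the fundamental form of `(G, J_α)` pulls back to `Φ_α` minus a
combination of products of the `η_γ`, hence is closed; the Nijenhuis tensor of `J_α` is the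
transverse part of that of `φ_α`. So each transverse ball is hyper-Kähler (`LocalCosymp.descend`),
and changes of transverse coordinates preserve these structures because both sides are computed from
the same tensors on `M`.

Without regularity, `M'` is the disjoint union of the transverse balls of countably many adapted
charts covering `M`, and the maps are the transverse coordinates. In the regular case each
transversal of a small adapted chart injects into the leaf space, and the projection is open, so
transversals give charts. Two such charts may overlap although their domains in `M` are disjoint; a
chain of plaques along a leaf factors the transition into changes of transverse coordinates. The
local structures are then glued. -/

theorem contDiffAt_clm_apply {D E F : Type*} [NormedAddCommGroup D] [NormedSpace ℝ D]
    [NormedAddCommGroup E] [NormedSpace ℝ E] [NormedAddCommGroup F] [NormedSpace ℝ F]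
    [FiniteDimensional ℝ E] {n : WithTop ℕ∞} {f : D → E →L[ℝ] F} {x : D} :
    ContDiffAt ℝ n f x ↔ ∀ v, ContDiffAt ℝ n (fun y => f y v) x := by
  refine ⟨fun h v => h.clm_apply contDiffAt_const, fun h => ?_⟩
  let d := Module.finrank ℝ E
  have hd : d = Module.finrank ℝ (Fin d → ℝ) := (Module.finrank_fin_fun ℝ).symm
  let e₁ := ContinuousLinearEquiv.ofFinrankEq hd
  let e₂ := (e₁.arrowCongr (1 : F ≃L[ℝ] F)).trans (ContinuousLinearEquiv.piRing (Fin d))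
  rw [← Function.id_comp f, ← e₂.symm_comp_self]
  exact e₂.symm.contDiff.contDiffAt.comp x (contDiffAt_pi.mpr fun i => h _)

/-! ### Vector fields, forms and endomorphism fields read in a chart. -/

section ChartCalculus

variable (m : ℕ) {X : Type u} [TopologicalSpace X] [ChartedSpace (EuclideanSpace ℝ (Fin m)) X]
  {E' : Type v} [NormedAddCommGroup E'] [NormedSpace ℝ E']

/-- A smooth chart with values in an arbitrary normed space. -/
structure IsSmoothChart (e : OpenPartialHomeomorph X E') : Prop where
  smooth : ContMDiffOn (𝓡 m) 𝓘(ℝ, E') ∞ e e.source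
  smooth_symm : ContMDiffOn 𝓘(ℝ, E') (𝓡 m) ∞ e.symm e.target

/-- The differential of a chart. -/
def fwd (e : OpenPartialHomeomorph X E') (x : X) : TangentSpace (𝓡 m) x →L[ℝ] E' :=
  mvfderiv (𝓡 m) e x

/-- The differential of the inverse of a chart. -/
def bwd (e : OpenPartialHomeomorph X E') (z : E') : E' →L[ℝ] TangentSpace (𝓡 m) (e.symm z) :=
  (mfderiv 𝓘(ℝ, E') (𝓡 m) e.symm z) ∘L
    (NormedSpace.fromTangentSpace z).symm.toContinuousLinearMap

/-- The vector field on a manifold whose coordinate expression in the chart `e` is `W`. -/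
def liftField (e : OpenPartialHomeomorph X E') (W : E' → E') : VField m X :=
  VectorField.mpullback (𝓡 m) 𝓘(ℝ, E') e W

/-- The coordinate expression of a vector field. -/
def coordField (e : OpenPartialHomeomorph X E') (Y : VField m X) (z : E') : E' :=
  fwd m e (e.symm z) (Y (e.symm z))

/-- The coordinate expression of a `1`-form. -/
def coordForm (e : OpenPartialHomeomorph X E') (η : OneForm m X) (z : E') : E' →L[ℝ] ℝ :=
  (η (e.symm z)) ∘L bwd m e z

/-- The coordinate expression of an endomorphism field. -/
def coordEndo (e : OpenPartialHomeomorph X E') (φ : EndoField m X) (z : E') : E' →L[ℝ] E' :=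
  fwd m e (e.symm z) ∘L φ (e.symm z) ∘L bwd m e z

/-- The coordinate expression of a continuous bilinear form. -/
def coordBilin (e : OpenPartialHomeomorph X E')
    (g : ∀ x : X, TangentSpace (𝓡 m) x →L[ℝ] TangentSpace (𝓡 m) x →L[ℝ] ℝ) (z : E') :
    E' →L[ℝ] E' →L[ℝ] ℝ :=
  ContinuousLinearMap.precomp ℝ (bwd m e z) ∘L g (e.symm z) ∘L bwd m e z

variable {m} {e : OpenPartialHomeomorph X E'} (he : IsSmoothChart m e)

include he

theorem IsSmoothChart.mdifferentiable : e.MDifferentiable (𝓡 m) 𝓘(ℝ, E') :=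
  ⟨he.smooth.mdifferentiableOn (by simp), he.smooth_symm.mdifferentiableOn (by simp)⟩

theorem IsSmoothChart.fwd_bwd {z : E'} (hz : z ∈ e.target) (w : E') :
    fwd m e (e.symm z) (bwd m e z w) = w :=
  DFunLike.congr_fun (he.mdifferentiable.comp_symm_deriv hz) w

theorem IsSmoothChart.bwd_fwd {z : E'} (hz : z ∈ e.target) (v : TangentSpace (𝓡 m) (e.symm z)) :
    bwd m e z (fwd m e (e.symm z) v) = v := by
  have h := DFunLike.congr_fun (he.mdifferentiable.symm_comp_deriv (e.map_target hz)) v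
  rw [e.right_inv hz] at h
  exact h

theorem IsSmoothChart.fwd_injective {x : X} (hx : x ∈ e.source) :
    Function.Injective (fwd m e x) := he.mdifferentiable.mfderiv_injective hx

theorem IsSmoothChart.fwd_surjective {x : X} (hx : x ∈ e.source) :
    Function.Surjective (fwd m e x) := he.mdifferentiable.mfderiv_surjective hx

theorem IsSmoothChart.isInvertible {x : X} (hx : x ∈ e.source) :
    (mfderiv (𝓡 m) 𝓘(ℝ, E') e x).IsInvertible :=
  ⟨he.mdifferentiable.mfderiv hx, rfl⟩

theorem IsSmoothChart.fwd_liftField {x : X} (hx : x ∈ e.source) (W : E' → E') :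
    fwd m e x (liftField m e W x) = W (e x) := by
  obtain ⟨f, hf⟩ := he.isInvertible hx
  have h : ∀ w, mfderiv (𝓡 m) 𝓘(ℝ, E') e x ((mfderiv (𝓡 m) 𝓘(ℝ, E') e x).inverse w) = w := by
    intro w
    rw [← hf, ContinuousLinearMap.inverse_equiv]
    exact f.apply_symm_apply w
  exact h (W (e x))

theorem IsSmoothChart.liftField_symm {z : E'} (hz : z ∈ e.target) (W : E' → E') :
    liftField m e W (e.symm z) = bwd m e z (W z) := by
  apply he.fwd_injective (e.map_target hz)
  rw [he.fwd_liftField (e.map_target hz), he.fwd_bwd hz, e.right_inv hz]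

theorem IsSmoothChart.liftField_coordField {x : X} (hx : x ∈ e.source) (Y : VField m X) :
    liftField m e (coordField m e Y) x = Y x := by
  apply he.fwd_injective hx
  rw [he.fwd_liftField hx, coordField, e.left_inv hx]

omit he in
theorem fwd_eq_coordField {x : X} (hx : x ∈ e.source) (Y : VField m X) :
    fwd m e x (Y x) = coordField m e Y (e x) := by
  rw [coordField, e.left_inv hx]

theorem IsSmoothChart.form_apply {x : X} (hx : x ∈ e.source) (η : OneForm m X)
    (v : TangentSpace (𝓡 m) x) : η x v = coordForm m e η (e x) (fwd m e x v) := by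
  obtain ⟨z, hz, rfl⟩ : ∃ z ∈ e.target, e.symm z = x := ⟨e x, e.map_source hx, e.left_inv hx⟩
  rw [e.right_inv hz, coordForm, ContinuousLinearMap.comp_apply, he.bwd_fwd hz]

theorem IsSmoothChart.endo_apply {x : X} (hx : x ∈ e.source) (φ : EndoField m X)
    (v : TangentSpace (𝓡 m) x) :
    fwd m e x (φ x v) = coordEndo m e φ (e x) (fwd m e x v) := by
  obtain ⟨z, hz, rfl⟩ : ∃ z ∈ e.target, e.symm z = x := ⟨e x, e.map_source hx, e.left_inv hx⟩
  rw [e.right_inv hz, coordEndo, ContinuousLinearMap.comp_apply, ContinuousLinearMap.comp_apply,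
    he.bwd_fwd hz]

theorem IsSmoothChart.bilin_apply {x : X} (hx : x ∈ e.source)
    (g : ∀ x : X, TangentSpace (𝓡 m) x →L[ℝ] TangentSpace (𝓡 m) x →L[ℝ] ℝ)
    (v w : TangentSpace (𝓡 m) x) :
    g x v w = coordBilin m e g (e x) (fwd m e x v) (fwd m e x w) := by
  obtain ⟨z, hz, rfl⟩ : ∃ z ∈ e.target, e.symm z = x := ⟨e x, e.map_source hx, e.left_inv hx⟩
  rw [e.right_inv hz, coordBilin, ContinuousLinearMap.comp_apply, ContinuousLinearMap.comp_apply,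
    ContinuousLinearMap.precomp_apply, ContinuousLinearMap.comp_apply, he.bwd_fwd hz,
    he.bwd_fwd hz]

variable [IsManifold (𝓡 m) ∞ X] [FiniteDimensional ℝ E']

omit [FiniteDimensional ℝ E'] in
theorem IsSmoothChart.smoothVFieldAt_liftField {x : X} (hx : x ∈ e.source) {W : E' → E'}
    (hW : ContDiffAt ℝ ∞ W (e x)) : SmoothVFieldAt (liftField m e W) x := by
  have : IsManifold (𝓡 m) 1 X := IsManifold.of_le (n := ∞) (by simp)
  exact ContMDiffAt.mpullback_vectorField_preimage (n := ∞)
    (contMDiffAt_vectorSpace_iff_contDiffAt.2 hW)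
    ((he.smooth x hx).contMDiffAt (e.open_source.mem_nhds hx)) (he.isInvertible hx) (by simp)

/-- On the target, `coordField` agrees with the pullback of the field along `e.symm`, and pullback
along a local diffeomorphism preserves smoothness. -/
theorem IsSmoothChart.contDiffAt_coordField {z : E'} (hz : z ∈ e.target) {Y : VField m X}
    (hY : SmoothVFieldAt Y (e.symm z)) : ContDiffAt ℝ ∞ (coordField m e Y) z := by
  have : IsManifold (𝓡 m) 1 X := IsManifold.of_le (n := ∞) (by simp)
  have : CompleteSpace E' := FiniteDimensional.complete ℝ E'
  have hz' : (mfderiv 𝓘(ℝ, E') (𝓡 m) e.symm z).IsInvertible :=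
    ⟨he.mdifferentiable.symm.mfderiv hz, rfl⟩
  have h := ContMDiffAt.mpullback_vectorField_preimage (n := ∞) (m := ∞) hY
    ((he.smooth_symm z hz).contMDiffAt (e.open_target.mem_nhds hz)) hz' (by simp)
  refine (contMDiffAt_vectorSpace_iff_contDiffAt.1 h).congr_of_eventuallyEq ?_
  filter_upwards [e.open_target.mem_nhds hz] with y hy
  change fwd m e (e.symm y) (Y (e.symm y)) = (mfderiv 𝓘(ℝ, E') (𝓡 m) e.symm y).inverse (Y (e.symm y))
  have hb : ∀ w, (mfderiv 𝓘(ℝ, E') (𝓡 m) e.symm y).inverse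
      ((mfderiv 𝓘(ℝ, E') (𝓡 m) e.symm y) w) = w := by
    intro w
    have : (mfderiv 𝓘(ℝ, E') (𝓡 m) e.symm y) =
      (he.mdifferentiable.symm.mfderiv hy : _ →L[ℝ] _) := rfl
    rw [this, ContinuousLinearMap.inverse_equiv]
    exact (he.mdifferentiable.symm.mfderiv hy).symm_apply_apply w
  have := hb (fwd m e (e.symm y) (Y (e.symm y)))
  have h2 : mfderiv 𝓘(ℝ, E') (𝓡 m) e.symm y (fwd m e (e.symm y) (Y (e.symm y))) = Y (e.symm y) :=
    he.bwd_fwd hy _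
  rw [h2] at this
  exact this.symm

/-- Naturality of the Lie bracket under pullback. Near a point of the chart every field is the lift
of its coordinate expression, so all brackets reduce to brackets in the model space. -/
theorem IsSmoothChart.bracket_liftField {x : X} (hx : x ∈ e.source) {V W : E' → E'}
    (hV : ContDiffAt ℝ ∞ V (e x)) (hW : ContDiffAt ℝ ∞ W (e x)) :
    bracket (liftField m e V) (liftField m e W) x
      = liftField m e (VectorField.lieBracket ℝ V W) x := by
  have : IsManifold (𝓡 m) (minSmoothness ℝ 2) X := by
    rw [minSmoothness_of_isRCLikeNormedField]
    exact IsManifold.of_le (n := ∞) ENat.LEInfty.out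
  have : CompleteSpace E' := FiniteDimensional.complete ℝ E'
  have h := VectorField.mpullback_mlieBracket (I := 𝓡 m) (I' := 𝓘(ℝ, E')) (f := e) (V := V) (W := W)
    (x₀ := x) (n := ∞) 
      ((contMDiffAt_vectorSpace_iff_contDiffAt.2 hV).mdifferentiableAt (by simp))
      ((contMDiffAt_vectorSpace_iff_contDiffAt.2 hW).mdifferentiableAt (by simp))
      ((he.smooth x hx).contMDiffAt (e.open_source.mem_nhds hx))
      (by rw [minSmoothness_of_isRCLikeNormedField]; exact ENat.LEInfty.out)
  have h2 : ∀ V W : (y : E') → TangentSpace 𝓘(ℝ, E') y,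
      VectorField.mlieBracket 𝓘(ℝ, E') V W = VectorField.lieBracket ℝ V W := by
    intro V W
    exact VectorField.mlieBracketWithin_univ.symm.trans
      (VectorField.mlieBracketWithin_eq_lieBracketWithin.trans VectorField.lieBracketWithin_univ)
  exact h.symm.trans (congrArg (fun U => VectorField.mpullback (𝓡 m) 𝓘(ℝ, E') e U x) (h2 V W))

omit [FiniteDimensional ℝ E'] [IsManifold (𝓡 m) ∞ X] in
theorem IsSmoothChart.dirDeriv_comp {x : X} (hx : x ∈ e.source) {h : X → ℝ} {k : E' → ℝ}
    (hk : DifferentiableAt ℝ k (e x)) (hh : ∀ᶠ y in 𝓝 x, h y = k (e y)) (Y : VField m X) :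
    dirDeriv Y h x = fderiv ℝ k (e x) (coordField m e Y (e x)) := by
  have h1 : mfderiv (𝓡 m) 𝓘(ℝ, ℝ) h x = mfderiv (𝓡 m) 𝓘(ℝ, ℝ) (k ∘ e) x :=
    Filter.EventuallyEq.mfderiv_eq hh
  have h2 : mfderiv (𝓡 m) 𝓘(ℝ, ℝ) (k ∘ e) x
      = (mfderiv 𝓘(ℝ, E') 𝓘(ℝ, ℝ) k (e x)).comp (mfderiv (𝓡 m) 𝓘(ℝ, E') e x) :=
    mfderiv_comp x hk.mdifferentiableAt (he.mdifferentiable.mdifferentiableAt hx)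
  have h3 : mfderiv (𝓡 m) 𝓘(ℝ, ℝ) h x (Y x) = fderiv ℝ k (e x) (fwd m e x (Y x)) := by
    rw [h1, h2, mfderiv_eq_fderiv]; rfl
  rw [← fwd_eq_coordField hx]
  exact h3

omit he [IsManifold (𝓡 m) ∞ X] in
theorem trivial_bundle_smooth {x : X} {h : X → ℝ} (hh : ContMDiffAt (𝓡 m) ((𝓡 m).prod 𝓘(ℝ, ℝ)) ∞
      (fun y => Bundle.TotalSpace.mk' ℝ (E := Bundle.Trivial X ℝ) y (h y)) x) :
    ContMDiffAt (𝓡 m) 𝓘(ℝ, ℝ) ∞ h x := by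
  rw [Bundle.contMDiffAt_totalSpace] at hh
  exact hh.2

omit [FiniteDimensional ℝ E'] [IsManifold (𝓡 m) ∞ X] in
/-- A function on the target of a chart is smooth when its composition with the chart is. -/
theorem IsSmoothChart.contDiffAt_of_comp {F' : Type*} [NormedAddCommGroup F'] [NormedSpace ℝ F']
    {z : E'} (hz : z ∈ e.target) {h : X → F'} {k : E' → F'}
    (hh : ContMDiffAt (𝓡 m) 𝓘(ℝ, F') ∞ h (e.symm z)) (hk : ∀ y ∈ e.target, k y = h (e.symm y)) :
    ContDiffAt ℝ ∞ k z := by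
  have h1 : ContMDiffAt 𝓘(ℝ, E') 𝓘(ℝ, F') ∞ (h ∘ e.symm) z :=
    hh.comp z ((he.smooth_symm z hz).contMDiffAt (e.open_target.mem_nhds hz))
  refine (contMDiffAt_iff_contDiffAt.1 h1).congr_of_eventuallyEq ?_
  filter_upwards [e.open_target.mem_nhds hz] with y hy using hk y hy

/-- Since the model space is finite-dimensional, it suffices to evaluate on lifts of constant
fields. -/
theorem IsSmoothChart.contDiffAt_coordForm {z : E'} (hz : z ∈ e.target) {η : OneForm m X}
    (hη : SmoothOneForm η) : ContDiffAt ℝ ∞ (coordForm m e η) z := by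
  refine contDiffAt_clm_apply.2 fun v => ?_
  have h1 := he.smoothVFieldAt_liftField (e.map_target hz) (W := fun _ => v) contDiffAt_const
  have h2 := trivial_bundle_smooth (ContMDiffAt.clm_bundle_apply
    (E₂ := Bundle.Trivial X ℝ) (hη (e.symm z)) h1)
  refine he.contDiffAt_of_comp hz h2 fun y hy => ?_
  rw [he.liftField_symm hy]; rfl

theorem IsSmoothChart.contDiffAt_coordEndo {z : E'} (hz : z ∈ e.target) {φ : EndoField m X}
    (hφ : SmoothEndoField φ) : ContDiffAt ℝ ∞ (coordEndo m e φ) z := by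
  refine contDiffAt_clm_apply.2 fun v => ?_
  have h1 := he.smoothVFieldAt_liftField (e.map_target hz) (W := fun _ => v) contDiffAt_const
  have h2 : SmoothVFieldAt (fun y => φ y (liftField m e (fun _ => v) y)) (e.symm z) :=
    ContMDiffAt.clm_bundle_apply (hφ (e.symm z)) h1
  refine (he.contDiffAt_coordField hz h2).congr_of_eventuallyEq ?_
  filter_upwards [e.open_target.mem_nhds hz] with y hy
  rw [coordField, he.liftField_symm hy]; rfl

theorem IsSmoothChart.contDiffAt_coordBilin {z : E'} (hz : z ∈ e.target)
    {g : ∀ x : X, TangentSpace (𝓡 m) x →L[ℝ] TangentSpace (𝓡 m) x →L[ℝ] ℝ}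
    (hg : ContMDiff (𝓡 m) ((𝓡 m).prod 𝓘(ℝ, EuclideanSpace ℝ (Fin m) →L[ℝ]
        EuclideanSpace ℝ (Fin m) →L[ℝ] ℝ)) ∞
      (fun b ↦ Bundle.TotalSpace.mk' (EuclideanSpace ℝ (Fin m) →L[ℝ]
        EuclideanSpace ℝ (Fin m) →L[ℝ] ℝ)
        (E := fun b => TangentSpace (𝓡 m) b →L[ℝ] TangentSpace (𝓡 m) b →L[ℝ] ℝ) b (g b))) :
    ContDiffAt ℝ ∞ (coordBilin m e g) z := by
  refine contDiffAt_clm_apply.2 fun v => contDiffAt_clm_apply.2 fun w => ?_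
  have h1 := he.smoothVFieldAt_liftField (e.map_target hz) (W := fun _ => v) contDiffAt_const
  have h1' := he.smoothVFieldAt_liftField (e.map_target hz) (W := fun _ => w) contDiffAt_const
  have h2 := trivial_bundle_smooth (ContMDiffAt.clm_bundle_apply₂
    (E₃ := Bundle.Trivial X ℝ) (hg (e.symm z)) h1 h1')
  refine he.contDiffAt_of_comp hz h2 fun y hy => ?_
  rw [he.liftField_symm hy, he.liftField_symm hy]; rfl

end ChartCalculus

/-! ### Coordinate formulas for exterior derivatives and the Nijenhuis tensor. -/

section ChartFormulas

variable {m : ℕ} {X : Type u} [TopologicalSpace X] [ChartedSpace (EuclideanSpace ℝ (Fin m)) X]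
  {E' : Type v} [NormedAddCommGroup E'] [NormedSpace ℝ E']
  {e : OpenPartialHomeomorph X E'}
  [IsManifold (𝓡 m) ∞ X] [FiniteDimensional ℝ E']

theorem IsSmoothChart.contDiffAt_coordField' (he : IsSmoothChart m e) {x : X} (hx : x ∈ e.source)
    {Y : VField m X} (hY : SmoothVFieldAt Y x) : ContDiffAt ℝ ∞ (coordField m e Y) (e x) :=
  he.contDiffAt_coordField (e.map_source hx) (by rwa [e.left_inv hx])

theorem IsSmoothChart.fwd_bracket (he : IsSmoothChart m e) {x : X} (hx : x ∈ e.source)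
    {Y Z : VField m X} (hY : SmoothVFieldAt Y x) (hZ : SmoothVFieldAt Z x) :
    fwd m e x (bracket Y Z x)
      = VectorField.lieBracket ℝ (coordField m e Y) (coordField m e Z) (e x) := by
  have h1 : ∀ Y : VField m X, Y =ᶠ[𝓝 x] liftField m e (coordField m e Y) := fun Y => by
    filter_upwards [e.open_source.mem_nhds hx] with y hy
    exact (he.liftField_coordField hy Y).symm
  have h2 : bracket Y Z x = bracket (liftField m e (coordField m e Y))
      (liftField m e (coordField m e Z)) x :=
    (h1 Y).mlieBracket_vectorField_eq (h1 Z)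
  rw [h2, he.bracket_liftField hx (he.contDiffAt_coordField' hx hY)
    (he.contDiffAt_coordField' hx hZ), he.fwd_liftField hx]

/-- By the product rule, the derivatives of `Y` and `Z` occur exactly in the combination forming
`η([Y, Z])`, so only the derivative of the coefficients survives. -/
theorem IsSmoothChart.extD1_eq (he : IsSmoothChart m e) {x : X} (hx : x ∈ e.source)
    {Y Z : VField m X} (hY : SmoothVFieldAt Y x) (hZ : SmoothVFieldAt Z x) {η : OneForm m X}
    (hη : DifferentiableAt ℝ (coordForm m e η) (e x)) :
    extD1 η Y Z x = (1 / 2 : ℝ) * (fderiv ℝ (coordForm m e η) (e x) (fwd m e x (Y x))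
        (fwd m e x (Z x))
      - fderiv ℝ (coordForm m e η) (e x) (fwd m e x (Z x)) (fwd m e x (Y x))) := by
  have hY' := (he.contDiffAt_coordField' hx hY).differentiableAt (by simp)
  have hZ' := (he.contDiffAt_coordField' hx hZ).differentiableAt (by simp)
  have h1 : ∀ Z : VField m X, ∀ᶠ y in 𝓝 x,
      η y (Z y) = (fun w => coordForm m e η w (coordField m e Z w)) (e y) := fun Z => by
    filter_upwards [e.open_source.mem_nhds hx] with y hy
    rw [he.form_apply hy, fwd_eq_coordField hy]
  rw [extD1, he.dirDeriv_comp hx (hη.clm_apply hZ') (h1 Z),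
    he.dirDeriv_comp hx (hη.clm_apply hY') (h1 Y), he.form_apply hx, he.fwd_bracket hx hY hZ,
    fderiv_clm_apply hη hZ', fderiv_clm_apply hη hY', VectorField.lieBracket,
    fwd_eq_coordField hx, fwd_eq_coordField hx]
  simp only [add_apply, ContinuousLinearMap.comp_apply,
    ContinuousLinearMap.flip_apply, map_sub]
  ring

theorem fderiv_clm_apply₂_apply {E F G H : Type*} [NormedAddCommGroup E] [NormedSpace ℝ E]
    [NormedAddCommGroup F] [NormedSpace ℝ F] [NormedAddCommGroup G] [NormedSpace ℝ G]
    [NormedAddCommGroup H] [NormedSpace ℝ H] {T : E → F →L[ℝ] G →L[ℝ] H} {V : E → F} {W : E → G}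
    {z : E} (hT : DifferentiableAt ℝ T z) (hV : DifferentiableAt ℝ V z)
    (hW : DifferentiableAt ℝ W z) (u : E) :
    fderiv ℝ (fun y => T y (V y) (W y)) z u
      = fderiv ℝ T z u (V z) (W z) + T z (fderiv ℝ V z u) (W z) + T z (V z) (fderiv ℝ W z u) := by
  rw [fderiv_clm_apply (hT.clm_apply hV) hW, fderiv_clm_apply hT hV]
  simp only [add_apply, ContinuousLinearMap.comp_apply,
    ContinuousLinearMap.flip_apply]
  abel

/-- Again the derivatives of the fields cancel against the brackets. The cancellation exchanges the
two arguments of `T`, which requires antisymmetry, but only at the point itself. -/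
theorem IsSmoothChart.extD2_eq (he : IsSmoothChart m e) {x : X} (hx : x ∈ e.source)
    {Y Z W : VField m X} (hY : SmoothVFieldAt Y x) (hZ : SmoothVFieldAt Z x)
    (hW : SmoothVFieldAt W x) {θ : BilinField m X} {T : E' → E' →L[ℝ] E' →L[ℝ] ℝ}
    (hθ : ∀ y ∈ e.source, ∀ v w, θ y v w = T (e y) (fwd m e y v) (fwd m e y w))
    (hT : DifferentiableAt ℝ T (e x)) (hanti : ∀ v w, T (e x) v w = - T (e x) w v) :
    extD2 θ Y Z W x = (1 / 3 : ℝ) * (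
      fderiv ℝ T (e x) (fwd m e x (Y x)) (fwd m e x (Z x)) (fwd m e x (W x))
      + fderiv ℝ T (e x) (fwd m e x (Z x)) (fwd m e x (W x)) (fwd m e x (Y x))
      + fderiv ℝ T (e x) (fwd m e x (W x)) (fwd m e x (Y x)) (fwd m e x (Z x))) := by
  have hY' := (he.contDiffAt_coordField' hx hY).differentiableAt (by simp)
  have hZ' := (he.contDiffAt_coordField' hx hZ).differentiableAt (by simp)
  have hW' := (he.contDiffAt_coordField' hx hW).differentiableAt (by simp)
  have h1 : ∀ Y Z : VField m X, ∀ᶠ y in 𝓝 x, θ y (Y y) (Z y)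
      = (fun w => T w (coordField m e Y w) (coordField m e Z w)) (e y) := fun Y Z => by
    filter_upwards [e.open_source.mem_nhds hx] with y hy
    rw [hθ y hy, fwd_eq_coordField hy, fwd_eq_coordField hy]
  rw [extD2, he.dirDeriv_comp hx ((hT.clm_apply hZ').clm_apply hW') (h1 Z W),
    he.dirDeriv_comp hx ((hT.clm_apply hW').clm_apply hY') (h1 W Y),
    he.dirDeriv_comp hx ((hT.clm_apply hY').clm_apply hZ') (h1 Y Z),
    hθ x hx, hθ x hx, hθ x hx, he.fwd_bracket hx hY hZ, he.fwd_bracket hx hZ hW,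
    he.fwd_bracket hx hW hY, fderiv_clm_apply₂_apply hT hZ' hW', fderiv_clm_apply₂_apply hT hW' hY',
    fderiv_clm_apply₂_apply hT hY' hZ']
  simp only [VectorField.lieBracket, fwd_eq_coordField hx, map_sub, sub_apply]
  generalize coordField m e Y = Y at *
  generalize coordField m e Z = Z at *
  generalize coordField m e W = W at *
  rw [hanti (Z (e x)) (fderiv ℝ W (e x) (Y (e x))), hanti (W (e x)) (fderiv ℝ Y (e x) (Z (e x))),
    hanti (Y (e x)) (fderiv ℝ Z (e x) (W (e x)))]
  ring

/-- The coordinate expression of the Nijenhuis tensor. -/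
def nijenhuisCoord (φ : E' → E' →L[ℝ] E') (z v w : E') : E' :=
  fderiv ℝ φ z (φ z v) w - fderiv ℝ φ z (φ z w) v + φ z (fderiv ℝ φ z w v)
    - φ z (fderiv ℝ φ z v w)

omit [IsManifold (𝓡 m) ∞ X] [FiniteDimensional ℝ E'] in
theorem coordField_endo (he : IsSmoothChart m e) {x : X} (hx : x ∈ e.source) (φ : EndoField m X)
    (Y : VField m X) : coordField m e (fun y => φ y (Y y))
      =ᶠ[𝓝 (e x)] fun z => coordEndo m e φ z (coordField m e Y z) := by
  filter_upwards [e.open_target.mem_nhds (e.map_source hx)] with z hz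
  have := he.endo_apply (e.map_target hz) φ (Y (e.symm z))
  rw [e.right_inv hz] at this
  exact this

/-- Tensoriality: all terms with derivatives of `Y` and `Z` cancel, without any algebraic relation
on `φ`. -/
theorem IsSmoothChart.fwd_nijenhuis (he : IsSmoothChart m e) {x : X} (hx : x ∈ e.source)
    {Y Z : VField m X} (hY : SmoothVFieldAt Y x) (hZ : SmoothVFieldAt Z x) {φ : EndoField m X}
    (hφ : SmoothEndoField φ) :
    fwd m e x (nijenhuis φ Y Z x)
      = nijenhuisCoord (coordEndo m e φ) (e x) (fwd m e x (Y x)) (fwd m e x (Z x)) := by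
  have hφY : SmoothVFieldAt (fun y => φ y (Y y)) x := ContMDiffAt.clm_bundle_apply (hφ x) hY
  have hφZ : SmoothVFieldAt (fun y => φ y (Z y)) x := ContMDiffAt.clm_bundle_apply (hφ x) hZ
  have hY' := (he.contDiffAt_coordField' hx hY).differentiableAt (by simp)
  have hZ' := (he.contDiffAt_coordField' hx hZ).differentiableAt (by simp)
  have hφ' := (he.contDiffAt_coordEndo (e.map_source hx) hφ).differentiableAt (by simp)
  have hcY := coordField_endo he hx φ Y
  have hcZ := coordField_endo he hx φ Z
  rw [nijenhuis, map_sub, map_sub, map_add, he.endo_apply hx, he.endo_apply hx, he.endo_apply hx,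
    he.endo_apply hx, he.fwd_bracket hx hY hZ, he.fwd_bracket hx hφY hφZ, he.fwd_bracket hx hφY hZ,
    he.fwd_bracket hx hY hφZ]
  simp only [VectorField.lieBracket, hcY.fderiv_eq, hcZ.fderiv_eq, hcY.eq_of_nhds, hcZ.eq_of_nhds,
    fderiv_clm_apply hφ' hY', fderiv_clm_apply hφ' hZ', fwd_eq_coordField hx, nijenhuisCoord,
    add_apply, ContinuousLinearMap.comp_apply,
    ContinuousLinearMap.flip_apply, map_sub, map_add]
  abel

end ChartFormulas

/-! ### Invariance of the structure under the Reeb fields. -/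

section LocalStructure

variable {E : Type*} [NormedAddCommGroup E] [NormedSpace ℝ E]

theorem fderiv_clm_apply_apply {F G H : Type*} [NormedAddCommGroup F] [NormedSpace ℝ F]
    [NormedAddCommGroup G] [NormedSpace ℝ G] [NormedAddCommGroup H] [NormedSpace ℝ H]
    {A : F → G →L[ℝ] H} {V : F → G} {z : F} (hA : DifferentiableAt ℝ A z)
    (hV : DifferentiableAt ℝ V z) (u : F) :
    fderiv ℝ (fun y => A y (V y)) z u = fderiv ℝ A z u (V z) + A z (fderiv ℝ V z u) := by
  rw [fderiv_clm_apply hA hV]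
  simp only [add_apply, ContinuousLinearMap.comp_apply, ContinuousLinearMap.flip_apply]
  abel

theorem fderiv_clm_apply_const {F G H : Type*} [NormedAddCommGroup F] [NormedSpace ℝ F]
    [NormedAddCommGroup G] [NormedSpace ℝ G] [NormedAddCommGroup H] [NormedSpace ℝ H]
    {A : F → G →L[ℝ] H} {z : F} (hA : DifferentiableAt ℝ A z) (v : G) (u : F) :
    fderiv ℝ (fun y => A y v) z u = fderiv ℝ A z u v := by
  rw [fderiv_clm_apply_apply hA (differentiableAt_const v)]
  simp

/-- The bilinear form `(v, w) ↦ g(v, φ w)`. -/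
def bilinComp (g : E →L[ℝ] E →L[ℝ] ℝ) (φ : E →L[ℝ] E) : E →L[ℝ] E →L[ℝ] ℝ :=
  (ContinuousLinearMap.compL ℝ E E ℝ).flip φ ∘L g

@[simp] theorem bilinComp_apply (g : E →L[ℝ] E →L[ℝ] ℝ) (φ : E →L[ℝ] E) (v w : E) :
    bilinComp g φ v w = g v (φ w) := rfl

theorem contDiffAt_bilinComp {F : Type*} [NormedAddCommGroup F] [NormedSpace ℝ F]
    {g : F → E →L[ℝ] E →L[ℝ] ℝ} {φ : F → E →L[ℝ] E} {z : F} {k : WithTop ℕ∞}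
    (hg : ContDiffAt ℝ k g z) (hφ : ContDiffAt ℝ k φ z) :
    ContDiffAt ℝ k (fun y => bilinComp (g y) (φ y)) z :=
  ((ContinuousLinearMap.contDiff _).contDiffAt.comp z hφ).clm_comp hg

/-- A `3`-cosymplectic structure on an open subset of a vector space, as the coordinate expression
of such a structure on a manifold. -/
structure LocalCosymp (U : Set E) where
  φ : Fin 3 → E → E →L[ℝ] E
  ξ : Fin 3 → E → E
  η : Fin 3 → E → E →L[ℝ] ℝ
  g : E → E →L[ℝ] E →L[ℝ] ℝ
  smooth_φ : ∀ α, ∀ z ∈ U, ContDiffAt ℝ ∞ (φ α) z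
  smooth_ξ : ∀ α, ∀ z ∈ U, ContDiffAt ℝ ∞ (ξ α) z
  smooth_η : ∀ α, ∀ z ∈ U, ContDiffAt ℝ ∞ (η α) z
  smooth_g : ∀ z ∈ U, ContDiffAt ℝ ∞ g z
  g_symm : ∀ z ∈ U, ∀ v w, g z v w = g z w v
  g_pos : ∀ z ∈ U, ∀ v, v ≠ 0 → 0 < g z v v
  φ_sq : ∀ α, ∀ z ∈ U, ∀ v, φ α z (φ α z v) = -v + η α z v • ξ α z
  η_ξ : ∀ α, ∀ z ∈ U, η α z (ξ α z) = 1
  φ_φ : ∀ α β, ∀ z ∈ U, ∀ v, φ α z (φ β z v) - η β z v • ξ α z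
    = ∑ γ, eps α β γ • φ γ z v - kron α β • v
  φ_ξ : ∀ α β, ∀ z ∈ U, φ α z (ξ β z) = ∑ γ, eps α β γ • ξ γ z
  η_φ : ∀ α β, ∀ z ∈ U, ∀ v, η α z (φ β z v) = ∑ γ, eps α β γ * η γ z v
  compat : ∀ α, ∀ z ∈ U, ∀ v w, g z (φ α z v) (φ α z w) = g z v w - η α z v * η α z w
  closed_η : ∀ α, ∀ z ∈ U, ∀ v w, fderiv ℝ (η α) z v w = fderiv ℝ (η α) z w v
  closed_Φ : ∀ α, ∀ z ∈ U, ∀ u v w,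
    fderiv ℝ (fun y => bilinComp (g y) (φ α y)) z u v w
      + fderiv ℝ (fun y => bilinComp (g y) (φ α y)) z v w u
      + fderiv ℝ (fun y => bilinComp (g y) (φ α y)) z w u v = 0
  normal : ∀ α, ∀ z ∈ U, ∀ v w, nijenhuisCoord (φ α) z v w = 0

theorem eps_self (α γ : Fin 3) : eps α α γ = 0 := by simp [eps]

namespace LocalCosymp

variable {U : Set E} (S : LocalCosymp U) {z : E}

theorem φ_ξ_self (α : Fin 3) (hz : z ∈ U) : S.φ α z (S.ξ α z) = 0 := by
  simp [S.φ_ξ α α z hz, eps_self]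

theorem η_φ_self (α : Fin 3) (hz : z ∈ U) (v : E) : S.η α z (S.φ α z v) = 0 := by
  simp [S.η_φ α α z hz, eps_self]

theorem ξ_ne_zero (α : Fin 3) (hz : z ∈ U) : S.ξ α z ≠ 0 := fun h => by
  have := S.η_ξ α z hz
  rw [h, map_zero] at this
  exact zero_ne_one this

/-- Put `ξ_α` into the compatibility identity: its left side vanishes since `φ_α ξ_α = 0`. -/
theorem g_ξ (α : Fin 3) (hz : z ∈ U) (v : E) : S.g z (S.ξ α z) v = S.η α z v := by
  have h := S.compat α z hz (S.ξ α z) v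
  rw [S.φ_ξ_self α hz, S.η_ξ α z hz, map_zero, zero_apply] at h
  linarith

/-- For `α ≠ β`, applying `φ_ξ` twice gives `φ_α² ξ_β = -ξ_β`; comparison with `φ_sq` leaves
`η_α(ξ_β) ξ_α = 0`. -/
theorem η_ξ_eq (α β : Fin 3) (hz : z ∈ U) : S.η α z (S.ξ β z) = kron α β := by
  by_cases h : α = β
  · subst h; simp [kron, S.η_ξ α z hz]
  · have h1 := S.φ_sq α z hz (S.ξ β z)
    have h2 : S.φ α z (S.φ α z (S.ξ β z)) = - S.ξ β z := by
      fin_cases α <;> fin_cases β <;>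
        first
        | exact absurd rfl h
        | (norm_num [S.φ_ξ _ _ z hz, Fin.sum_univ_three, eps]; done)
        | (norm_num [S.φ_ξ _ _ z hz, Fin.sum_univ_three, eps]; rfl)
    rw [h2] at h1
    have h3 : S.η α z (S.ξ β z) • S.ξ α z = 0 := by simpa using h1
    simp only [kron, if_neg h]
    exact (smul_eq_zero.1 h3).resolve_right (S.ξ_ne_zero α hz)

/-- The fundamental forms. -/
def Φ (α : Fin 3) (y : E) : E →L[ℝ] E →L[ℝ] ℝ := bilinComp (S.g y) (S.φ α y)

theorem Φ_apply (α : Fin 3) (v w : E) : S.Φ α z v w = S.g z v (S.φ α z w) := rfl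

theorem Φ_anti (α : Fin 3) (hz : z ∈ U) (v w : E) : S.Φ α z v w = - S.Φ α z w v := by
  have h := S.compat α z hz v (S.φ α z w)
  rw [S.φ_sq α z hz, S.η_φ_self α hz, map_add, map_neg, map_smul,
    S.g_symm z hz _ (S.ξ α z), S.g_ξ α hz, S.η_φ_self α hz, S.g_symm z hz _ w] at h
  simp only [Φ_apply]
  simp at h
  linarith

theorem Φ_ξ (α β : Fin 3) (hz : z ∈ U) (v : E) :
    S.Φ β z (S.ξ α z) v = ∑ γ, eps α β γ * S.η γ z v := by
  rw [Φ_apply, S.g_ξ α hz, S.η_φ α β z hz]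

/-- Recovers the metric from tensors whose Lie derivatives are directly accessible; `lie_g` is
obtained by differentiating this identity. -/
theorem g_eq (α : Fin 3) (hz : z ∈ U) (v w : E) :
    S.g z v w = - S.Φ α z v (S.φ α z w) + S.η α z v * S.η α z w := by
  rw [Φ_apply, S.φ_sq α z hz, map_add, map_neg, map_smul, S.g_symm z hz _ (S.ξ α z), S.g_ξ α hz,
    smul_eq_mul]
  ring

theorem contDiffAt_Φ (α : Fin 3) (hz : z ∈ U) : ContDiffAt ℝ ∞ (S.Φ α) z :=
  contDiffAt_bilinComp (S.smooth_g z hz) (S.smooth_φ α z hz)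

theorem dφ (α : Fin 3) (hz : z ∈ U) : DifferentiableAt ℝ (S.φ α) z :=
  (S.smooth_φ α z hz).differentiableAt (by simp)
theorem dξ (α : Fin 3) (hz : z ∈ U) : DifferentiableAt ℝ (S.ξ α) z :=
  (S.smooth_ξ α z hz).differentiableAt (by simp)
theorem dη (α : Fin 3) (hz : z ∈ U) : DifferentiableAt ℝ (S.η α) z :=
  (S.smooth_η α z hz).differentiableAt (by simp)
theorem dg (hz : z ∈ U) : DifferentiableAt ℝ S.g z := (S.smooth_g z hz).differentiableAt (by simp)
theorem dΦ (α : Fin 3) (hz : z ∈ U) : DifferentiableAt ℝ (S.Φ α) z :=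
  (S.contDiffAt_Φ α hz).differentiableAt (by simp)

theorem fderiv_eq_of_eqOn {F : Type*} [NormedAddCommGroup F] [NormedSpace ℝ F] (hU : IsOpen U)
    (hz : z ∈ U) {f k : E → F} (h : ∀ y ∈ U, f y = k y) : fderiv ℝ f z = fderiv ℝ k z :=
  Filter.EventuallyEq.fderiv_eq (by filter_upwards [hU.mem_nhds hz] with y hy using h y hy)

variable (hU : IsOpen U)
include hU

/-- This is `L_{ξ_α} φ_α = 0` in coordinates. Inserting `ξ_α` into the vanishing Nijenhuis tensor
shows that `φ_α` kills the Lie derivative `A` applied to `w`. Closedness of `η_α`, with `η_α(ξ_α) =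
1` and `η_α ∘ φ_α = 0`, gives `η_α(A) = 0`. Then `φ_α² = -I + η_α ⊗ ξ_α` forces `A = 0`. -/
theorem lie_φ_self (α : Fin 3) (hz : z ∈ U) (w : E) :
    fderiv ℝ (S.φ α) z (S.ξ α z) w
      = fderiv ℝ (S.ξ α) z (S.φ α z w) - S.φ α z (fderiv ℝ (S.ξ α) z w) := by
  have hφξ : ∀ u, fderiv ℝ (S.φ α) z u (S.ξ α z) = - S.φ α z (fderiv ℝ (S.ξ α) z u) := fun u => by
    have h := fderiv_eq_of_eqOn hU hz (f := fun y => S.φ α y (S.ξ α y)) (k := fun _ => 0)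
      fun y hy => S.φ_ξ_self α hy
    have h := DFunLike.congr_fun h u
    rw [fderiv_clm_apply_apply (S.dφ α hz) (S.dξ α hz)] at h
    simp at h
    exact eq_neg_of_add_eq_zero_left h
  have hηφ : ∀ u, S.η α z (fderiv ℝ (S.φ α) z u w) = - fderiv ℝ (S.η α) z u (S.φ α z w) :=
    fun u => by
    have h := fderiv_eq_of_eqOn hU hz (f := fun y => S.η α y (S.φ α y w)) (k := fun _ => 0)
      fun y hy => S.η_φ_self α hy w
    have h := DFunLike.congr_fun h u
    rw [fderiv_clm_apply_apply (S.dη α hz) ((S.dφ α hz).clm_apply (differentiableAt_const w)),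
      fderiv_clm_apply_const (S.dφ α hz)] at h
    simp at h
    linarith
  have hηξ : ∀ u, S.η α z (fderiv ℝ (S.ξ α) z u) = - fderiv ℝ (S.η α) z u (S.ξ α z) := fun u => by
    have h := fderiv_eq_of_eqOn hU hz (f := fun y => S.η α y (S.ξ α y)) (k := fun _ => 1)
      fun y hy => S.η_ξ α y hy
    have h := DFunLike.congr_fun h u
    rw [fderiv_clm_apply_apply (S.dη α hz) (S.dξ α hz)] at h
    simp at h
    linarith
  have hN := S.normal α z hz (S.ξ α z) w
  rw [nijenhuisCoord, S.φ_ξ_self α hz, hφξ, hφξ] at hN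
  set A := fderiv ℝ (S.φ α) z (S.ξ α z) w
      - (fderiv ℝ (S.ξ α) z (S.φ α z w) - S.φ α z (fderiv ℝ (S.ξ α) z w)) with hA
  have h1 : S.φ α z A = 0 := by
    simp only [hA, map_sub, map_neg, map_zero, zero_apply] at hN ⊢
    rw [← neg_eq_zero, ← hN]
    abel
  have h2 : S.η α z A = 0 := by
    simp only [hA, map_sub, hηφ, hηξ, S.η_φ_self α hz]
    rw [S.closed_η α z hz]
    ring
  have h3 := S.φ_sq α z hz A
  rw [h1, h2] at h3
  simp at h3
  exact sub_eq_zero.1 h3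

/-- Cartan's formula: `η_β` is closed and `η_β(ξ_α)` is constant. -/
theorem lie_η (α β : Fin 3) (hz : z ∈ U) (w : E) :
    fderiv ℝ (S.η β) z (S.ξ α z) w = - S.η β z (fderiv ℝ (S.ξ α) z w) := by
  have h := fderiv_eq_of_eqOn hU hz (f := fun y => S.η β y (S.ξ α y)) (k := fun _ => kron β α)
      fun y hy => S.η_ξ_eq β α hy
  have h := DFunLike.congr_fun h w
  rw [fderiv_clm_apply_apply (S.dη β hz) (S.dξ α hz), S.closed_η β z hz] at h
  simp at h
  linarith

/-- Cartan's formula again: `Φ_β` is closed, and by `Φ_ξ` its contraction with `ξ_α` is the closed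
form `∑ ε_{αβγ} η_γ`. -/
theorem lie_Φ (α β : Fin 3) (hz : z ∈ U) (v w : E) :
    fderiv ℝ (S.Φ β) z (S.ξ α z) v w
      = - S.Φ β z (fderiv ℝ (S.ξ α) z v) w - S.Φ β z v (fderiv ℝ (S.ξ α) z w) := by
  have hanti : ∀ u v w, fderiv ℝ (S.Φ β) z u v w = - fderiv ℝ (S.Φ β) z u w v := fun u v w => by
    have h := fderiv_eq_of_eqOn hU hz (f := fun y => S.Φ β y v w) (k := fun y => - S.Φ β y w v)
      fun y hy => S.Φ_anti β hy v w
    have h := DFunLike.congr_fun h u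
    rw [fderiv_fun_neg, neg_apply] at h
    rwa [fderiv_clm_apply_const ((S.dΦ β hz).clm_apply (differentiableAt_const v)),
      fderiv_clm_apply_const ((S.dΦ β hz).clm_apply (differentiableAt_const w)),
      fderiv_clm_apply_const (S.dΦ β hz), fderiv_clm_apply_const (S.dΦ β hz)] at h
  have hθ : ∀ u v, fderiv ℝ (S.Φ β) z u (S.ξ α z) v + S.Φ β z (fderiv ℝ (S.ξ α) z u) v
      = ∑ γ, eps α β γ * fderiv ℝ (S.η γ) z u v := fun u v => by
    have h := fderiv_eq_of_eqOn hU hz (f := fun y => S.Φ β y (S.ξ α y) v)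
      (k := fun y => ∑ γ, eps α β γ * S.η γ y v) fun y hy => S.Φ_ξ α β hy v
    have h := DFunLike.congr_fun h u
    rw [fderiv_clm_apply₂_apply (S.dΦ β hz) (S.dξ α hz) (differentiableAt_const v)] at h
    rw [fderiv_fun_sum fun γ _ => ((S.dη γ hz).clm_apply (differentiableAt_const v)).const_mul _]
      at h
    simp only [sum_apply] at h
    have h2 : ∀ γ, fderiv ℝ (fun y => eps α β γ * S.η γ y v) z u
        = eps α β γ * fderiv ℝ (S.η γ) z u v := fun γ => by
      rw [fderiv_const_mul ((S.dη γ hz).clm_apply (differentiableAt_const v)), smul_apply,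
        fderiv_clm_apply_const (S.dη γ hz), smul_eq_mul]
    simp only [h2] at h
    simpa using h
  have hc : fderiv ℝ (S.Φ β) z (S.ξ α z) v w + fderiv ℝ (S.Φ β) z v w (S.ξ α z)
      + fderiv ℝ (S.Φ β) z w (S.ξ α z) v = 0 := S.closed_Φ β z hz (S.ξ α z) v w
  have h1 := hθ v w
  have h2 := hθ w v
  have h3 : ∑ γ, eps α β γ * fderiv ℝ (S.η γ) z v w = ∑ γ, eps α β γ * fderiv ℝ (S.η γ) z w v :=
    Finset.sum_congr rfl fun γ _ => by rw [S.closed_η γ z hz]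
  have h4 := hanti v w (S.ξ α z)
  have h5 := S.Φ_anti β hz v (fderiv ℝ (S.ξ α) z w)
  linarith

/-- Every ingredient of `g_eq` for the same index `α` is invariant under `ξ_α`. The index has to be
the same, as invariance of `φ_β` for `β ≠ α` is itself deduced from that of `g`. -/
theorem lie_g (α : Fin 3) (hz : z ∈ U) (v w : E) :
    fderiv ℝ S.g z (S.ξ α z) v w
      = - S.g z (fderiv ℝ (S.ξ α) z v) w - S.g z v (fderiv ℝ (S.ξ α) z w) := by
  have dc : ∀ v : E, DifferentiableAt ℝ (fun _ : E => v) z := fun v => differentiableAt_const v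
  have h := fderiv_eq_of_eqOn hU hz (f := fun y => S.g y v w)
    (k := fun y => - S.Φ α y v (S.φ α y w) + S.η α y v * S.η α y w) fun y hy => S.g_eq α hy v w
  have h := DFunLike.congr_fun h (S.ξ α z)
  have d1 := ((S.dΦ α hz).clm_apply (dc v)).clm_apply ((S.dφ α hz).clm_apply (dc w))
  rw [fderiv_clm_apply_const ((S.dg hz).clm_apply (dc v)), fderiv_clm_apply_const (S.dg hz),
    fderiv_fun_add d1.fun_neg (((S.dη α hz).clm_apply (dc v)).fun_mul ((S.dη α hz).clm_apply (dc w))),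
    fderiv_fun_neg, fderiv_fun_mul ((S.dη α hz).clm_apply (dc v)) ((S.dη α hz).clm_apply (dc w)),
    add_apply, neg_apply, add_apply, smul_apply, smul_apply,
    fderiv_clm_apply_const (S.dη α hz), fderiv_clm_apply_const (S.dη α hz),
    fderiv_clm_apply₂_apply (S.dΦ α hz) (dc v) ((S.dφ α hz).clm_apply (dc w)),
    fderiv_clm_apply_const (S.dφ α hz), S.lie_Φ hU α α hz, S.lie_φ_self hU α hz,
    S.lie_η hU α α hz, S.lie_η hU α α hz] at h
  rw [h, S.g_eq α hz, S.g_eq α hz v]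
  simp only [fderiv_const_apply, zero_apply, map_zero, map_sub, smul_eq_mul]
  ring

omit hU in
theorem g_ext (hz : z ∈ U) {v w : E} (h : ∀ u, S.g z u v = S.g z u w) : v = w := by
  by_contra hne
  have h1 := S.g_pos z hz (v - w) (sub_ne_zero.2 hne)
  have h2 : S.g z (v - w) (v - w) = 0 := by rw [map_sub, h, sub_self]
  exact h1.ne' h2

/-- By `g_ξ` the field `ξ_β` is the metric dual of `η_β`. Both `g` and `η_β` are invariant under
`ξ_α`, hence so is `ξ_β`. -/
theorem ξ_commute (α β : Fin 3) (hz : z ∈ U) :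
    fderiv ℝ (S.ξ β) z (S.ξ α z) = fderiv ℝ (S.ξ α) z (S.ξ β z) := by
  refine S.g_ext hz fun w => ?_
  have dc : ∀ v : E, DifferentiableAt ℝ (fun _ : E => v) z := fun v => differentiableAt_const v
  have h := fderiv_eq_of_eqOn hU hz (f := fun y => S.η β y w)
    (k := fun y => S.g y (S.ξ β y) w) fun y hy => (S.g_ξ β hy w).symm
  have h := DFunLike.congr_fun h (S.ξ α z)
  rw [fderiv_clm_apply_const (S.dη β hz), S.lie_η hU α β hz,
    fderiv_clm_apply₂_apply (S.dg hz) (S.dξ β hz) (dc w), S.lie_g hU α hz, ← S.g_ξ β hz] at h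
  simp only [fderiv_const_apply, zero_apply, map_zero] at h
  rw [S.g_symm z hz w, S.g_symm z hz w]
  linarith

/-- Normality controls `φ_α` only along its own Reeb field. For mixed indices, `φ_β` is recovered
from the invariant tensors `g` and `Φ_β` by nondegeneracy of `g`. -/
theorem lie_φ (α β : Fin 3) (hz : z ∈ U) (w : E) :
    fderiv ℝ (S.φ β) z (S.ξ α z) w
      = fderiv ℝ (S.ξ α) z (S.φ β z w) - S.φ β z (fderiv ℝ (S.ξ α) z w) := by
  refine S.g_ext hz fun v => ?_
  have dc : ∀ v : E, DifferentiableAt ℝ (fun _ : E => v) z := fun v => differentiableAt_const v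
  have h := fderiv_eq_of_eqOn hU hz (f := fun y => S.Φ β y v w)
    (k := fun y => S.g y v (S.φ β y w)) fun y hy => rfl
  have h := DFunLike.congr_fun h (S.ξ α z)
  rw [fderiv_clm_apply_const ((S.dΦ β hz).clm_apply (dc v)), fderiv_clm_apply_const (S.dΦ β hz),
    S.lie_Φ hU α β hz, fderiv_clm_apply₂_apply (S.dg hz) (dc v) ((S.dφ β hz).clm_apply (dc w)),
    fderiv_clm_apply_const (S.dφ β hz), S.lie_g hU α hz, Φ_apply, Φ_apply] at h
  simp only [fderiv_const_apply, zero_apply, map_zero] at h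
  rw [map_sub]
  linarith

end LocalCosymp

end LocalStructure

/-! ### Inverse function theorem. -/

section InverseFunction

/-- The inverse function theorem for smooth maps, with smoothness on the whole domain of the local
inverse. -/
theorem exists_smooth_openPartialHomeomorph {E F : Type*} [NormedAddCommGroup E] [NormedSpace ℝ E]
    [CompleteSpace E] [NormedAddCommGroup F] [NormedSpace ℝ F] {f : E → F} {a : E} {f' : E ≃L[ℝ] F}
    {W : Set E} (hW : W ∈ 𝓝 a) (hf : ∀ y ∈ W, ContDiffAt ℝ ∞ f y)
    (hf' : HasFDerivAt f (f' : E →L[ℝ] F) a) :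
    ∃ Ψ : OpenPartialHomeomorph E F, (∀ y, Ψ y = f y) ∧ a ∈ Ψ.source ∧ Ψ.source ⊆ W ∧
      (∀ y ∈ Ψ.source, ∃ A : E ≃L[ℝ] F, (A : E →L[ℝ] F) = fderiv ℝ f y) ∧
      ∀ z ∈ Ψ.target, ContDiffAt ℝ ∞ Ψ.symm z := by
  have ha : a ∈ W := mem_of_mem_nhds hW
  let Ψ₀ := (hf a ha).toOpenPartialHomeomorph f hf' (by simp)
  have hcont : ContinuousAt (fderiv ℝ f) a :=
    ((hf a ha).fderiv_right (m := 0) (by simp)).continuousAt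
  -- Invertible operators form an open set. Shrinking to points with invertible derivative makes the
  -- local inverse smooth on its entire target, not only at the image of `a`.
  have h1 : ∀ᶠ y in 𝓝 a, fderiv ℝ f y ∈ Set.range ((↑) : (E ≃L[ℝ] F) → E →L[ℝ] F) := by
    refine hcont.eventually ?_
    rw [hf'.fderiv]
    exact ContinuousLinearEquiv.nhds f'
  obtain ⟨V, hVsub, hVo, haV⟩ := mem_nhds_iff.1 (Filter.inter_mem hW h1)
  refine ⟨Ψ₀.restrOpen V hVo, fun y => rfl, ⟨(hf a ha).mem_toOpenPartialHomeomorph_source hf' _, haV⟩,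
    fun y hy => (hVsub hy.2).1, fun y hy => (hVsub hy.2).2, fun z hz => ?_⟩
  have hz' : (Ψ₀.restrOpen V hVo).symm z ∈ (Ψ₀.restrOpen V hVo).source :=
    (Ψ₀.restrOpen V hVo).map_target hz
  obtain ⟨A, hA⟩ := (hVsub hz'.2).2
  have hs := hf _ (hVsub hz'.2).1
  refine (Ψ₀.restrOpen V hVo).contDiffAt_symm (f₀' := A) hz ?_ hs
  rw [hA]
  exact (hs.differentiableAt (by simp)).hasFDerivAt

end InverseFunction

/-! ### Superposition operators on the Banach space of curves. -/

section Superposition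

open unitInterval

/-- Continuous curves `[0, 1] → E`, with the supremum norm. -/
def Curve (E : Type v) [NormedAddCommGroup E] : Type v := C(I, E)

namespace Curve

variable {E F : Type v} [NormedAddCommGroup E] [NormedAddCommGroup F]

instance : NormedAddCommGroup (Curve E) := inferInstanceAs (NormedAddCommGroup C(I, E))
instance [NormedSpace ℝ E] : NormedSpace ℝ (Curve E) := inferInstanceAs (NormedSpace ℝ C(I, E))
instance [CompleteSpace E] : CompleteSpace (Curve E) := inferInstanceAs (CompleteSpace C(I, E))
instance : FunLike (Curve E) I E := inferInstanceAs (FunLike C(I, E) I E)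

theorem continuous (u : Curve E) : Continuous u := ContinuousMap.continuous u

/-- The curve defined by a continuous function. -/
def mk (f : I → E) (hf : Continuous f) : Curve E := (⟨f, hf⟩ : C(I, E))

@[simp] theorem mk_apply (f : I → E) (hf : Continuous f) (t : I) : mk f hf t = f t := rfl

@[ext] theorem ext {u w : Curve E} (h : ∀ t, u t = w t) : u = w := DFunLike.ext _ _ h

@[simp] theorem add_apply (u w : Curve E) (t : I) : (u + w) t = u t + w t := rfl
@[simp] theorem sub_apply (u w : Curve E) (t : I) : (u - w) t = u t - w t := rfl
@[simp] theorem zero_apply (t : I) : (0 : Curve E) t = 0 := rfl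
@[simp] theorem smul_apply [NormedSpace ℝ E] (c : ℝ) (u : Curve E) (t : I) :
    (c • u) t = c • u t := rfl

theorem norm_apply_le (u : Curve E) (t : I) : ‖u t‖ ≤ ‖u‖ := ContinuousMap.norm_coe_le_norm u t

theorem norm_le {u : Curve E} {C : ℝ} (hC : 0 ≤ C) : ‖u‖ ≤ C ↔ ∀ t, ‖u t‖ ≤ C :=
  ContinuousMap.norm_le _ hC

/-- The superposition operator `u ↦ v ∘ u`. -/
def map (v : E → F) (hv : Continuous v) (u : Curve E) : Curve F := mk (v ∘ u) (hv.comp u.continuous)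

@[simp] theorem map_apply (v : E → F) (hv : Continuous v) (u : Curve E) (t : I) :
    map v hv u t = v (u t) := rfl

theorem continuous_map {v : E → F} (hv : Continuous v) : Continuous (map v hv) :=
  ContinuousMap.continuous_postcomp (X := I) (⟨v, hv⟩ : C(E, F))

end Curve

variable {E F : Type v} [NormedAddCommGroup E] [NormedSpace ℝ E]
  [NormedAddCommGroup F] [NormedSpace ℝ F]

/-- Evaluation of curves. -/
def Curve.evalL (E : Type v) [NormedAddCommGroup E] [NormedSpace ℝ E] (t : I) : Curve E →L[ℝ] E :=
  LinearMap.mkContinuous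
    { toFun := fun u => u t, map_add' := fun _ _ => rfl, map_smul' := fun _ _ => rfl } 1
    fun u => by rw [one_mul]; exact u.norm_apply_le t

@[simp] theorem Curve.evalL_apply (t : I) (u : Curve E) : Curve.evalL E t u = u t := rfl

/-- Constant curves. -/
def constL (E : Type v) [NormedAddCommGroup E] [NormedSpace ℝ E] : E →L[ℝ] Curve E :=
  LinearMap.mkContinuous
    { toFun := fun x => Curve.mk (fun _ => x) continuous_const
      map_add' := fun _ _ => rfl, map_smul' := fun _ _ => rfl } 1
    fun x => by
      rw [one_mul]
      exact (Curve.norm_le (norm_nonneg _)).2 fun t => le_rfl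

@[simp] theorem constL_apply (x : E) (t : I) : constL E x t = x := rfl

/-- Pointwise application of a curve of operators to a curve of vectors. -/
def pointwiseApply (E F : Type v) [NormedAddCommGroup E] [NormedSpace ℝ E]
    [NormedAddCommGroup F] [NormedSpace ℝ F] : Curve (E →L[ℝ] F) →L[ℝ] Curve E →L[ℝ] Curve F :=
  LinearMap.mkContinuous₂
    (LinearMap.mk₂ ℝ (fun (A : Curve (E →L[ℝ] F)) (h : Curve E) =>
        Curve.mk (fun t => A t (h t)) (A.continuous.clm_apply h.continuous))
      (fun _ _ _ => by ext; simp) (fun _ _ _ => by ext; simp) (fun _ _ _ => by ext; simp)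
      (fun _ _ _ => by ext; simp)) 1 (fun A h => by
        rw [one_mul]
        refine (Curve.norm_le (by positivity)).2 fun t => ?_
        exact ((A t).le_opNorm _).trans (mul_le_mul (A.norm_apply_le t) (h.norm_apply_le t)
          (norm_nonneg _) (norm_nonneg _)))

@[simp] theorem pointwiseApply_apply (A : Curve (E →L[ℝ] F)) (h : Curve E) (t : I) :
    pointwiseApply E F A h t = A t (h t) := rfl

/-- The mean value inequality is applied on the segment from `u t` to `u t + h t`. Uniformity in `t`
comes from continuity, in the supremum norm, of the superposition operator of `fderiv ℝ v`,
evaluated at the curves `u + θ • h`. -/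
theorem hasFDerivAt_superposition {v : E → F} (hv : ContDiff ℝ 1 v) (u : Curve E) :
    HasFDerivAt (Curve.map v hv.continuous)
      (pointwiseApply E F (Curve.map (fderiv ℝ v) (hv.continuous_fderiv (by simp)) u)) u := by
  rw [hasFDerivAt_iff_isLittleO_nhds_zero, Asymptotics.isLittleO_iff]
  intro c hc
  have hcont := (Curve.continuous_map (hv.continuous_fderiv (by simp))).continuousAt (x := u)
  obtain ⟨δ, hδ, hball⟩ := Metric.continuousAt_iff.1 hcont c hc
  filter_upwards [Metric.ball_mem_nhds (0 : Curve E) hδ] with h hh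
  rw [mem_ball_zero_iff] at hh
  refine (Curve.norm_le (by positivity)).2 fun t => ?_
  have hseg := (convex_segment (u t) (u t + h t)).norm_image_sub_le_of_norm_fderiv_le'
    (𝕜 := ℝ) (f := v) (φ := fderiv ℝ v (u t)) (C := c) (x := u t) (y := u t + h t)
    (fun x _ => hv.differentiable (by simp) x) (fun x hx => ?_) (left_mem_segment ℝ _ _)
    (right_mem_segment ℝ _ _)
  · simp only [add_sub_cancel_left] at hseg
    exact hseg.trans (mul_le_mul_of_nonneg_left (h.norm_apply_le t) hc.le)
  · rw [segment_eq_image'] at hx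
    obtain ⟨θ, hθ, rfl⟩ := hx
    have h1 : dist (u + θ • h) u < δ := by
      rw [dist_eq_norm, add_sub_cancel_left, norm_smul, Real.norm_of_nonneg hθ.1]
      exact (mul_le_of_le_one_left (norm_nonneg _) hθ.2).trans_lt hh
    have h2 := hball h1
    rw [dist_eq_norm] at h2
    have h3 := (Curve.norm_apply_le _ t).trans h2.le
    simpa using h3

/-- The derivative is the superposition operator of `fderiv ℝ v` followed by a bounded linear map,
so the induction gains one order at each step. The codomain is quantified inside because it changes
from `F` to `E →L[ℝ] F`. -/
theorem contDiff_superposition_nat (n : ℕ) : ∀ {F : Type v} [NormedAddCommGroup F]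
    [NormedSpace ℝ F] {v : E → F} (hv : ContDiff ℝ ∞ v),
    ContDiff ℝ n (Curve.map v hv.continuous) := by
  induction n with
  | zero =>
    intro F _ _ v hv
    exact contDiff_zero.2 (Curve.continuous_map _)
  | succ n ih =>
    intro F _ _ v hv
    have hv' : ContDiff ℝ ∞ (fderiv ℝ v) := hv.fderiv_right (by simp)
    exact contDiff_succ_iff_hasFDerivAt.2 ⟨fun u => pointwiseApply E F
      (Curve.map (fderiv ℝ v) hv'.continuous u), (pointwiseApply E F).contDiff.comp (ih hv'),
        fun u => hasFDerivAt_superposition (hv.of_le (by simp)) u⟩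

/-- The superposition operator of a smooth map is smooth. -/
theorem contDiff_superposition {v : E → F} (hv : ContDiff ℝ ∞ v) :
    ContDiff ℝ ∞ (Curve.map v hv.continuous) :=
  contDiff_infty.2 fun n => contDiff_superposition_nat n hv

omit [NormedSpace ℝ E] in
theorem intervalIntegrable_projIcc (u : Curve E) (a b : ℝ) : IntervalIntegrable
    (fun s => u (Set.projIcc 0 1 zero_le_one s)) MeasureTheory.volume a b :=
  (u.continuous.comp continuous_projIcc).intervalIntegrable a b

/-- The operator taking a curve to its primitive. -/
def primitiveL (E : Type v) [NormedAddCommGroup E] [NormedSpace ℝ E] [CompleteSpace E] :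
    Curve E →L[ℝ] Curve E :=
  LinearMap.mkContinuous
    { toFun := fun u => Curve.mk (fun t => ∫ s in (0 : ℝ)..t, u (Set.projIcc 0 1 zero_le_one s))
        ((intervalIntegral.continuous_primitive (intervalIntegrable_projIcc u) 0).comp
          continuous_subtype_val)
      map_add' := fun u w => by
        ext t
        exact intervalIntegral.integral_add (intervalIntegrable_projIcc u _ _)
          (intervalIntegrable_projIcc w _ _)
      map_smul' := fun c u => by
        ext t
        exact intervalIntegral.integral_smul c _ }
    1 (fun u => by
      rw [one_mul]
      refine (Curve.norm_le (norm_nonneg _)).2 fun t => ?_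
      refine (intervalIntegral.norm_integral_le_of_norm_le_const (C := ‖u‖)
        fun s _ => u.norm_apply_le _).trans ?_
      rw [sub_zero, abs_of_nonneg t.2.1]
      exact mul_le_of_le_one_right (norm_nonneg _) t.2.2)

theorem primitiveL_apply [CompleteSpace E] (u : Curve E) (t : I) :
    primitiveL E u t = ∫ s in (0 : ℝ)..t, u (Set.projIcc 0 1 zero_le_one s) := rfl

end Superposition

/-! ### Joint flow of commuting vector fields. -/

section CommutingFlow

open unitInterval

variable {E : Type v} [NormedAddCommGroup E] [NormedSpace ℝ E] [CompleteSpace E]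
  {ι : Type} [Fintype ι]

/-- The map whose zeros in the curve variable are the integral curves of `∑ s_α ξ_α`. -/
def picardDefect (ξ : ι → E → E) (hξ : ∀ α, ContDiff ℝ ∞ (ξ α))
    (q : (E × (ι → ℝ)) × Curve E) : Curve E :=
  q.2 - constL E q.1.1
    - ∑ α, q.1.2 α • primitiveL E (Curve.map (ξ α) (hξ α).continuous q.2)

variable {ξ : ι → E → E} (hξ : ∀ α, ContDiff ℝ ∞ (ξ α))

theorem contDiff_picardDefect : ContDiff ℝ ∞ (picardDefect ξ hξ) := by
  have h1 : ContDiff ℝ ∞ (fun q : (E × (ι → ℝ)) × Curve E => q.2 - constL E q.1.1) := by fun_prop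
  refine h1.sub (ContDiff.sum fun α _ => ?_)
  have h2 : ContDiff ℝ ∞ (fun q : (E × (ι → ℝ)) × Curve E =>
      primitiveL E (Curve.map (ξ α) (hξ α).continuous q.2)) :=
    (primitiveL E).contDiff.comp ((contDiff_superposition (hξ α)).comp contDiff_snd)
  have h3 : ContDiff ℝ ∞ (fun q : (E × (ι → ℝ)) × Curve E => q.1.2 α) := by fun_prop
  exact h3.smul h2

theorem hasFDerivAt_picardDefect (q : (E × (ι → ℝ)) × Curve E) :
    HasFDerivAt (picardDefect ξ hξ) (fderiv ℝ (picardDefect ξ hξ) q) q :=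
  ((contDiff_picardDefect hξ).differentiable (by simp) q).hasFDerivAt

theorem fderiv_picardDefect_apply (q r : (E × (ι → ℝ)) × Curve E) :
    fderiv ℝ (picardDefect ξ hξ) q r = r.2 - constL E r.1.1
      - ∑ α, (r.1.2 α • primitiveL E (Curve.map (ξ α) (hξ α).continuous q.2)
        + q.1.2 α • primitiveL E (pointwiseApply E E
          (Curve.map (fderiv ℝ (ξ α)) ((hξ α).continuous_fderiv (by simp)) q.2) r.2)) := by
  have hα : ∀ α, HasFDerivAt (fun q : (E × (ι → ℝ)) × Curve E =>
      q.1.2 α • primitiveL E (Curve.map (ξ α) (hξ α).continuous q.2)) _ q := fun α =>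
    HasFDerivAt.smul
      (((ContinuousLinearMap.proj (R := ℝ) (φ := fun _ : ι => ℝ) α) ∘L
        (ContinuousLinearMap.snd ℝ E (ι → ℝ)) ∘L
          (ContinuousLinearMap.fst ℝ (E × (ι → ℝ)) (Curve E))).hasFDerivAt)
      ((primitiveL E).hasFDerivAt.comp q ((hasFDerivAt_superposition
        ((hξ α).of_le (by simp)) q.2).comp q hasFDerivAt_snd))
  have h := ((hasFDerivAt_snd (𝕜 := ℝ) (p := q)).sub ((constL E).hasFDerivAt.comp q
    (hasFDerivAt_fst.comp q (hasFDerivAt_fst (𝕜 := ℝ) (p := q))))).sub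
    (HasFDerivAt.fun_sum (u := Finset.univ) fun α _ => hα α)
  have h' : HasFDerivAt (picardDefect ξ hξ) _ q := h
  rw [h'.fderiv]
  simp [add_comm]

/-- The inverse of the differential of `(p, u) ↦ (p, picardDefect (p, u))` at a constant curve. -/
def picardEquiv (E : Type v) [NormedAddCommGroup E] [NormedSpace ℝ E] [CompleteSpace E]
    (A : (E × (ι → ℝ)) →L[ℝ] Curve E) :
    ((E × (ι → ℝ)) × Curve E) ≃L[ℝ] ((E × (ι → ℝ)) × Curve E) :=
  ContinuousLinearEquiv.equivOfInverse
    ((ContinuousLinearMap.fst ℝ _ _).prod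
      (ContinuousLinearMap.snd ℝ _ _ - A ∘L ContinuousLinearMap.fst ℝ _ _))
    ((ContinuousLinearMap.fst ℝ _ _).prod
      (ContinuousLinearMap.snd ℝ _ _ + A ∘L ContinuousLinearMap.fst ℝ _ _))
    (fun q => by simp) (fun q => by simp)

/-- Smooth local solutions of `u' = ∑ s_α ξ_α(u)`, `u(0) = x`, together with the injectivity of the
linearised equation. -/
theorem exists_smooth_solution (x₀ : E) {ε : ℝ} (hε : 0 < ε) :
    ∃ u : E × (ι → ℝ) → Curve E, ∀ᶠ p in 𝓝 ((x₀, 0) : E × (ι → ℝ)),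
      ContDiffAt ℝ ∞ u p ∧ picardDefect ξ hξ (p, u p) = 0 ∧ (∀ t, u p t ∈ Metric.ball x₀ ε) ∧
      ∀ r h k, fderiv ℝ (picardDefect ξ hξ) (p, u p) (r, h) = 0 →
        fderiv ℝ (picardDefect ξ hξ) (p, u p) (r, k) = 0 → h = k := by
  -- Keeping the parameter as a component of the value turns the implicit equation `picardDefect (p,
  -- u) = 0` into the inversion of `𝓕`.
  let 𝓕 : (E × (ι → ℝ)) × Curve E → (E × (ι → ℝ)) × Curve E :=
    fun q => (q.1, picardDefect ξ hξ q)
  let a : (E × (ι → ℝ)) × Curve E := ((x₀, 0), constL E x₀)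
  have h𝓕 : ContDiff ℝ ∞ 𝓕 := contDiff_fst.prodMk (contDiff_picardDefect hξ)
  have hd : ∀ q, HasFDerivAt 𝓕 ((ContinuousLinearMap.fst ℝ _ _).prod
      (fderiv ℝ (picardDefect ξ hξ) q)) q := fun q =>
    hasFDerivAt_fst.prodMk (hasFDerivAt_picardDefect hξ q)
  let A : (E × (ι → ℝ)) →L[ℝ] Curve E :=
    - (fderiv ℝ (picardDefect ξ hξ) a ∘L ContinuousLinearMap.inl ℝ _ _)
  have hda : HasFDerivAt 𝓕 (picardEquiv E A : _ →L[ℝ] _) a := by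
    convert hd a using 1
    refine ContinuousLinearMap.ext fun r => ?_
    refine Prod.ext rfl ?_
    change r.2 - A r.1 = fderiv ℝ (picardDefect ξ hξ) a r
    have h1 : A r.1 = - fderiv ℝ (picardDefect ξ hξ) a (r.1, 0) := rfl
    have h2 : fderiv ℝ (picardDefect ξ hξ) a r = fderiv ℝ (picardDefect ξ hξ) a (r.1, 0)
        + fderiv ℝ (picardDefect ξ hξ) a (0, r.2) := by
      rw [← map_add]; simp
    -- At `s = 0` the integral terms drop out in the curve direction, so the partial differential is
    -- the identity. Smallness of `s` replaces shortness of time.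
    have h3 : fderiv ℝ (picardDefect ξ hξ) a (0, r.2) = r.2 := by
      rw [fderiv_picardDefect_apply]
      simp [a]
    rw [h1, h2, h3]
    abel
  obtain ⟨Ψ, hΨ, haΨ, -, hinv, hsm⟩ := exists_smooth_openPartialHomeomorph (W := Set.univ)
    Filter.univ_mem (fun y _ => h𝓕.contDiffAt) hda
  have h𝓕a : 𝓕 a = ((x₀, 0), 0) := by
    simp [𝓕, a, picardDefect]
  have hΨa : Ψ a = ((x₀, 0), 0) := (hΨ a).trans h𝓕a
  have htgt : (((x₀, 0), 0) : (E × (ι → ℝ)) × Curve E) ∈ Ψ.target := hΨa ▸ Ψ.map_source haΨ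
  let j : E × (ι → ℝ) → (E × (ι → ℝ)) × Curve E := fun p => (p, 0)
  have hj : ContDiff ℝ ∞ j := contDiff_id.prodMk contDiff_const
  refine ⟨fun p => (Ψ.symm (j p)).2, ?_⟩
  have hev : ∀ᶠ p in 𝓝 ((x₀, 0) : E × (ι → ℝ)), j p ∈ Ψ.target :=
    hj.continuous.continuousAt.eventually (Ψ.open_target.mem_nhds htgt)
  have hsmall : ∀ᶠ p in 𝓝 ((x₀, 0) : E × (ι → ℝ)),
      (Ψ.symm (j p)).2 ∈ Metric.ball (constL E x₀) ε := by
    have hc : ContinuousAt (fun p => (Ψ.symm (j p)).2) ((x₀, 0) : E × (ι → ℝ)) :=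
      continuousAt_snd.comp (ContinuousAt.comp (g := Ψ.symm) (f := j)
        (Ψ.continuousAt_symm htgt) hj.continuous.continuousAt)
    refine hc.eventually ?_
    have : Ψ.symm (j (x₀, 0)) = a := by
      rw [← Ψ.left_inv haΨ, hΨa]
    change ∀ᶠ y in 𝓝 (Ψ.symm (j (x₀, 0))).2, y ∈ Metric.ball (constL E x₀) ε
    rw [this]
    exact Metric.ball_mem_nhds _ hε
  filter_upwards [hev, hsmall] with p hp hps
  have hright : 𝓕 (Ψ.symm (j p)) = j p := (hΨ _).symm.trans (Ψ.right_inv hp)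
  have hfst : (Ψ.symm (j p)).1 = p := congrArg Prod.fst hright
  have hpair : (p, (Ψ.symm (j p)).2) = Ψ.symm (j p) := Prod.ext hfst.symm rfl
  refine ⟨contDiffAt_snd.comp p ((hsm _ hp).comp p hj.contDiffAt), ?_, fun t => ?_, ?_⟩
  · rw [hpair]
    exact congrArg Prod.snd hright
  · rw [mem_ball_iff_norm] at hps ⊢
    exact (Curve.norm_apply_le ((Ψ.symm (j p)).2 - constL E x₀) t).trans_lt hps
  · intro r h k hh hk
    -- The differential of `𝓕` is invertible at the solution as well, so a solution of the
    -- linearised equation is determined by its parameter direction.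
    obtain ⟨B, hB⟩ := hinv _ (Ψ.map_target hp)
    rw [(hd _).fderiv, ← hpair] at hB
    have : B (r, h) = B (r, k) := by
      change (B : ((E × (ι → ℝ)) × Curve E) →L[ℝ] ((E × (ι → ℝ)) × Curve E)) (r, h)
        = (B : ((E × (ι → ℝ)) × Curve E) →L[ℝ] ((E × (ι → ℝ)) × Curve E)) (r, k)
      rw [hB]
      exact Prod.ext rfl (hh.trans hk.symm)
    exact congrArg Prod.snd (B.injective this)

theorem hasDerivAt_primitive (u : Curve E) (t : ℝ) :
    HasDerivAt (fun t => ∫ s in (0 : ℝ)..t, u (Set.projIcc 0 1 zero_le_one s))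
      (u (Set.projIcc 0 1 zero_le_one t)) t :=
  (u.continuous.comp continuous_projIcc).integral_hasStrictDerivAt 0 t |>.hasDerivAt

/-- For commuting vector fields, `t ↦ t ξ_α(u(t))` solves the linearised equation along a solution
`u`. -/
theorem linearised_solution {x₀ : E} {ε : ℝ}
    (hcomm : ∀ y ∈ Metric.ball x₀ ε, ∀ α β,
      fderiv ℝ (ξ α) y (ξ β y) = fderiv ℝ (ξ β) y (ξ α y))
    {p : E × (ι → ℝ)} {u : Curve E} (hu : picardDefect ξ hξ (p, u) = 0)
    (hball : ∀ t, u t ∈ Metric.ball x₀ ε) (α : ι) [DecidableEq ι] :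
    fderiv ℝ (picardDefect ξ hξ) (p, u) ((0, Pi.single α 1),
      Curve.mk (fun t => (t : ℝ) • ξ α (u t))
        (continuous_subtype_val.smul ((hξ α).continuous.comp u.continuous))) = 0 := by
  have hproj : ∀ t : I, Set.projIcc (0 : ℝ) 1 zero_le_one t = t := fun t => Set.projIcc_val _ t
  -- The integral formula for `u`, extended to all real times so that it can be differentiated at
  -- the endpoints too.
  let w : ℝ → E := fun t => p.1 + ∑ β, p.2 β •
    ∫ s in (0 : ℝ)..t, Curve.map (ξ β) (hξ β).continuous u (Set.projIcc 0 1 zero_le_one s)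
  have hw : ∀ t : I, w t = u t := fun t => by
    have h := DFunLike.congr_fun hu t
    simp only [picardDefect, Curve.sub_apply, Curve.zero_apply, constL_apply] at h
    have hs : (∑ β, p.2 β • primitiveL E (Curve.map (ξ β) (hξ β).continuous u)) t
        = ∑ β, p.2 β • primitiveL E (Curve.map (ξ β) (hξ β).continuous u) t :=
      map_sum (Curve.evalL E t) _ _
    rw [hs, sub_sub, sub_eq_zero] at h
    exact h.symm
  have hw' : ∀ t : ℝ, HasDerivAt w
      (∑ β, p.2 β • ξ β (u (Set.projIcc 0 1 zero_le_one t))) t := fun t =>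
    (HasDerivAt.fun_sum fun β _ => (hasDerivAt_primitive _ t).const_smul (p.2 β)).const_add p.1
  rw [fderiv_picardDefect_apply]
  ext t
  have hs : ∀ f : ι → Curve E, (∑ β, f β) t = ∑ β, f β t := fun f => map_sum (Curve.evalL E t) _ _
  simp only [Curve.sub_apply, hs, Curve.add_apply, Curve.smul_apply, primitiveL_apply,
    Curve.mk_apply, map_zero, Curve.zero_apply, sub_zero, Curve.map_apply, pointwiseApply_apply]
  rw [Finset.sum_add_distrib]
  have h1 : ∑ β, (Pi.single α (1 : ℝ) : ι → ℝ) β •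
      ∫ s in (0 : ℝ)..t, ξ β (u (Set.projIcc 0 1 zero_le_one s))
      = ∫ s in (0 : ℝ)..t, ξ α (u (Set.projIcc 0 1 zero_le_one s)) := by
    rw [Finset.sum_eq_single α]
    · simp
    · intro β _ hβ
      simp [Pi.single_eq_of_ne hβ]
    · simp
  rw [h1]
  have hcont : ∀ {G : Type v} [NormedAddCommGroup G] (v : E → G), Continuous v →
      Continuous (fun s : ℝ => v (u (Set.projIcc 0 1 zero_le_one s))) := fun v hv =>
    hv.comp (u.continuous.comp continuous_projIcc)
  have hk : ∀ β, Continuous (fun s : ℝ => p.2 β • fderiv ℝ (ξ β)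
      (u (Set.projIcc 0 1 zero_le_one s)) ((Set.projIcc (0 : ℝ) 1 zero_le_one s : ℝ) •
        ξ α (u (Set.projIcc 0 1 zero_le_one s)))) := fun β =>
    ((hcont _ ((hξ β).continuous_fderiv (by simp))).clm_apply
      ((continuous_subtype_val.comp continuous_projIcc).smul
        (hcont _ (hξ α).continuous))).const_smul _
  -- The derivative of `s • ξ_α(w s)` contains `Dξ_α(ξ_β)`. Commutation replaces it by `Dξ_β(ξ_α)`,
  -- which is what the linearised integral equation requires.
  have hFTC := intervalIntegral.integral_eq_sub_of_hasDerivAt (a := 0) (b := (t : ℝ))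
    (f := fun s => s • ξ α (w s))
    (f' := fun s => ξ α (u (Set.projIcc 0 1 zero_le_one s)) + ∑ β, p.2 β • fderiv ℝ (ξ β)
      (u (Set.projIcc 0 1 zero_le_one s)) ((Set.projIcc (0 : ℝ) 1 zero_le_one s : ℝ) •
        ξ α (u (Set.projIcc 0 1 zero_le_one s)))) (fun s hs => ?_) (Continuous.intervalIntegrable
          ((hcont _ (hξ α).continuous).add (continuous_finsetSum _ fun β _ => hk β)) _ _)
  · rw [intervalIntegral.integral_add ((hcont _ (hξ α).continuous).intervalIntegrable _ _)
      ((continuous_finsetSum _ fun β _ => hk β).intervalIntegrable _ _),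
      intervalIntegral.integral_finsetSum fun β _ => (hk β).intervalIntegrable _ _, zero_smul,
      sub_zero, hw] at hFTC
    simp only [intervalIntegral.integral_smul] at hFTC
    rw [hFTC, sub_self]
  · rw [Set.uIcc_of_le t.2.1] at hs
    have hsI : s ∈ Set.Icc (0 : ℝ) 1 := ⟨hs.1, hs.2.trans t.2.2⟩
    have hps : Set.projIcc (0 : ℝ) 1 zero_le_one s = ⟨s, hsI⟩ := Set.projIcc_of_mem _ hsI
    have hws : w s = u ⟨s, hsI⟩ := hw ⟨s, hsI⟩
    have hd := (hasDerivAt_id s).smul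
      (((hξ α).differentiable (by simp) (w s)).hasFDerivAt.comp_hasDerivAt s (hw' s))
    refine hd.congr_deriv ?_
    simp only [hps, hws, id, one_smul, map_sum, map_smul, Function.comp_apply]
    rw [add_comm, Finset.smul_sum]
    congr 1
    refine Finset.sum_congr rfl fun β _ => ?_
    rw [hcomm _ (hball _) α β, smul_comm]

include hξ in
/-- The joint flow of finitely many commuting smooth vector fields near a point. -/
theorem exists_commuting_flow [DecidableEq ι] (x₀ : E) {ε : ℝ} (hε : 0 < ε)
    (hcomm : ∀ y ∈ Metric.ball x₀ ε, ∀ α β,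
      fderiv ℝ (ξ α) y (ξ β y) = fderiv ℝ (ξ β) y (ξ α y)) :
    ∃ Fl : E × (ι → ℝ) → E, ∀ᶠ p in 𝓝 ((x₀, 0) : E × (ι → ℝ)),
      ContDiffAt ℝ ∞ Fl p ∧ Fl p ∈ Metric.ball x₀ ε ∧ (p.2 = 0 → Fl p = p.1) ∧
        ∀ α, fderiv ℝ Fl p (0, Pi.single α 1) = ξ α (Fl p) := by
  obtain ⟨u, hu⟩ := exists_smooth_solution hξ x₀ hε
  -- The time-one value of the flow of `∑ s_α ξ_α`.
  refine ⟨fun p => u p 1, ?_⟩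
  filter_upwards [hu, hu.eventually_nhds] with p ⟨hsm, hdef, hball, hinj⟩ hnear
  refine ⟨(Curve.evalL E 1).contDiff.contDiffAt.comp p hsm, hball 1, fun h0 => ?_, fun α => ?_⟩
  · have h := DFunLike.congr_fun hdef 1
    simp only [picardDefect, h0, Pi.zero_apply, zero_smul, Finset.sum_const_zero, sub_zero,
      Curve.sub_apply, constL_apply, Curve.zero_apply] at h
    exact sub_eq_zero.1 h
  · have hdu := hsm.differentiableAt (by simp)
    have h1 : fderiv ℝ (fun p => picardDefect ξ hξ (p, u p)) p = 0 := by
      have : (fun p => picardDefect ξ hξ (p, u p)) =ᶠ[𝓝 p] fun _ => 0 := by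
        filter_upwards [hnear] with q hq using hq.2.1
      rw [this.fderiv_eq]
      simp
    have h2 := ((hasFDerivAt_picardDefect hξ (p, u p)).comp p
      ((hasFDerivAt_id p).prodMk hdu.hasFDerivAt)).fderiv
    have h3 := DFunLike.congr_fun (h2.symm.trans h1) (0, Pi.single α 1)
    -- Differentiating `picardDefect (p, u p) = 0` in `s_α` shows that `∂u/∂s_α` solves the
    -- linearised equation; by injectivity it equals `t ↦ t ξ_α(u(t))`, which is then evaluated at
    -- `t = 1`.
    have h4 := hinj _ _ _ h3 (linearised_solution hξ hcomm hdef hball α)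
    have h5 := ((Curve.evalL E 1).hasFDerivAt.comp p hdu.hasFDerivAt).fderiv
    have h6 := DFunLike.congr_fun h5 (0, Pi.single α 1)
    refine h6.trans ?_
    have h7 := congrArg (fun c : Curve E => c 1) h4
    simpa using h7

end CommutingFlow

/-! ### The structure of `M` in the coordinates of a chart. -/

section CoordinateStructure

variable {n : ℕ} {M : Type u} [TopologicalSpace M]
  [ChartedSpace (EuclideanSpace ℝ (Fin (4 * n + 3))) M] [IsManifold (𝓡 (4 * n + 3)) ∞ M]
  {E : Type v} [NormedAddCommGroup E] [NormedSpace ℝ E] [FiniteDimensional ℝ E]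

theorem IsSmoothChart.bwd_ne_zero {m : ℕ} {X : Type u} [TopologicalSpace X]
    [ChartedSpace (EuclideanSpace ℝ (Fin m)) X] {e : OpenPartialHomeomorph X E}
    (he : IsSmoothChart m e) {z : E} (hz : z ∈ e.target) {v : E} (hv : v ≠ 0) :
    bwd m e z v ≠ 0 := fun h => hv (by
  have := he.fwd_bwd hz v
  rw [h, map_zero] at this
  exact this.symm)

theorem coordBilin_apply {m : ℕ} {X : Type u} [TopologicalSpace X]
    [ChartedSpace (EuclideanSpace ℝ (Fin m)) X] (e : OpenPartialHomeomorph X E)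
    (g : ∀ x : X, TangentSpace (𝓡 m) x →L[ℝ] TangentSpace (𝓡 m) x →L[ℝ] ℝ) (z v w : E) :
    coordBilin m e g z v w = g (e.symm z) (bwd m e z v) (bwd m e z w) := rfl

theorem coordEndo_apply {m : ℕ} {X : Type u} [TopologicalSpace X]
    [ChartedSpace (EuclideanSpace ℝ (Fin m)) X] (e : OpenPartialHomeomorph X E)
    (φ : EndoField m X) (z v : E) :
    coordEndo m e φ z v = fwd m e (e.symm z) (φ (e.symm z) (bwd m e z v)) := rfl

theorem IsSmoothChart.coordEndo_coordEndo {m : ℕ} {X : Type u} [TopologicalSpace X]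
    [ChartedSpace (EuclideanSpace ℝ (Fin m)) X] {e : OpenPartialHomeomorph X E}
    (he : IsSmoothChart m e) {z : E} (hz : z ∈ e.target) (φ ψ : EndoField m X) (v : E) :
    coordEndo m e φ z (coordEndo m e ψ z v)
      = fwd m e (e.symm z) (φ (e.symm z) (ψ (e.symm z) (bwd m e z v))) := by
  rw [coordEndo_apply, coordEndo_apply, he.bwd_fwd hz]

theorem IsSmoothChart.bwd_coordField {m : ℕ} {X : Type u} [TopologicalSpace X]
    [ChartedSpace (EuclideanSpace ℝ (Fin m)) X] {e : OpenPartialHomeomorph X E}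
    (he : IsSmoothChart m e) {z : E} (hz : z ∈ e.target) (Y : VField m X) :
    bwd m e z (coordField m e Y z) = Y (e.symm z) := he.bwd_fwd hz _

variable (S : AlmostContactMetric3 n M) (hS : S.Is3Cosymplectic)
  {e : OpenPartialHomeomorph M E} (he : IsSmoothChart (4 * n + 3) e)

-- Evaluated on lifts of constant fields, `extD1_eq` turns closedness into symmetry of the
-- derivative of the coefficients.
include hS he in
theorem coord_closed_η (α : Fin 3) {z : E} (hz : z ∈ e.target) (v w : E) :
    fderiv ℝ (coordForm (4 * n + 3) e (S.η α)) z v w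
      = fderiv ℝ (coordForm (4 * n + 3) e (S.η α)) z w v := by
  have hx := e.map_target hz
  have hs : ∀ v, SmoothVFieldAt (liftField (4 * n + 3) e fun _ => v) (e.symm z) := fun v =>
    he.smoothVFieldAt_liftField hx contDiffAt_const
  have h := he.extD1_eq hx (hs v) (hs w) (η := S.η α) (by
    rw [e.right_inv hz]
    exact (he.contDiffAt_coordForm hz (S.smooth_η α)).differentiableAt (by simp))
  rw [(hS α).1 _ _ _ (hs v) (hs w), he.fwd_liftField hx, he.fwd_liftField hx, e.right_inv hz] at h
  linarith

theorem Φ_eq_coord (α : Fin 3) {y : M} (hy : y ∈ e.source)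
    (he : IsSmoothChart (4 * n + 3) e) (v w : TangentSpace (𝓡 (4 * n + 3)) y) :
    S.Φ α y v w = bilinComp (coordBilin (4 * n + 3) e S.g.inner (e y))
      (coordEndo (4 * n + 3) e (S.φ α) (e y)) (fwd (4 * n + 3) e y v) (fwd (4 * n + 3) e y w) := by
  rw [bilinComp_apply, ← he.endo_apply hy, ← he.bilin_apply hy]
  rfl

/-- The coordinate expression of a `3`-cosymplectic structure in a smooth chart. -/
def coordStructure : LocalCosymp e.target where
  φ α := coordEndo (4 * n + 3) e (S.φ α)
  ξ α := coordField (4 * n + 3) e (S.ξ α)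
  η α := coordForm (4 * n + 3) e (S.η α)
  g := coordBilin (4 * n + 3) e S.g.inner
  smooth_φ α z hz := he.contDiffAt_coordEndo hz (S.smooth_φ α)
  smooth_ξ α z hz := he.contDiffAt_coordField hz (S.smooth_ξ α _)
  smooth_η α z hz := he.contDiffAt_coordForm hz (S.smooth_η α)
  smooth_g z hz := he.contDiffAt_coordBilin hz S.g.contMDiff
  g_symm z hz v w := S.g.symm _ _ _
  g_pos z hz v hv := S.g.pos _ _ (he.bwd_ne_zero hz hv)
  φ_sq α z hz v := by
    rw [he.coordEndo_coordEndo hz, S.φ_sq, map_add, map_neg, he.fwd_bwd hz, map_smul]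
    rfl
  η_ξ α z hz := by
    rw [coordForm, ContinuousLinearMap.comp_apply, he.bwd_coordField hz, S.η_ξ]
  φ_φ α β z hz v := by
    have h := congrArg (fwd (4 * n + 3) e (e.symm z)) (S.φ_φ α β (e.symm z) (bwd (4 * n + 3) e z v))
    rw [map_sub, map_smul, map_sub, map_smul, map_sum, he.fwd_bwd hz] at h
    simp only [map_smul] at h
    rw [he.coordEndo_coordEndo hz]
    exact h
  φ_ξ α β z hz := by
    have h := congrArg (fwd (4 * n + 3) e (e.symm z)) (S.φ_ξ α β (e.symm z))
    rw [map_sum] at h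
    simp only [map_smul] at h
    rw [coordEndo_apply, he.bwd_coordField hz]
    exact h
  η_φ α β z hz v := by
    have h := S.η_φ α β (e.symm z) (bwd (4 * n + 3) e z v)
    rw [coordForm, ContinuousLinearMap.comp_apply, coordEndo_apply, he.bwd_fwd hz]
    exact h
  compat α z hz v w := by
    have h := S.compat α (e.symm z) (bwd (4 * n + 3) e z v) (bwd (4 * n + 3) e z w)
    rw [coordEndo_apply, coordEndo_apply, coordBilin_apply, he.bwd_fwd hz, he.bwd_fwd hz]
    exact h
  closed_η α z hz v w := coord_closed_η S hS he α hz v w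
  closed_Φ α z hz u v w := by
    have hx := e.map_target hz
    have hs : ∀ v, SmoothVFieldAt (liftField (4 * n + 3) e fun _ => v) (e.symm z) := fun v =>
      he.smoothVFieldAt_liftField hx contDiffAt_const
    have h := he.extD2_eq hx (hs u) (hs v) (hs w) (θ := S.Φ α)
      (T := fun y => bilinComp (coordBilin (4 * n + 3) e S.g.inner y)
        (coordEndo (4 * n + 3) e (S.φ α) y))
      (fun y hy v w => Φ_eq_coord S α hy he v w) (by
        rw [e.right_inv hz]
        exact (contDiffAt_bilinComp (he.contDiffAt_coordBilin hz S.g.contMDiff)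
          (he.contDiffAt_coordEndo hz (S.smooth_φ α))).differentiableAt (by simp)) (fun v w => by
        -- The antisymmetry required by `extD2_eq` is derived on `M`, since the coordinate structure
        -- to which `Φ_anti` would apply is still under construction.
        have h2 : ∀ x v w, S.Φ α x v w = - S.Φ α x w v := fun x v w => by
          have hηφ : S.η α x (S.φ α x w) = 0 := by rw [S.η_φ]; simp [eps_self]
          have hφξ : S.φ α x (S.ξ α x) = 0 := by rw [S.φ_ξ]; simp [eps_self]
          have h3 := S.compat α x v (S.φ α x w)
          have h4 := S.compat α x (S.φ α x w) (S.ξ α x)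
          rw [hφξ, hηφ, map_zero, S.η_ξ] at h4
          have h5 : S.g.inner x (S.φ α x v) (S.ξ α x) = 0 := by
            have h6 := S.compat α x (S.φ α x v) (S.ξ α x)
            have hηφ : S.η α x (S.φ α x v) = 0 := by rw [S.η_φ]; simp [eps_self]
            rw [hφξ, hηφ, map_zero] at h6
            linarith
          rw [S.φ_sq, hηφ, map_add, map_neg, map_smul, h5, S.g.symm x _ w] at h3
          simp at h3
          change S.g.inner x v (S.φ α x w) = - S.g.inner x w (S.φ α x v)
          linarith
        have h3 := h2 (e.symm z) (bwd (4 * n + 3) e z v) (bwd (4 * n + 3) e z w)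
        rw [Φ_eq_coord S α hx he, Φ_eq_coord S α hx he, he.fwd_bwd hz, he.fwd_bwd hz] at h3
        exact h3)
    rw [(hS α).2.1 _ _ _ _ (hs u) (hs v) (hs w), he.fwd_liftField hx, he.fwd_liftField hx,
      he.fwd_liftField hx, e.right_inv hz] at h
    linarith
  normal α z hz v w := by
    have hx := e.map_target hz
    have hs : ∀ v, SmoothVFieldAt (liftField (4 * n + 3) e fun _ => v) (e.symm z) := fun v =>
      he.smoothVFieldAt_liftField hx contDiffAt_const
    have h := he.fwd_nijenhuis hx (hs v) (hs w) (S.smooth_φ α)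
    have h1 := (hS α).2.2 _ _ _ (hs v) (hs w)
    -- Closedness of `η_α` removes the term `2 dη_α ⊗ ξ_α`, so normality becomes vanishing of the
    -- Nijenhuis tensor.
    rw [(hS α).1 _ _ _ (hs v) (hs w), mul_zero, zero_smul, add_zero] at h1
    rw [h1, map_zero, he.fwd_liftField hx, he.fwd_liftField hx, e.right_inv hz] at h
    exact h.symm

end CoordinateStructure

/-! ### Simultaneous straightening of commuting vector fields. -/

section StraighteningVectorFields

variable {E : Type v} [NormedAddCommGroup E] [NormedSpace ℝ E] [FiniteDimensional ℝ E]

/-- A linearly independent family extends to a linear coordinate system. -/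
theorem exists_equiv_of_linearIndependent {ι : Type} [Fintype ι] [DecidableEq ι] {F : Type*}
    [NormedAddCommGroup F] [NormedSpace ℝ F] [FiniteDimensional ℝ F] {b : ι → E}
    (hb : LinearIndependent ℝ b)
    (hdim : Module.finrank ℝ E = Fintype.card ι + Module.finrank ℝ F) :
    ∃ A : ((ι → ℝ) × F) ≃L[ℝ] E, ∀ α, A (Pi.single α 1, 0) = b α := by
  let L : (ι → ℝ) →ₗ[ℝ] E := Fintype.linearCombination ℝ b
  have hL : Function.Injective L := hb.fintypeLinearCombination_injective
  obtain ⟨W', hW'⟩ := Submodule.exists_isCompl (LinearMap.range L)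
  have h1 := Submodule.finrank_add_eq_of_isCompl hW'
  have h2 : Module.finrank ℝ (LinearMap.range L) = Fintype.card ι := by
    rw [LinearMap.finrank_range_of_inj hL, Module.finrank_fintype_fun_eq_card]
  let B : F ≃ₗ[ℝ] W' := LinearEquiv.ofFinrankEq _ _ (by omega)
  refine ⟨(((LinearEquiv.ofInjective L hL).prodCongr B).trans
    (Submodule.prodEquivOfIsCompl _ _ hW')).toContinuousLinearEquiv, fun α => ?_⟩
  simp [L]

/-- Cutting off a vector field. -/
theorem exists_global_extension {ι : Type*} {U : Set E} (hU : IsOpen U) {ξ : ι → E → E}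
    (hξ : ∀ α, ∀ z ∈ U, ContDiffAt ℝ ∞ (ξ α) z) {x₀ : E} (hx₀ : x₀ ∈ U) :
    ∃ ε > 0, Metric.ball x₀ ε ⊆ U ∧ ∃ ζ : ι → E → E, (∀ α, ContDiff ℝ ∞ (ζ α)) ∧
      ∀ α, ∀ z ∈ Metric.ball x₀ ε, ζ α z = ξ α z := by
  obtain ⟨δ, hδ, hδU⟩ := Metric.isOpen_iff.1 hU x₀ hx₀
  let χ : ContDiffBump x₀ := ⟨δ / 4, δ / 2, by positivity, by linarith⟩
  refine ⟨δ / 4, by positivity, (Metric.ball_subset_ball (by linarith)).trans hδU,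
    fun α z => χ z • ξ α z, fun α => contDiff_iff_contDiffAt.2 fun z => ?_, fun α z hz => ?_⟩
  · by_cases hz : z ∈ U
    · exact χ.contDiffAt.smul (hξ α z hz)
    · have hz' : z ∉ tsupport χ := fun h => by
        rw [χ.tsupport_eq] at h
        exact hz (hδU (Metric.closedBall_subset_ball (by change δ / 2 < δ; linarith) h))
      refine (contDiffAt_const (c := (0 : E))).congr_of_eventuallyEq ?_
      filter_upwards [(isClosed_tsupport χ).isOpen_compl.mem_nhds hz'] with y hy
      rw [image_eq_zero_of_notMem_tsupport hy, zero_smul]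
  · change χ z • ξ α z = ξ α z
    rw [χ.one_of_mem_closedBall (Metric.ball_subset_closedBall hz), one_smul]

/-- Commuting linearly independent vector fields are simultaneously straightened by a
diffeomorphism. -/
theorem exists_straightening {ι : Type} [Fintype ι] [DecidableEq ι] {F : Type v}
    [NormedAddCommGroup F] [NormedSpace ℝ F] [FiniteDimensional ℝ F] {U : Set E} (hU : IsOpen U)
    {ξ : ι → E → E} (hξ : ∀ α, ∀ z ∈ U, ContDiffAt ℝ ∞ (ξ α) z)
    (hcomm : ∀ z ∈ U, ∀ α β, fderiv ℝ (ξ α) z (ξ β z) = fderiv ℝ (ξ β) z (ξ α z))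
    {x₀ : E} (hx₀ : x₀ ∈ U) (hli : LinearIndependent ℝ fun α => ξ α x₀)
    (hdim : Module.finrank ℝ E = Fintype.card ι + Module.finrank ℝ F) :
    ∃ (Ψ : OpenPartialHomeomorph ((ι → ℝ) × F) E) (r : ℝ), 0 < r ∧
      Ψ.source = Metric.ball 0 r ∧ Ψ 0 = x₀ ∧ Ψ.target ⊆ U ∧
      (∀ p ∈ Ψ.source, ContDiffAt ℝ ∞ Ψ p) ∧ (∀ z ∈ Ψ.target, ContDiffAt ℝ ∞ Ψ.symm z) ∧
      ∀ p ∈ Ψ.source, ∀ α, fderiv ℝ Ψ p (Pi.single α 1, 0) = ξ α (Ψ p) := by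
  have : CompleteSpace E := FiniteDimensional.complete ℝ E
  obtain ⟨A, hA⟩ := exists_equiv_of_linearIndependent (F := F) hli hdim
  obtain ⟨ε, hε, hεU, ζ, hζ, hζξ⟩ := exists_global_extension hU hξ hx₀
  have hev : ∀ α, ∀ z ∈ Metric.ball x₀ ε, ζ α =ᶠ[𝓝 z] ξ α := fun α z hz => by
    filter_upwards [Metric.isOpen_ball.mem_nhds hz] with y hy using hζξ α y hy
  obtain ⟨Fl, hFl⟩ := exists_commuting_flow hζ x₀ hε fun y hy α β => by
    rw [(hev α y hy).fderiv_eq, (hev β y hy).fderiv_eq, hζξ α y hy, hζξ β y hy,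
      hcomm y (hεU hy)]
  -- The straightening map sends `(s, y)` to the value of the joint flow with times `s` started at
  -- `x₀ + A (0, y)`; the affine map `q` built from `Q` supplies these data.
  let Q : (ι → ℝ) × F →L[ℝ] E × (ι → ℝ) :=
    ((A : (ι → ℝ) × F →L[ℝ] E) ∘L (ContinuousLinearMap.inr ℝ (ι → ℝ) F) ∘L
      ContinuousLinearMap.snd ℝ (ι → ℝ) F).prod (ContinuousLinearMap.fst ℝ (ι → ℝ) F)
  let q : (ι → ℝ) × F → E × (ι → ℝ) := fun p => (x₀, 0) + Q p
  have hq : ContDiff ℝ ∞ q := contDiff_const.add Q.contDiff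
  have hqd : ∀ p, HasFDerivAt q Q p := fun p => Q.hasFDerivAt.const_add _
  have hq0 : q 0 = (x₀, 0) := by simp [q]
  let f := Fl ∘ q
  have hW := (hq.continuous.tendsto' 0 _ hq0).eventually hFl
  have hW0 := hW.self_of_nhds
  have hfs : ∀ p, ContDiffAt ℝ ∞ Fl (q p) → ContDiffAt ℝ ∞ f p := fun p hp =>
    hp.comp p hq.contDiffAt
  have hfd : ∀ p, ContDiffAt ℝ ∞ Fl (q p) → HasFDerivAt f (fderiv ℝ Fl (q p) ∘L Q) p :=
    fun p hp => (hp.differentiableAt (by simp)).hasFDerivAt.comp p (hqd p)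
  have hfξ : ∀ p, (ContDiffAt ℝ ∞ Fl (q p) ∧ Fl (q p) ∈ Metric.ball x₀ ε ∧
      ((q p).2 = 0 → Fl (q p) = (q p).1) ∧
      ∀ α, fderiv ℝ Fl (q p) (0, Pi.single α 1) = ζ α (Fl (q p))) →
      ∀ α, fderiv ℝ f p (Pi.single α 1, 0) = ξ α (f p) := fun p hp α => by
    rw [(hfd p hp.1).fderiv]
    have h0 : Q (Pi.single α 1, 0) = (0, Pi.single α 1) := Prod.ext (map_zero A) rfl
    exact (congrArg (fderiv ℝ Fl (q p)) h0).trans ((hp.2.2.2 α).trans (hζξ α _ hp.2.1))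
  -- On the first factor the differential at `0` takes the basis to the vectors `ξ_α(x₀)`, which are
  -- the images under `A`. On the second it is `A` because the flow with `s = 0` is the identity.
  have hA0 : HasFDerivAt f (A : (ι → ℝ) × F →L[ℝ] E) 0 := by
    convert hfd 0 hW0.1 using 1
    have h1 := (hfd 0 hW0.1).fderiv
    have hf0 : f 0 = x₀ := by simpa [f, hq0] using hW0.2.2.1 (by simp [hq0])
    rw [← h1]
    refine ContinuousLinearMap.prod_ext ?_ ?_
    · refine ContinuousLinearMap.coe_inj.1 (LinearMap.pi_ext' fun α => LinearMap.ext_ring ?_)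
      have := hfξ 0 hW0 α
      rw [hf0] at this
      simpa [hA] using this.symm
    · have h2 : (fun y : F => f (0, y)) =ᶠ[𝓝 0] fun y => x₀ + A (0, y) := by
        have h3 : Filter.Tendsto (fun y : F => ((0, y) : (ι → ℝ) × F)) (𝓝 0) (𝓝 0) :=
          (Continuous.prodMk continuous_const continuous_id).tendsto' _ _ rfl
        filter_upwards [h3.eventually hW] with y hy
        simpa [f, q, Q] using hy.2.2.1 (by simp [q, Q])
      have h4 : HasFDerivAt (fun y : F => x₀ + A (0, y))
          ((A : (ι → ℝ) × F →L[ℝ] E) ∘L ContinuousLinearMap.inr ℝ (ι → ℝ) F) 0 :=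
        (ContinuousLinearMap.hasFDerivAt ((A : (ι → ℝ) × F →L[ℝ] E) ∘L
          ContinuousLinearMap.inr ℝ (ι → ℝ) F)).const_add x₀
      have h5 := h4.congr_of_eventuallyEq h2
      have h6 : HasFDerivAt (fun y : F => f (0, y))
          (fderiv ℝ f 0 ∘L ContinuousLinearMap.inr ℝ (ι → ℝ) F) 0 := by
        have h7 : HasFDerivAt f (fderiv ℝ f 0) ((0, 0) : (ι → ℝ) × F) :=
          ((hfs 0 hW0.1).differentiableAt (by simp)).hasFDerivAt
        exact h7.comp (0 : F) (ContinuousLinearMap.inr ℝ (ι → ℝ) F).hasFDerivAt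
      exact h5.unique h6
  obtain ⟨Ψ, hΨf, hΨ0, hΨW, -, hΨs⟩ :=
    exists_smooth_openPartialHomeomorph hW (fun p hp => hfs p hp.1) hA0
  obtain ⟨r, hr, hrΨ⟩ := Metric.isOpen_iff.1 Ψ.open_source 0 hΨ0
  have hΨf' : (Ψ : (ι → ℝ) × F → E) = f := funext hΨf
  refine ⟨Ψ.restrOpen _ (Metric.isOpen_ball (x := (0 : (ι → ℝ) × F)) (ε := r)), r, hr,
    Set.inter_eq_right.2 hrΨ, ?_, fun z hz => ?_, fun p hp => ?_,
    fun z hz => hΨs z hz.1, fun p hp => ?_⟩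
  · change Ψ 0 = x₀
    rw [hΨf]
    simpa [f, hq0] using hW0.2.2.1 (by simp [hq0])
  · have h1 := hΨW (Ψ.map_target hz.1)
    have h2 : f (Ψ.symm z) = z := by rw [← hΨf, Ψ.right_inv hz.1]
    rw [← h2]
    exact hεU h1.2.1
  · change ContDiffAt ℝ ∞ Ψ p
    rw [hΨf']
    exact hfs p (hΨW hp.1).1
  · change ∀ α, fderiv ℝ Ψ p _ = ξ α (Ψ p)
    rw [hΨf']
    exact hfξ p (hΨW hp.1)

end StraighteningVectorFields

/-! ### Charts in which the Reeb fields are coordinate fields. -/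

section AdaptedCharts

section

variable {m : ℕ} {X : Type u} [TopologicalSpace X] [ChartedSpace (EuclideanSpace ℝ (Fin m)) X]
  {E : Type*} [NormedAddCommGroup E] [NormedSpace ℝ E]
  {E' : Type*} [NormedAddCommGroup E'] [NormedSpace ℝ E']

theorem isSmoothChart_chartAt [IsManifold (𝓡 m) ∞ X] (x : X) :
    IsSmoothChart m (chartAt (EuclideanSpace ℝ (Fin m)) x) :=
  ⟨contMDiffOn_chart, contMDiffOn_chart_symm⟩

theorem mvfderiv_comp_chart {e : OpenPartialHomeomorph X E} (he : IsSmoothChart m e) {x : X}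
    (hx : x ∈ e.source) {f : E → E'} (hf : DifferentiableAt ℝ f (e x)) {h : X → E'}
    (hh : h =ᶠ[𝓝 x] f ∘ e) (v : TangentSpace (𝓡 m) x) :
    mvfderiv (𝓡 m) h x v = fderiv ℝ f (e x) (fwd m e x v) := by
  have h1 : mfderiv (𝓡 m) 𝓘(ℝ, E') h x = mfderiv (𝓡 m) 𝓘(ℝ, E') (f ∘ e) x :=
    Filter.EventuallyEq.mfderiv_eq hh
  have h2 : mfderiv (𝓡 m) 𝓘(ℝ, E') (f ∘ e) x
      = (mfderiv 𝓘(ℝ, E) 𝓘(ℝ, E') f (e x)).comp (mfderiv (𝓡 m) 𝓘(ℝ, E) e x) :=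
    mfderiv_comp x hf.mdifferentiableAt (he.mdifferentiable.mdifferentiableAt hx)
  have h3 : mfderiv (𝓡 m) 𝓘(ℝ, E') h x v = fderiv ℝ f (e x) (fwd m e x v) := by
    rw [h1, h2, mfderiv_eq_fderiv]; rfl
  exact h3

theorem IsSmoothChart.trans {e : OpenPartialHomeomorph X E} (he : IsSmoothChart m e)
    {Ψ : OpenPartialHomeomorph E E'} (h1 : ∀ z ∈ Ψ.source, ContDiffAt ℝ ∞ Ψ z)
    (h2 : ∀ z ∈ Ψ.target, ContDiffAt ℝ ∞ Ψ.symm z) : IsSmoothChart m (e.trans Ψ) := by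
  refine ⟨fun x hx => ?_, fun z hz => ?_⟩
  · rw [OpenPartialHomeomorph.trans_source] at hx
    exact (((h1 _ hx.2).contMDiffAt.comp x ((he.smooth x hx.1).contMDiffAt
      (e.open_source.mem_nhds hx.1)))).contMDiffWithinAt
  · rw [OpenPartialHomeomorph.trans_target] at hz
    exact (((he.smooth_symm _ hz.2).contMDiffAt (e.open_target.mem_nhds hz.2)).comp z
      (h2 _ hz.1).contMDiffAt).contMDiffWithinAt

theorem IsSmoothChart.restrict {e : OpenPartialHomeomorph X E} (he : IsSmoothChart m e)
    {s : Set E} (hs : IsOpen s) : IsSmoothChart m (e.symm.restrOpen s hs).symm := by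
  refine ⟨fun x hx => (he.smooth.mono ?_) x hx, fun z hz => (he.smooth_symm.mono ?_) z hz⟩
  · intro y hy
    simp at hy
    exact hy.1
  · intro z hz
    exact hz.1

end

variable {n : ℕ} {M : Type u} [TopologicalSpace M]
  [ChartedSpace (EuclideanSpace ℝ (Fin (4 * n + 3))) M] [IsManifold (𝓡 (4 * n + 3)) ∞ M]

/-- The model of a foliated chart: leaf coordinates and transverse coordinates. -/
abbrev AdaptedModel (n : ℕ) : Type := (Fin 3 → ℝ) × EuclideanSpace ℝ (Fin (4 * n))

/-- A smooth chart onto a cube in which the Reeb fields are the first three coordinate fields. -/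
structure IsAdaptedChart (S : AlmostContactMetric3 n M) (e : OpenPartialHomeomorph M (AdaptedModel n))
    (r : ℝ) : Prop where
  chart : IsSmoothChart (4 * n + 3) e
  pos : 0 < r
  target_eq : e.target = Metric.ball 0 r
  field_eq : ∀ α, ∀ z ∈ e.target, coordField (4 * n + 3) e (S.ξ α) z = (Pi.single α 1, 0)

variable {S : AlmostContactMetric3 n M}

theorem IsAdaptedChart.fwd_ξ {e : OpenPartialHomeomorph M (AdaptedModel n)} {r : ℝ}
    (he : IsAdaptedChart S e r) (α : Fin 3) {x : M} (hx : x ∈ e.source) :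
    fwd (4 * n + 3) e x (S.ξ α x) = (Pi.single α 1, 0) := by
  rw [fwd_eq_coordField hx, he.field_eq α _ (e.map_source hx)]

theorem IsAdaptedChart.restrict {e : OpenPartialHomeomorph M (AdaptedModel n)} {r : ℝ}
    (he : IsAdaptedChart S e r) {r' : ℝ} (hr' : 0 < r') (hr : r' ≤ r) :
    IsAdaptedChart S (e.symm.restrOpen (Metric.ball 0 r') Metric.isOpen_ball).symm r' where
  chart := he.chart.restrict _
  pos := hr'
  target_eq := by
    have h : Metric.ball (0 : AdaptedModel n) r' ⊆ e.target := by
      rw [he.target_eq]; exact Metric.ball_subset_ball hr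
    exact Set.inter_eq_right.2 h
  field_eq α z hz := he.field_eq α z hz.1

theorem LocalCosymp.linearIndependent_ξ {E : Type*} [NormedAddCommGroup E] [NormedSpace ℝ E]
    {U : Set E} (T : LocalCosymp U) {z : E} (hz : z ∈ U) :
    LinearIndependent ℝ fun α => T.ξ α z := by
  rw [Fintype.linearIndependent_iff]
  intro c hc α
  have h := congrArg (T.η α z) hc
  rw [map_sum, map_zero] at h
  simpa [T.η_ξ_eq α _ hz, kron] using h

/-- The Reeb fields commute by `ξ_commute` and are independent by duality with the `η_α`, so a chart
of `M` followed by the inverse of a straightening map is adapted. -/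
theorem exists_adaptedChart (hS : S.Is3Cosymplectic) (x : M) :
    ∃ (e : OpenPartialHomeomorph M (AdaptedModel n)) (r : ℝ),
      IsAdaptedChart S e r ∧ x ∈ e.source ∧ e x = 0 := by
  let c := chartAt (EuclideanSpace ℝ (Fin (4 * n + 3))) x
  have hc : IsSmoothChart (4 * n + 3) c := isSmoothChart_chartAt x
  have hx : x ∈ c.source := mem_chart_source _ x
  let T := coordStructure S hS hc
  obtain ⟨Ψ, r, hr, hsrc, h0, htgt, hs, hs', hξ⟩ := exists_straightening
    (F := EuclideanSpace ℝ (Fin (4 * n))) c.open_target T.smooth_ξ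
    (fun z hz α β => T.ξ_commute c.open_target β α hz) (c.map_source hx)
    (T.linearIndependent_ξ (c.map_source hx)) (by simp; omega)
  have h0s : (0 : AdaptedModel n) ∈ Ψ.source := hsrc ▸ Metric.mem_ball_self hr
  have hchart : IsSmoothChart (4 * n + 3) (c.trans Ψ.symm) :=
    hc.trans (Ψ := Ψ.symm) hs' hs
  have htarget : (c.trans Ψ.symm).target = Metric.ball 0 r := by
    rw [OpenPartialHomeomorph.trans_target, ← hsrc]
    refine Set.inter_eq_left.2 fun p hp => ?_
    exact htgt (Ψ.map_source hp)
  have h0' : Ψ.symm (c x) = 0 := by rw [← h0, Ψ.left_inv h0s]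
  refine ⟨c.trans Ψ.symm, r, ⟨hchart, hr, htarget, fun α p hp => ?_⟩, ?_, h0'⟩
  · have hpΨ : p ∈ Ψ.source := by rw [htarget] at hp; rwa [hsrc]
    have hy := (c.trans Ψ.symm).map_target hp
    set y := (c.trans Ψ.symm).symm p with hydef
    have hyc : y ∈ c.source := c.map_target (htgt (Ψ.map_source hpΨ))
    have hcy : c y = Ψ p := c.right_inv (htgt (Ψ.map_source hpΨ))
    have hd : DifferentiableAt ℝ Ψ.symm (Ψ p) :=
      (hs' _ (Ψ.map_source hpΨ)).differentiableAt (by simp)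
    have h1 := mvfderiv_comp_chart hc hyc (f := Ψ.symm) (h := c.trans Ψ.symm)
      (by rw [hcy]; exact hd) Filter.EventuallyEq.rfl (S.ξ α y)
    have h2 : fwd (4 * n + 3) c y (S.ξ α y) = T.ξ α (Ψ p) := by
      rw [fwd_eq_coordField hyc, hcy]; rfl
    rw [h2, hcy] at h1
    refine h1.trans ?_
    -- `DΨ` takes the coordinate vector to `ξ_α`, so the differential of the inverse takes it back.
    refine (congrArg (fderiv ℝ Ψ.symm (Ψ p)) (hξ p hpΨ α).symm).trans ?_
    have h3 : HasFDerivAt Ψ (fderiv ℝ Ψ p) p := ((hs p hpΨ).differentiableAt (by simp)).hasFDerivAt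
    have h4 := hd.hasFDerivAt.comp p h3
    have h5 : HasFDerivAt (Ψ.symm ∘ Ψ) (ContinuousLinearMap.id ℝ (AdaptedModel n)) p := by
      refine (hasFDerivAt_id p).congr_of_eventuallyEq ?_
      filter_upwards [Ψ.open_source.mem_nhds hpΨ] with q hq using Ψ.left_inv hq
    exact DFunLike.congr_fun (h4.unique h5) _
  · rw [OpenPartialHomeomorph.trans_source]
    refine ⟨hx, ?_⟩
    change c x ∈ Ψ.target
    rw [← h0]
    exact Ψ.map_source h0s

end AdaptedCharts

/-! ### Descent to the transverse coordinates. -/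

section Descent

variable {F : Type v} [NormedAddCommGroup F] [NormedSpace ℝ F]

/-- A hyper-Kähler structure on an open subset of a vector space. -/
structure LocalHyperKahler (V : Set F) where
  J : Fin 3 → F → F →L[ℝ] F
  G : F → F →L[ℝ] F →L[ℝ] ℝ
  smooth_J : ∀ α, ∀ y ∈ V, ContDiffAt ℝ ∞ (J α) y
  smooth_G : ∀ y ∈ V, ContDiffAt ℝ ∞ G y
  G_symm : ∀ y ∈ V, ∀ v w, G y v w = G y w v
  G_pos : ∀ y ∈ V, ∀ v, v ≠ 0 → 0 < G y v v
  J_J : ∀ α β, ∀ y ∈ V, ∀ v, J α y (J β y v) = ∑ γ, eps α β γ • J γ y v - kron α β • v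
  compat : ∀ α, ∀ y ∈ V, ∀ v w, G y (J α y v) (J α y w) = G y v w
  integrable : ∀ α, ∀ y ∈ V, ∀ v w, nijenhuisCoord (J α) y v w = 0
  closed_Ω : ∀ α, ∀ y ∈ V, ∀ u v w,
    fderiv ℝ (fun y => bilinComp (G y) (J α y)) y u v w
      + fderiv ℝ (fun y => bilinComp (G y) (J α y)) y v w u
      + fderiv ℝ (fun y => bilinComp (G y) (J α y)) y w u v = 0

/-- A ball for the product norm is a product of balls, so each slice with fixed second coordinate is
convex and contains the point over `0`. -/
theorem eq_of_fderiv_fst_eq_zero {A H : Type*} [NormedAddCommGroup A] [NormedSpace ℝ A]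
    [NormedAddCommGroup H] [NormedSpace ℝ H] {f : A × F → H} {r : ℝ}
    (hf : ∀ p ∈ Metric.ball (0 : A × F) r, DifferentiableAt ℝ f p)
    (h0 : ∀ p ∈ Metric.ball (0 : A × F) r, ∀ s, fderiv ℝ f p (s, 0) = 0)
    {p : A × F} (hp : p ∈ Metric.ball (0 : A × F) r) : f p = f (0, p.2) := by
  have hball : ∀ s y, ((s, y) : A × F) ∈ Metric.ball (0 : A × F) r ↔ ‖s‖ < r ∧ ‖y‖ < r :=
    fun s y => by rw [mem_ball_zero_iff, Prod.norm_mk, max_lt_iff]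
  obtain ⟨s, y⟩ := p
  have hsy := (hball s y).1 hp
  have hmem : ∀ t ∈ Metric.ball (0 : A) r, ((t, y) : A × F) ∈ Metric.ball (0 : A × F) r :=
    fun t ht => (hball t y).2 ⟨mem_ball_zero_iff.1 ht, hsy.2⟩
  have hd : ∀ t ∈ Metric.ball (0 : A) r, HasFDerivAt (fun t => f (t, y)) (0 : A →L[ℝ] H) t :=
    fun t ht => by
    have h1 := HasFDerivAt.comp (g := f) (f := fun t => (t, y)) t
      (hf _ (hmem t ht)).hasFDerivAt (hasFDerivAt_prodMk_left t y)
    refine h1.congr_fderiv ?_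
    ext s'
    simpa using h0 _ (hmem t ht) s'
  refine Metric.isOpen_ball.is_const_of_fderiv_eq_zero (f := fun t => f (t, y))
    (convex_ball (0 : A) r).isPreconnected (fun t ht =>
    (hd t ht).differentiableAt.differentiableWithinAt) (fun t ht => (hd t ht).fderiv)
    (mem_ball_zero_iff.2 hsy.1) (Metric.mem_ball_self ((norm_nonneg _).trans_lt hsy.1))

theorem hasFDerivAt_comp_snd {A H : Type*} [NormedAddCommGroup A] [NormedSpace ℝ A]
    [NormedAddCommGroup H] [NormedSpace ℝ H] {k : F → H} {k' : F →L[ℝ] H} {z : A × F}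
    (hk : HasFDerivAt k k' z.2) :
    HasFDerivAt (fun z : A × F => k z.2) (k' ∘L ContinuousLinearMap.snd ℝ A F) z :=
  hk.comp z hasFDerivAt_snd

namespace LocalCosymp

variable {r : ℝ} (T : LocalCosymp (Metric.ball (0 : (Fin 3 → ℝ) × F) r))
  (hT : ∀ α, ∀ z ∈ Metric.ball (0 : (Fin 3 → ℝ) × F) r, T.ξ α z = (Pi.single α 1, 0))

include hT

theorem fderiv_ξ_eq_zero (α : Fin 3) {z : (Fin 3 → ℝ) × F}
    (hz : z ∈ Metric.ball (0 : (Fin 3 → ℝ) × F) r) : fderiv ℝ (T.ξ α) z = 0 := by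
  rw [fderiv_eq_of_eqOn Metric.isOpen_ball hz (hT α)]
  simp

omit hT in
theorem vertical_eq_sum (s : Fin 3 → ℝ) :
    ((s, 0) : (Fin 3 → ℝ) × F) = ∑ α, s α • ((Pi.single α 1, 0) : (Fin 3 → ℝ) × F) := by
  refine Prod.ext ?_ ?_
  · rw [Prod.fst_sum]
    ext i
    simp [Pi.single_apply]
  · rw [Prod.snd_sum]
    simp

/-- The Reeb fields have constant coefficients here, so the invariance formula `lie_φ` reduces to
vanishing of the derivatives in the leaf directions. The same holds for `η` and `g`. -/
theorem φ_const (β : Fin 3) {z : (Fin 3 → ℝ) × F}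
    (hz : z ∈ Metric.ball (0 : (Fin 3 → ℝ) × F) r) : T.φ β z = T.φ β (0, z.2) := by
  refine eq_of_fderiv_fst_eq_zero (fun p hp => T.dφ β hp) (fun p hp s => ?_) hz
  refine ContinuousLinearMap.ext fun w => ?_
  rw [vertical_eq_sum, map_sum, sum_apply]
  refine Finset.sum_eq_zero fun α _ => ?_
  rw [map_smul, smul_apply, ← hT α p hp, T.lie_φ Metric.isOpen_ball α β hp,
    T.fderiv_ξ_eq_zero hT α hp]
  simp

theorem η_const (β : Fin 3) {z : (Fin 3 → ℝ) × F}
    (hz : z ∈ Metric.ball (0 : (Fin 3 → ℝ) × F) r) : T.η β z = T.η β (0, z.2) := by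
  refine eq_of_fderiv_fst_eq_zero (fun p hp => T.dη β hp) (fun p hp s => ?_) hz
  refine ContinuousLinearMap.ext fun w => ?_
  rw [vertical_eq_sum, map_sum, sum_apply]
  refine Finset.sum_eq_zero fun α _ => ?_
  rw [map_smul, smul_apply, ← hT α p hp, T.lie_η Metric.isOpen_ball α β hp,
    T.fderiv_ξ_eq_zero hT α hp]
  simp

theorem g_const {z : (Fin 3 → ℝ) × F}
    (hz : z ∈ Metric.ball (0 : (Fin 3 → ℝ) × F) r) : T.g z = T.g (0, z.2) := by
  refine eq_of_fderiv_fst_eq_zero (fun p hp => T.dg hp) (fun p hp s => ?_) hz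
  refine ContinuousLinearMap.ext fun v => ContinuousLinearMap.ext fun w => ?_
  rw [vertical_eq_sum, map_sum, sum_apply, sum_apply]
  refine Finset.sum_eq_zero fun α _ => ?_
  rw [map_smul, smul_apply, smul_apply, ← hT α p hp, T.lie_g Metric.isOpen_ball α hp,
    T.fderiv_ξ_eq_zero hT α hp]
  simp

omit hT

/-- The endomorphism field induced on the transverse coordinates. -/
def transJ (α : Fin 3) (y : F) : F →L[ℝ] F :=
  ContinuousLinearMap.snd ℝ (Fin 3 → ℝ) F ∘L T.φ α (0, y) ∘L ContinuousLinearMap.inr ℝ (Fin 3 → ℝ) F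

/-- The metric induced on the transverse coordinates. -/
def transG (y : F) : F →L[ℝ] F →L[ℝ] ℝ :=
  ContinuousLinearMap.precomp ℝ (ContinuousLinearMap.inr ℝ (Fin 3 → ℝ) F) ∘L
    (T.g (0, y) - ∑ α, (T.η α (0, y)).smulRight (T.η α (0, y))) ∘L
      ContinuousLinearMap.inr ℝ (Fin 3 → ℝ) F

theorem zero_mk_mem {y : F} : ((0, y) : (Fin 3 → ℝ) × F) ∈ Metric.ball (0 : (Fin 3 → ℝ) × F) r ↔
    y ∈ Metric.ball (0 : F) r := by
  rw [mem_ball_zero_iff, mem_ball_zero_iff, Prod.norm_mk, norm_zero,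
    max_eq_right (norm_nonneg _)]

include hT

/-- By `φ_ξ` the vertical space is preserved, so `φ_α` acts on the quotient; by `φ_const` this
action does not depend on the leaf coordinates. -/
theorem snd_φ (α : Fin 3) {z : (Fin 3 → ℝ) × F}
    (hz : z ∈ Metric.ball (0 : (Fin 3 → ℝ) × F) r) (v : (Fin 3 → ℝ) × F) :
    (T.φ α z v).2 = T.transJ α z.2 v.2 := by
  have hv : v = (v.1, 0) + (0, v.2) := by ext <;> simp
  have h1 : (T.φ α z (v.1, 0)).2 = 0 := by
    rw [vertical_eq_sum, map_sum, Prod.snd_sum]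
    refine Finset.sum_eq_zero fun β _ => ?_
    rw [map_smul, ← hT β z hz, T.φ_ξ α β z hz, Prod.smul_snd, Prod.snd_sum]
    simp [hT _ z hz]
  conv_lhs => rw [hv, map_add, Prod.snd_add, h1, zero_add, T.φ_const hT α hz]
  rfl

/-- The symmetric form `g - ∑ η_α ⊗ η_α` vanishes on vertical vectors, so only transverse components
matter. This makes it the right candidate for the projected metric on horizontal vectors. -/
theorem transG_eq {z : (Fin 3 → ℝ) × F}
    (hz : z ∈ Metric.ball (0 : (Fin 3 → ℝ) × F) r) (v w : (Fin 3 → ℝ) × F) :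
    T.transG z.2 v.2 w.2 = T.g z v w - ∑ α, T.η α z v * T.η α z w := by
  have hv : ∀ v : (Fin 3 → ℝ) × F, v = (v.1, 0) + (0, v.2) := fun v => by ext <;> simp
  let B : ((Fin 3 → ℝ) × F) → ((Fin 3 → ℝ) × F) → ℝ :=
    fun v w => T.g z v w - ∑ α, T.η α z v * T.η α z w
  have hsymm : ∀ v w, B v w = B w v := fun v w => by
    simp only [B, T.g_symm z hz v w, mul_comm]
  have hadd : ∀ u v w, B (u + v) w = B u w + B v w := fun u v w => by
    simp only [B, map_add, add_apply, add_mul, Finset.sum_add_distrib]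
    ring
  have h0 : ∀ s w, B (s, 0) w = 0 := fun s w => by
    have hs : ((s, 0) : (Fin 3 → ℝ) × F) = ∑ α, s α • T.ξ α z := by
      rw [vertical_eq_sum]
      exact Finset.sum_congr rfl fun α _ => by rw [hT α z hz]
    have hη : ∀ α, T.η α z (s, 0) = s α := fun α => by
      rw [hs, map_sum]
      simp [T.η_ξ_eq _ _ hz, kron]
    simp only [B, hη]
    rw [hs, map_sum, sum_apply, sub_eq_zero]
    refine Finset.sum_congr rfl fun α _ => ?_
    rw [map_smul, smul_apply, T.g_ξ α hz, smul_eq_mul]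
  have h1 : B v w = B (0, v.2) (0, w.2) := by
    conv_lhs => rw [hv v, hadd, h0, zero_add, hsymm, hv w, hadd, h0, zero_add, hsymm]
  refine Eq.trans ?_ h1.symm
  simp only [B, T.g_const hT hz, T.η_const hT _ hz, transG]
  simp [ContinuousLinearMap.precomp_apply]

theorem transG_eq' {y : F} (hy : y ∈ Metric.ball (0 : F) r) (v w : (Fin 3 → ℝ) × F) :
    T.transG y v.2 w.2 = T.g (0, y) v w - ∑ α, T.η α (0, y) v * T.η α (0, y) w :=
  T.transG_eq hT (zero_mk_mem.2 hy) v w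

theorem snd_φ' (α : Fin 3) {y : F} (hy : y ∈ Metric.ball (0 : F) r) (v : (Fin 3 → ℝ) × F) :
    (T.φ α (0, y) v).2 = T.transJ α y v.2 := T.snd_φ hT α (zero_mk_mem.2 hy) v

omit hT in
theorem smooth_transJ (α : Fin 3) {y : F} (hy : y ∈ Metric.ball (0 : F) r) :
    ContDiffAt ℝ ∞ (T.transJ α) y := by
  have h := (T.smooth_φ α _ (zero_mk_mem.2 hy)).comp y
    (contDiff_prodMk_right (0 : Fin 3 → ℝ)).contDiffAt
  exact contDiffAt_const.clm_comp (h.clm_comp contDiffAt_const)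

omit hT in
theorem smooth_transG {y : F} (hy : y ∈ Metric.ball (0 : F) r) :
    ContDiffAt ℝ ∞ T.transG y := by
  have hg := (T.smooth_g _ (zero_mk_mem.2 hy)).comp y
    (contDiff_prodMk_right (0 : Fin 3 → ℝ)).contDiffAt
  have hη := fun α => (T.smooth_η α _ (zero_mk_mem.2 hy)).comp y
    (contDiff_prodMk_right (0 : Fin 3 → ℝ)).contDiffAt
  have h1 : ContDiffAt ℝ ∞ (fun y => T.g (0, y) -
      ∑ α, (T.η α (0, y)).smulRight (T.η α (0, y))) y :=
    hg.sub (ContDiffAt.sum fun α _ => (hη α).smulRight (hη α))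
  exact contDiffAt_const.clm_comp (h1.clm_comp contDiffAt_const)

theorem fderiv_transJ (α : Fin 3) {y : F} (hy : y ∈ Metric.ball (0 : F) r)
    (u w : (Fin 3 → ℝ) × F) :
    fderiv ℝ (T.transJ α) y u.2 w.2 = (fderiv ℝ (T.φ α) (0, y) u w).2 := by
  have hz := (zero_mk_mem (r := r)).2 hy
  have h1 := fderiv_eq_of_eqOn Metric.isOpen_ball hz (f := fun z => (T.φ α z w).2)
    (k := fun z => T.transJ α z.2 w.2) fun z hz => T.snd_φ hT α hz w
  have hJ := (T.smooth_transJ α hy).differentiableAt (by simp)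
  have h2 : HasFDerivAt (fun z : (Fin 3 → ℝ) × F => T.transJ α z.2 w.2) _ (0, y) :=
    hasFDerivAt_comp_snd (z := ((0, y) : (Fin 3 → ℝ) × F)) (k := fun y => T.transJ α y w.2)
      (hJ.clm_apply (differentiableAt_const w.2)).hasFDerivAt
  have h3 : HasFDerivAt (fun z : (Fin 3 → ℝ) × F => (T.φ α z w).2) _ (0, y) :=
    hasFDerivAt_snd.comp (f := fun z => T.φ α z w) (0, y)
      ((T.dφ α hz).clm_apply (differentiableAt_const w)).hasFDerivAt
  rw [h2.fderiv, h3.fderiv] at h1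
  have h4 := DFunLike.congr_fun h1 u
  simp only [ContinuousLinearMap.comp_apply, ContinuousLinearMap.coe_snd'] at h4
  rw [fderiv_clm_apply_const (T.dφ α hz), fderiv_clm_apply_const hJ] at h4
  exact h4.symm

/-- The transverse fundamental form pulls back to `Φ_α - ∑ ε_{γαδ} η_γ ⊗ η_δ`; this is its
differentiated version. -/
theorem fderiv_transΩ (α : Fin 3) {y : F} (hy : y ∈ Metric.ball (0 : F) r)
    (u v w : (Fin 3 → ℝ) × F) :
    fderiv ℝ (fun y => bilinComp (T.transG y) (T.transJ α y)) y u.2 v.2 w.2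
      = fderiv ℝ (T.Φ α) (0, y) u v w - ∑ γ, ∑ δ, eps γ α δ *
        (T.η γ (0, y) v * fderiv ℝ (T.η δ) (0, y) u w
          + T.η δ (0, y) w * fderiv ℝ (T.η γ) (0, y) u v) := by
  have hz := (zero_mk_mem (r := r)).2 hy
  have hΩ : DifferentiableAt ℝ (fun y => bilinComp (T.transG y) (T.transJ α y)) y :=
    (contDiffAt_bilinComp (T.smooth_transG hy) (T.smooth_transJ α hy)).differentiableAt (by simp)
  have dc : ∀ v : (Fin 3 → ℝ) × F, DifferentiableAt ℝ (fun _ : (Fin 3 → ℝ) × F => v) (0, y) :=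
    fun v => differentiableAt_const v
  have h1 := fderiv_eq_of_eqOn Metric.isOpen_ball hz
    (f := fun z => bilinComp (T.transG z.2) (T.transJ α z.2) v.2 w.2)
    (k := fun z => T.Φ α z v w - ∑ γ, ∑ δ, eps γ α δ * (T.η γ z v * T.η δ z w))
    fun z hz => by
      rw [bilinComp_apply, ← T.snd_φ hT α hz, T.transG_eq hT hz, Φ_apply]
      refine congrArg _ (Finset.sum_congr rfl fun γ _ => ?_)
      rw [T.η_φ γ α z hz, Finset.mul_sum]
      exact Finset.sum_congr rfl fun δ _ => by ring
  have h2 : HasFDerivAt (fun z : (Fin 3 → ℝ) × F =>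
      bilinComp (T.transG z.2) (T.transJ α z.2) v.2 w.2) _ (0, y) :=
    hasFDerivAt_comp_snd (z := ((0, y) : (Fin 3 → ℝ) × F))
      (k := fun y => bilinComp (T.transG y) (T.transJ α y) v.2 w.2)
      ((hΩ.clm_apply (differentiableAt_const v.2)).clm_apply (differentiableAt_const w.2)).hasFDerivAt
  have h3 : HasFDerivAt (fun z => T.Φ α z v w - ∑ γ, ∑ δ, eps γ α δ * (T.η γ z v * T.η δ z w))
      _ (0, y) :=
    (((T.dΦ α hz).clm_apply (dc v)).clm_apply (dc w)).hasFDerivAt.fun_sub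
      (HasFDerivAt.fun_sum fun γ _ => HasFDerivAt.fun_sum fun δ _ =>
        ((((T.dη γ hz).clm_apply (dc v)).hasFDerivAt.fun_mul
          ((T.dη δ hz).clm_apply (dc w)).hasFDerivAt).const_mul (eps γ α δ)))
  rw [h2.fderiv, h3.fderiv] at h1
  have h4 := DFunLike.congr_fun h1 u
  simp only [ContinuousLinearMap.comp_apply, ContinuousLinearMap.coe_snd', sub_apply, sum_apply,
    smul_apply, add_apply, smul_eq_mul, fderiv_clm_apply_const (T.dη _ hz),
    fderiv_clm_apply_const (T.dΦ _ hz), fderiv_clm_apply_const ((T.dΦ _ hz).clm_apply (dc _)),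
    fderiv_clm_apply_const hΩ,
    fderiv_clm_apply_const (hΩ.clm_apply (differentiableAt_const _))] at h4
  exact h4

/-- The hyper-Kähler structure on the transverse coordinates. -/
def descend : LocalHyperKahler (Metric.ball (0 : F) r) where
  J := T.transJ
  G := T.transG
  smooth_J α y hy := T.smooth_transJ α hy
  smooth_G y hy := T.smooth_transG hy
  G_symm y hy v w := by
    have h1 := T.transG_eq' hT hy (0, v) (0, w)
    have h2 := T.transG_eq' hT hy (0, w) (0, v)
    simp only at h1 h2
    rw [h1, h2, T.g_symm _ (zero_mk_mem.2 hy)]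
    simp only [mul_comm]
  G_pos y hy w hw := by
    have hz := (zero_mk_mem (r := r)).2 hy
    -- The horizontal lift of `w`: on it the correction terms vanish, and positivity is that of `g`.
    let v : (Fin 3 → ℝ) × F := (0, w) - ∑ α, T.η α (0, y) (0, w) • T.ξ α (0, y)
    have hη : ∀ γ, T.η γ (0, y) v = 0 := fun γ => by
      simp only [v, map_sub, map_sum, map_smul, T.η_ξ_eq _ _ hz, kron]
      simp
    have hv2 : v.2 = w := by
      simp only [v, Prod.snd_sub, Prod.snd_sum, Prod.smul_snd, hT _ _ hz]
      simp
    have hv : v ≠ 0 := fun h => hw (by rw [← hv2, h]; rfl)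
    have h1 := T.transG_eq' hT hy v v
    rw [hv2] at h1
    rw [h1]
    simpa [hη] using T.g_pos _ hz v hv
  J_J α β y hy v := by
    have hz := (zero_mk_mem (r := r)).2 hy
    have h1 := T.φ_φ α β _ hz (0, v)
    have h2 := congrArg Prod.snd h1
    simp only [Prod.snd_sub, Prod.smul_snd, Prod.snd_sum, hT _ _ hz, T.snd_φ' hT _ hy] at h2
    simpa using h2
  compat α y hy v w := by
    have hz := (zero_mk_mem (r := r)).2 hy
    have h1 := T.transG_eq' hT hy (T.φ α (0, y) (0, v)) (T.φ α (0, y) (0, w))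
    rw [T.snd_φ' hT _ hy, T.snd_φ' hT _ hy, T.compat α _ hz] at h1
    rw [h1]
    have h2 := T.transG_eq' hT hy (0, v) (0, w)
    simp only at h2
    rw [h2]
    -- Composition with `φ_α` kills `η_α` and exchanges the other two forms up to sign. The
    -- correction sum thus loses exactly its `α` term, which compatibility of `g` supplies.
    simp only [T.η_φ _ _ _ hz, Fin.sum_univ_three]
    fin_cases α <;> norm_num [eps]
    · ring
    · ring
    · change _ - T.η 2 (0, y) (0, v) * T.η 2 (0, y) (0, w) - _ = _
      ring
  integrable α y hy v w := by
    have hz := (zero_mk_mem (r := r)).2 hy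
    have h1 := congrArg Prod.snd (T.normal α _ hz (0, v) (0, w))
    simp only [nijenhuisCoord, Prod.snd_sub, Prod.snd_add, ← T.fderiv_transJ hT α hy,
      T.snd_φ' hT _ hy] at h1
    exact h1
  closed_Ω α y hy u v w := by
    have hz := (zero_mk_mem (r := r)).2 hy
    have h1 := T.fderiv_transΩ hT α hy (0, u) (0, v) (0, w)
    have h2 := T.fderiv_transΩ hT α hy (0, v) (0, w) (0, u)
    have h3 := T.fderiv_transΩ hT α hy (0, w) (0, u) (0, v)
    simp only at h1 h2 h3
    rw [h1, h2, h3]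
    have h4 : fderiv ℝ (T.Φ α) (0, y) (0, u) (0, v) (0, w)
      + fderiv ℝ (T.Φ α) (0, y) (0, v) (0, w) (0, u)
      + fderiv ℝ (T.Φ α) (0, y) (0, w) (0, u) (0, v) = 0 := T.closed_Φ α _ hz _ _ _
    -- In the cyclic sum the products of `η_γ` with derivatives of `η_δ` cancel, by closedness and
    -- antisymmetry of `ε_{γαδ}` in `γ` and `δ`.
    have h5 := fun γ => T.closed_η γ _ hz (0, u) (0, v)
    have h6 := fun γ => T.closed_η γ _ hz (0, v) (0, w)
    have h7 := fun γ => T.closed_η γ _ hz (0, w) (0, u)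
    simp only [h5, h6, h7, Fin.sum_univ_three]
    have h8 : ∀ γ δ, eps γ α δ = - eps δ α γ := fun γ δ => by simp only [eps]; ring
    have h9 : ∀ γ, eps γ α γ = 0 := fun γ => by simp only [eps]; ring
    rw [h8 1 0, h8 2 0, h8 2 1, h9, h9, h9]
    linear_combination h4

end LocalCosymp

end Descent

/-! ### Smooth sections from smooth coordinate expressions. -/

section SmoothnessFromCoordinates

variable {m : ℕ} {X : Type u} [TopologicalSpace X] [ChartedSpace (EuclideanSpace ℝ (Fin m)) X]
  [IsManifold (𝓡 m) ∞ X]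

theorem fwd_chartAt_eq {x y : X} (hy : y ∈ (chartAt (EuclideanSpace ℝ (Fin m)) x).source) :
    haveI : IsManifold (𝓡 m) 1 X := IsManifold.of_le (n := ∞) (by simp)
    (trivializationAt (EuclideanSpace ℝ (Fin m)) (TangentSpace (𝓡 m)) x).continuousLinearMapAt ℝ y
      = fwd m (chartAt (EuclideanSpace ℝ (Fin m)) x) y := by
  have : IsManifold (𝓡 m) 1 X := IsManifold.of_le (n := ∞) (by simp)
  rw [TangentBundle.continuousLinearMapAt_trivializationAt hy]
  rfl

theorem fwd_chartAt_symm {x y : X} (hy : y ∈ (chartAt (EuclideanSpace ℝ (Fin m)) x).source)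
    (v : EuclideanSpace ℝ (Fin m)) :
    haveI : IsManifold (𝓡 m) 1 X := IsManifold.of_le (n := ∞) (by simp)
    fwd m (chartAt (EuclideanSpace ℝ (Fin m)) x) y
      ((trivializationAt (EuclideanSpace ℝ (Fin m)) (TangentSpace (𝓡 m)) x).symmL ℝ y v) = v := by
  have : IsManifold (𝓡 m) 1 X := IsManifold.of_le (n := ∞) (by simp)
  rw [← fwd_chartAt_eq hy]
  have hb : y ∈ (trivializationAt (EuclideanSpace ℝ (Fin m)) (TangentSpace (𝓡 m)) x).baseSet := hy
  exact (trivializationAt (EuclideanSpace ℝ (Fin m))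
    (TangentSpace (𝓡 m)) x).continuousLinearMapAt_symmL (R := ℝ) hb v

/-- The trivialisation of the tangent bundle at `x` is the differential of the preferred chart, so
in it the section reads as the coordinate expression composed with that chart. -/
theorem smoothEndoField_of_coord {J : EndoField m X}
    (hJ : ∀ x, ContDiffAt ℝ ∞ (coordEndo m (chartAt (EuclideanSpace ℝ (Fin m)) x) J)
      (chartAt (EuclideanSpace ℝ (Fin m)) x x)) : SmoothEndoField J := by
  have : IsManifold (𝓡 m) 1 X := IsManifold.of_le (n := ∞) (by simp)
  intro x
  rw [contMDiffAt_hom_bundle]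
  refine ⟨contMDiffAt_id, ?_⟩
  have hc := isSmoothChart_chartAt (m := m) x
  have h1 : ContMDiffAt (𝓡 m)
      𝓘(ℝ, EuclideanSpace ℝ (Fin m) →L[ℝ] EuclideanSpace ℝ (Fin m)) ∞
      (coordEndo m (chartAt (EuclideanSpace ℝ (Fin m)) x) J ∘
        chartAt (EuclideanSpace ℝ (Fin m)) x) x :=
    (hJ x).contMDiffAt.comp x ((hc.smooth x (mem_chart_source _ x)).contMDiffAt
      ((chartAt (EuclideanSpace ℝ (Fin m)) x).open_source.mem_nhds (mem_chart_source _ x)))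
  refine h1.congr_of_eventuallyEq ?_
  filter_upwards [(chartAt (EuclideanSpace ℝ (Fin m)) x).open_source.mem_nhds (mem_chart_source _ x)] with y hy
  refine ContinuousLinearMap.ext fun v => ?_
  refine (DFunLike.congr_fun (fwd_chartAt_eq hy) _).trans ?_
  refine (hc.endo_apply hy J _).trans ?_
  exact congrArg _ (fwd_chartAt_symm hy v)

theorem contMDiff_bilin_of_coord
    {g : ∀ x : X, TangentSpace (𝓡 m) x →L[ℝ] TangentSpace (𝓡 m) x →L[ℝ] ℝ}
    (hg : ∀ x, ContDiffAt ℝ ∞ (coordBilin m (chartAt (EuclideanSpace ℝ (Fin m)) x) g)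
      (chartAt (EuclideanSpace ℝ (Fin m)) x x)) :
    ContMDiff (𝓡 m) ((𝓡 m).prod 𝓘(ℝ, EuclideanSpace ℝ (Fin m) →L[ℝ]
        EuclideanSpace ℝ (Fin m) →L[ℝ] ℝ)) ∞
      (fun b ↦ Bundle.TotalSpace.mk' (EuclideanSpace ℝ (Fin m) →L[ℝ]
        EuclideanSpace ℝ (Fin m) →L[ℝ] ℝ)
        (E := fun b => TangentSpace (𝓡 m) b →L[ℝ] TangentSpace (𝓡 m) b →L[ℝ] ℝ) b (g b)) := by
  have : IsManifold (𝓡 m) 1 X := IsManifold.of_le (n := ∞) (by simp)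
  intro x
  rw [contMDiffAt_hom_bundle]
  refine ⟨contMDiffAt_id, ?_⟩
  have hc := isSmoothChart_chartAt (m := m) x
  have h1 : ContMDiffAt (𝓡 m)
      𝓘(ℝ, EuclideanSpace ℝ (Fin m) →L[ℝ] EuclideanSpace ℝ (Fin m) →L[ℝ] ℝ) ∞
      (coordBilin m (chartAt (EuclideanSpace ℝ (Fin m)) x) g ∘
        chartAt (EuclideanSpace ℝ (Fin m)) x) x :=
    (hg x).contMDiffAt.comp x ((hc.smooth x (mem_chart_source _ x)).contMDiffAt
      ((chartAt (EuclideanSpace ℝ (Fin m)) x).open_source.mem_nhds (mem_chart_source _ x)))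
  refine h1.congr_of_eventuallyEq ?_
  filter_upwards [(chartAt (EuclideanSpace ℝ (Fin m)) x).open_source.mem_nhds (mem_chart_source _ x)] with y hy
  refine ContinuousLinearMap.ext fun v => ContinuousLinearMap.ext fun w => ?_
  have hb : y ∈ (trivializationAt (EuclideanSpace ℝ (Fin m)) (TangentSpace (𝓡 m)) x).baseSet := hy
  refine (inCoordinates_apply_eq₂ (F₃ := ℝ) (E₃ := Bundle.Trivial X ℝ) hb hb
    (Set.mem_univ _)).trans ?_
  have htriv : ∀ c : ℝ, (trivializationAt ℝ (Bundle.Trivial X ℝ) x).linearMapAt ℝ y c = c :=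
    fun c => by
      rw [Bundle.Trivialization.coe_linearMapAt_of_mem _ (by exact Set.mem_univ y)]
      rfl
  rw [← Bundle.Trivialization.symmL_apply (R := ℝ) _ hb,
    ← Bundle.Trivialization.symmL_apply (R := ℝ) _ hb]
  refine (htriv _).trans ?_
  refine (hc.bilin_apply hy g _ _).trans ?_
  rw [fwd_chartAt_symm hy, fwd_chartAt_symm hy]
  rfl

/-- By compactness of the unit sphere the form dominates a positive multiple of the squared norm. -/
theorem isVonNBounded_of_posDef {E : Type*} [NormedAddCommGroup E] [NormedSpace ℝ E]
    [FiniteDimensional ℝ E] {g : E →L[ℝ] E →L[ℝ] ℝ} (hg : ∀ v, v ≠ 0 → 0 < g v v) :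
    Bornology.IsVonNBounded ℝ {v | g v v < 1} := by
  have : ProperSpace E := FiniteDimensional.proper ℝ E
  rw [NormedSpace.isVonNBounded_iff ℝ]
  obtain ⟨c, hc, hcg⟩ : ∃ c > 0, ∀ v, c * ‖v‖ ^ 2 ≤ g v v := by
    have hcont : Continuous fun v => g v v := by fun_prop
    rcases (Metric.sphere (0 : E) 1).eq_empty_or_nonempty with h | h
    -- The sphere is empty in dimension zero, a case which occurs for `n = 0`.
    · refine ⟨1, one_pos, fun v => ?_⟩
      have hv : v = 0 := by
        by_contra hv
        have : ‖v‖⁻¹ • v ∈ Metric.sphere (0 : E) 1 := by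
          rw [mem_sphere_zero_iff_norm, norm_smul, norm_inv, norm_norm,
            inv_mul_cancel₀ (norm_ne_zero_iff.2 hv)]
        rw [h] at this
        exact this
      simp [hv]
    · obtain ⟨w, hw, hmin⟩ := (isCompact_sphere (0 : E) 1).exists_isMinOn h hcont.continuousOn
      have hw0 : w ≠ 0 := by
        rintro rfl
        simp at hw
      refine ⟨g w w, hg w hw0, fun v => ?_⟩
      rcases eq_or_ne v 0 with rfl | hv
      · simp
      · have hv' := norm_ne_zero_iff.2 hv
        have h1 : ‖v‖⁻¹ • v ∈ Metric.sphere (0 : E) 1 := by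
          rw [mem_sphere_zero_iff_norm, norm_smul, norm_inv, norm_norm, inv_mul_cancel₀ hv']
        have h2 : g w w ≤ g (‖v‖⁻¹ • v) (‖v‖⁻¹ • v) := hmin h1
        simp only [map_smul, smul_apply, smul_eq_mul] at h2
        calc g w w * ‖v‖ ^ 2 ≤ ‖v‖⁻¹ * (‖v‖⁻¹ * g v v) * ‖v‖ ^ 2 := by gcongr
          _ = g v v := by field_simp
  refine (Metric.isBounded_closedBall (x := (0 : E)) (r := 1 + c⁻¹)).subset fun v hv => ?_
  rw [mem_closedBall_zero_iff]
  have h1 : c * ‖v‖ ^ 2 < 1 := (hcg v).trans_lt hv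
  have h2 : ‖v‖ ^ 2 < c⁻¹ := by rwa [inv_eq_one_div, lt_div_iff₀' hc]
  nlinarith [norm_nonneg v, inv_pos.2 hc]

end SmoothnessFromCoordinates

/-! ### Transverse hyper-Kähler structures and their changes of coordinates. -/

section TransverseStructure

/-- Restriction to a smaller set. -/
def LocalCosymp.mono {E : Type*} [NormedAddCommGroup E] [NormedSpace ℝ E] {U V : Set E}
    (T : LocalCosymp U) (h : V ⊆ U) : LocalCosymp V where
  φ := T.φ
  ξ := T.ξ
  η := T.η
  g := T.g
  smooth_φ α z hz := T.smooth_φ α z (h hz)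
  smooth_ξ α z hz := T.smooth_ξ α z (h hz)
  smooth_η α z hz := T.smooth_η α z (h hz)
  smooth_g z hz := T.smooth_g z (h hz)
  g_symm z hz := T.g_symm z (h hz)
  g_pos z hz := T.g_pos z (h hz)
  φ_sq α z hz := T.φ_sq α z (h hz)
  η_ξ α z hz := T.η_ξ α z (h hz)
  φ_φ α β z hz := T.φ_φ α β z (h hz)
  φ_ξ α β z hz := T.φ_ξ α β z (h hz)
  η_φ α β z hz := T.η_φ α β z (h hz)
  compat α z hz := T.compat α z (h hz)
  closed_η α z hz := T.closed_η α z (h hz)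
  closed_Φ α z hz := T.closed_Φ α z (h hz)
  normal α z hz := T.normal α z (h hz)

/-- Restriction to a smaller set. -/
def LocalHyperKahler.mono {F : Type*} [NormedAddCommGroup F] [NormedSpace ℝ F] {U V : Set F}
    (D : LocalHyperKahler U) (h : V ⊆ U) : LocalHyperKahler V where
  J := D.J
  G := D.G
  smooth_J α z hz := D.smooth_J α z (h hz)
  smooth_G z hz := D.smooth_G z (h hz)
  G_symm z hz := D.G_symm z (h hz)
  G_pos z hz := D.G_pos z (h hz)
  J_J α β z hz := D.J_J α β z (h hz)
  compat α z hz := D.compat α z (h hz)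
  integrable α z hz := D.integrable α z (h hz)
  closed_Ω α z hz := D.closed_Ω α z (h hz)

variable {n : ℕ} {M : Type u} [TopologicalSpace M]
  [ChartedSpace (EuclideanSpace ℝ (Fin (4 * n + 3))) M] [IsManifold (𝓡 (4 * n + 3)) ∞ M]
  {S : AlmostContactMetric3 n M} (hS : S.Is3Cosymplectic)
  {e : OpenPartialHomeomorph M (AdaptedModel n)} {r : ℝ} (he : IsAdaptedChart S e r)

/-- The expression of the structure in an adapted chart. -/
def IsAdaptedChart.localCosymp : LocalCosymp (Metric.ball (0 : AdaptedModel n) r) :=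
  (coordStructure S hS he.chart).mono he.target_eq.ge

theorem IsAdaptedChart.localCosymp_ξ (α : Fin 3) (z : AdaptedModel n)
    (hz : z ∈ Metric.ball (0 : AdaptedModel n) r) :
    (he.localCosymp hS).ξ α z = (Pi.single α 1, 0) := he.field_eq α z (he.target_eq.ge hz)

/-- The hyper-Kähler structure on the transverse coordinates of an adapted chart. -/
def IsAdaptedChart.transverse :
    LocalHyperKahler (Metric.ball (0 : EuclideanSpace ℝ (Fin (4 * n))) r) :=
  (he.localCosymp hS).descend (he.localCosymp_ξ hS)

include he in
theorem IsAdaptedChart.mem_ball {y : M} (hy : y ∈ e.source) :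
    e y ∈ Metric.ball (0 : AdaptedModel n) r := he.target_eq.le (e.map_source hy)

theorem IsAdaptedChart.transverse_J (α : Fin 3) {y : M} (hy : y ∈ e.source)
    (v : TangentSpace (𝓡 (4 * n + 3)) y) :
    (fwd (4 * n + 3) e y (S.φ α y v)).2
      = (he.transverse hS).J α (e y).2 (fwd (4 * n + 3) e y v).2 := by
  refine Eq.trans ?_ ((he.localCosymp hS).snd_φ (he.localCosymp_ξ hS) α (he.mem_ball hy) _)
  rw [he.chart.endo_apply hy]
  rfl

theorem IsAdaptedChart.transverse_G {y : M} (hy : y ∈ e.source)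
    (v w : TangentSpace (𝓡 (4 * n + 3)) y) :
    (he.transverse hS).G (e y).2 (fwd (4 * n + 3) e y v).2 (fwd (4 * n + 3) e y w).2
      = S.g.inner y v w - ∑ α, S.η α y v * S.η α y w := by
  refine ((he.localCosymp hS).transG_eq (he.localCosymp_ξ hS) (he.mem_ball hy) _ _).trans ?_
  rw [he.chart.bilin_apply hy S.g.inner]
  refine congrArg _ (Finset.sum_congr rfl fun α _ => ?_)
  rw [he.chart.form_apply hy (S.η α), he.chart.form_apply hy (S.η α)]
  rfl

/-- A smooth map between open subsets of vector spaces which preserves hyper-Kähler structures. -/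
def StructurePreservingAt {F F' : Type*} [NormedAddCommGroup F] [NormedSpace ℝ F]
    [NormedAddCommGroup F'] [NormedSpace ℝ F'] {V : Set F} {V' : Set F'}
    (D : LocalHyperKahler V) (D' : LocalHyperKahler V') (τ : F → F') (z : F) : Prop :=
  ContDiffAt ℝ ∞ τ z ∧ (∀ α v, fderiv ℝ τ z (D.J α z v) = D'.J α (τ z) (fderiv ℝ τ z v)) ∧
    ∀ v w, D'.G (τ z) (fderiv ℝ τ z v) (fderiv ℝ τ z w) = D.G z v w

theorem StructurePreservingAt.congr {F F' : Type*} [NormedAddCommGroup F] [NormedSpace ℝ F]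
    [NormedAddCommGroup F'] [NormedSpace ℝ F'] {V : Set F} {V' : Set F'}
    {D : LocalHyperKahler V} {D' : LocalHyperKahler V'} {τ τ' : F → F'} {z : F}
    (h : StructurePreservingAt D D' τ z) (hτ : τ' =ᶠ[𝓝 z] τ) :
    StructurePreservingAt D D' τ' z := by
  unfold StructurePreservingAt
  rw [hτ.fderiv_eq, hτ.eq_of_nhds]
  exact ⟨h.1.congr_of_eventuallyEq hτ, h.2⟩

theorem StructurePreservingAt.comp {F F' F'' : Type*} [NormedAddCommGroup F] [NormedSpace ℝ F]
    [NormedAddCommGroup F'] [NormedSpace ℝ F'] [NormedAddCommGroup F''] [NormedSpace ℝ F'']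
    {V : Set F} {V' : Set F'} {V'' : Set F''}
    {D : LocalHyperKahler V} {D' : LocalHyperKahler V'} {D'' : LocalHyperKahler V''}
    {τ : F → F'} {τ' : F' → F''} {z : F}
    (h' : StructurePreservingAt D' D'' τ' (τ z)) (h : StructurePreservingAt D D' τ z) :
    StructurePreservingAt D D'' (τ' ∘ τ) z := by
  have hd : fderiv ℝ (τ' ∘ τ) z = fderiv ℝ τ' (τ z) ∘L fderiv ℝ τ z :=
    fderiv_comp z (h'.1.differentiableAt (by simp)) (h.1.differentiableAt (by simp))
  refine ⟨h'.1.comp z h.1, fun α v => ?_, fun v w => ?_⟩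
  · rw [hd, ContinuousLinearMap.comp_apply, h.2.1, h'.2.1]
    rfl
  · rw [hd, ← h.2.2, ← h'.2.2]
    rfl

/-- The transition between the transverse coordinates of two overlapping adapted charts preserves
the transverse structures. -/
theorem IsAdaptedChart.structurePreservingAt {e' : OpenPartialHomeomorph M (AdaptedModel n)}
    {r' : ℝ} (he' : IsAdaptedChart S e' r') {y : M} (hy : y ∈ e.source) (hy' : y ∈ e'.source)
    {τ : EuclideanSpace ℝ (Fin (4 * n)) → EuclideanSpace ℝ (Fin (4 * n))}
    (hτ : ∀ᶠ w in 𝓝 y, τ (e w).2 = (e' w).2) :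
    StructurePreservingAt (he.transverse hS) (he'.transverse hS) τ (e y).2 := by
  have hσ : ContDiffAt ℝ ∞ (e' ∘ e.symm) (e y) :=
    he.chart.contDiffAt_of_comp (e.map_source hy) (h := e') (k := e' ∘ e.symm) (by
      rw [e.left_inv hy]
      exact (he'.chart.smooth y hy').contMDiffAt (e'.open_source.mem_nhds hy')) fun _ _ => rfl
  have hev : ∀ᶠ p in 𝓝 (e y), τ p.2 = ((e' ∘ e.symm) p).2 := by
    have h1 : Filter.Tendsto e.symm (𝓝 (e y)) (𝓝 y) := e.tendsto_symm hy
    filter_upwards [h1.eventually hτ, e.open_target.mem_nhds (e.map_source hy)] with p hp hpt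
    rw [e.right_inv hpt] at hp
    exact hp
  -- Near `(e y).2`, `τ` is the transverse part of the chart transition on the slice whose leaf
  -- coordinates are those of `y`.
  have hτs : ContDiffAt ℝ ∞ τ (e y).2 := by
    have h2 : ContDiffAt ℝ ∞ (fun z => ((e' ∘ e.symm) ((e y).1, z)).2) (e y).2 :=
      contDiff_snd.contDiffAt.comp (e y).2
        (ContDiffAt.comp (e y).2 (f := fun z => ((e y).1, z)) hσ
          (contDiff_prodMk_right (e y).1).contDiffAt)
    refine h2.congr_of_eventuallyEq ?_
    have h3 : Filter.Tendsto (fun z => ((e y).1, z)) (𝓝 (e y).2) (𝓝 (e y)) :=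
      (Continuous.prodMk_right (e y).1).tendsto' _ _ rfl
    exact h3.eventually hev
  have hd : ∀ v : TangentSpace (𝓡 (4 * n + 3)) y,
      fderiv ℝ τ (e y).2 (fwd (4 * n + 3) e y v).2 = (fwd (4 * n + 3) e' y v).2 := fun v => by
    have h1 := mvfderiv_comp_chart he.chart hy (hσ.differentiableAt (by simp)) (h := e') (by
      filter_upwards [e.open_source.mem_nhds hy] with w hw
      simp [e.left_inv hw]) v
    have h2 : HasFDerivAt (fun p => τ p.2) _ (e y) :=
      hasFDerivAt_comp_snd (hτs.differentiableAt (by simp)).hasFDerivAt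
    have h3 : HasFDerivAt (fun p => ((e' ∘ e.symm) p).2) _ (e y) :=
      hasFDerivAt_snd.comp (f := e' ∘ e.symm) (e y) (hσ.differentiableAt (by simp)).hasFDerivAt
    have h4 := h2.unique (h3.congr_of_eventuallyEq hev)
    refine (DFunLike.congr_fun h4 (fwd (4 * n + 3) e y v)).trans ?_
    exact (congrArg Prod.snd h1).symm
  -- Every transverse vector comes from a tangent vector of `M`, on which both transverse structures
  -- are expressed through `S`.
  have hsurj : ∀ v : EuclideanSpace ℝ (Fin (4 * n)), ∃ v₀, (fwd (4 * n + 3) e y v₀).2 = v :=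
    fun v => by
      obtain ⟨v₀, hv₀⟩ := he.chart.fwd_surjective hy (0, v)
      exact ⟨v₀, by rw [hv₀]⟩
  have hτy : τ (e y).2 = (e' y).2 := hτ.self_of_nhds
  refine ⟨hτs, fun α v => ?_, fun v w => ?_⟩
  · obtain ⟨v, rfl⟩ := hsurj v
    rw [← he.transverse_J hS α hy, hd, hd, hτy, he'.transverse_J hS α hy']
  · obtain ⟨v, rfl⟩ := hsurj v
    obtain ⟨w, rfl⟩ := hsurj w
    rw [hd, hd, hτy, he.transverse_G hS hy, he'.transverse_G hS hy']

theorem IsAdaptedChart.mem_vertical_iff (he : IsAdaptedChart S e r) {y : M} (hy : y ∈ e.source)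
    (v : TangentSpace (𝓡 (4 * n + 3)) y) :
    v ∈ S.vertical y ↔ (fwd (4 * n + 3) e y v).2 = 0 := by
  constructor
  · intro hv
    refine Submodule.span_induction (p := fun v _ => (fwd (4 * n + 3) e y v).2 = 0) ?_ ?_ ?_ ?_ hv
    · rintro _ ⟨α, rfl⟩
      rw [he.fwd_ξ α hy]
    · rw [map_zero]; rfl
    · intro v w _ _ hv hw
      rw [map_add, Prod.snd_add, hv, hw, add_zero]
    · intro c v _ hv
      rw [map_smul, Prod.smul_snd, hv, smul_zero]
  · intro hv
    have h1 : v = ∑ α, (fwd (4 * n + 3) e y v).1 α • S.ξ α y := by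
      apply he.chart.fwd_injective hy
      rw [map_sum]
      refine Eq.trans (b := (((fwd (4 * n + 3) e y v).1, 0) : AdaptedModel n))
        (Prod.ext rfl hv) ?_
      rw [LocalCosymp.vertical_eq_sum]
      refine Finset.sum_congr rfl fun α _ => ?_
      rw [map_smul, he.fwd_ξ α hy]
    rw [h1]
    exact Submodule.sum_mem _ fun α _ => Submodule.smul_mem _ _ (Submodule.subset_span ⟨α, rfl⟩)

end TransverseStructure

/-! ### Gluing local hyper-Kähler structures. -/

section Gluing

theorem LocalHyperKahler.Ω_anti {F : Type*} [NormedAddCommGroup F] [NormedSpace ℝ F] {V : Set F}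
    (D : LocalHyperKahler V) (α : Fin 3) {y : F} (hy : y ∈ V) (v w : F) :
    bilinComp (D.G y) (D.J α y) v w = - bilinComp (D.G y) (D.J α y) w v := by
  have h1 := D.compat α y hy v (D.J α y w)
  rw [D.J_J α α y hy] at h1
  simp only [eps_self, kron, zero_smul, Finset.sum_const_zero, if_true, one_smul, zero_sub,
    map_neg] at h1
  rw [bilinComp_apply, bilinComp_apply, ← h1, D.G_symm y hy]

/-- An atlas whose charts carry hyper-Kähler structures preserved by the transition maps. -/
structure HyperKahlerAtlas (n : ℕ) (N : Type v) [TopologicalSpace N] where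
  index : Type u
  chart : index → OpenPartialHomeomorph N (EuclideanSpace ℝ (Fin (4 * n)))
  str : ∀ i, LocalHyperKahler (chart i).target
  cover : N → index
  mem_cover : ∀ x, x ∈ (chart (cover x)).source
  compatible : ∀ i j, ∀ x ∈ (chart i).source, x ∈ (chart j).source →
    StructurePreservingAt (str i) (str j) (chart j ∘ (chart i).symm) (chart i x)

namespace HyperKahlerAtlas

variable {n : ℕ} {N : Type v} [TopologicalSpace N] (A : HyperKahlerAtlas.{u} n N)

/-- The manifold structure defined by the atlas. -/
abbrev chartedSpace : ChartedSpace (EuclideanSpace ℝ (Fin (4 * n))) N where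
  atlas := Set.range A.chart
  chartAt x := A.chart (A.cover x)
  mem_chart_source := A.mem_cover
  chart_mem_atlas _ := ⟨_, rfl⟩

theorem isManifold : letI := A.chartedSpace; IsManifold (𝓡 (4 * n)) ∞ N := by
  let := A.chartedSpace
  refine isManifold_of_contDiffOn (𝓡 (4 * n)) ∞ N ?_
  rintro _ _ ⟨i, rfl⟩ ⟨j, rfl⟩ z hz
  have hz' : z ∈ ((A.chart i).symm.trans (A.chart j)).source := hz.1
  rw [OpenPartialHomeomorph.trans_source] at hz'
  have h := (A.compatible i j ((A.chart i).symm z) ((A.chart i).map_target hz'.1) hz'.2).1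
  rw [(A.chart i).right_inv hz'.1] at h
  exact h.contDiffWithinAt

variable [ChartedSpace (EuclideanSpace ℝ (Fin (4 * n))) N] [IsManifold (𝓡 (4 * n)) ∞ N]

/-- The chart chosen around a point. -/
abbrev chartOf (y : N) : OpenPartialHomeomorph N (EuclideanSpace ℝ (Fin (4 * n))) :=
  A.chart (A.cover y)

/-- The endomorphism fields of the glued structure. -/
def J (α : Fin 3) : EndoField (4 * n) N := fun y =>
  (fwd (4 * n) (A.chartOf y) y).inverse ∘L (A.str (A.cover y)).J α (A.chartOf y y) ∘L
    fwd (4 * n) (A.chartOf y) y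

/-- The metric of the glued structure. -/
def G (y : N) : TangentSpace (𝓡 (4 * n)) y →L[ℝ] TangentSpace (𝓡 (4 * n)) y →L[ℝ] ℝ :=
  ContinuousLinearMap.precomp ℝ (fwd (4 * n) (A.chartOf y) y) ∘L
    (A.str (A.cover y)).G (A.chartOf y y) ∘L fwd (4 * n) (A.chartOf y) y

variable {A} (hA : ∀ i, IsSmoothChart (4 * n) (A.chart i))

include hA

omit [IsManifold (𝓡 (4 * n)) ∞ N] in
theorem fwd_inverse (y : N) (v : EuclideanSpace ℝ (Fin (4 * n))) :
    fwd (4 * n) (A.chartOf y) y ((fwd (4 * n) (A.chartOf y) y).inverse v) = v := by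
  have hinv : (fwd (4 * n) (A.chartOf y) y).IsInvertible := by
    obtain ⟨f, hf⟩ := (hA (A.cover y)).isInvertible (A.mem_cover y)
    exact ⟨f.trans (NormedSpace.fromTangentSpace _), by
      rw [fwd, mvfderiv, ← hf]; rfl⟩
  obtain ⟨f, hf⟩ := hinv
  rw [← hf, ContinuousLinearMap.inverse_equiv]
  exact f.apply_symm_apply v

omit [IsManifold (𝓡 (4 * n)) ∞ N] in
theorem fwd_chart {y : N} {i : A.index} (hy : y ∈ (A.chart i).source)
    (v : TangentSpace (𝓡 (4 * n)) y) :
    fwd (4 * n) (A.chart i) y v = fderiv ℝ (A.chart i ∘ (A.chartOf y).symm) (A.chartOf y y)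
      (fwd (4 * n) (A.chartOf y) y v) := by
  refine mvfderiv_comp_chart (hA _) (A.mem_cover y)
    ((A.compatible _ i y (A.mem_cover y) hy).1.differentiableAt (by simp)) ?_ v
  filter_upwards [(A.chartOf y).open_source.mem_nhds (A.mem_cover y)] with w hw
  simp [(A.chartOf y).left_inv hw]

-- The chart selected in the definition of `J` is immaterial, since the transition to any other
-- chart intertwines the local structures.
omit [IsManifold (𝓡 (4 * n)) ∞ N] in
theorem fwd_J (α : Fin 3) {y : N} {i : A.index} (hy : y ∈ (A.chart i).source)
    (v : TangentSpace (𝓡 (4 * n)) y) :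
    fwd (4 * n) (A.chart i) y (A.J α y v)
      = (A.str i).J α (A.chart i y) (fwd (4 * n) (A.chart i) y v) := by
  have h := A.compatible _ i y (A.mem_cover y) hy
  rw [fwd_chart hA hy, fwd_chart hA hy, J, ContinuousLinearMap.comp_apply,
    ContinuousLinearMap.comp_apply, fwd_inverse hA, h.2.1, Function.comp_apply,
    (A.chartOf y).left_inv (A.mem_cover y)]

omit [IsManifold (𝓡 (4 * n)) ∞ N] in
theorem G_eq {y : N} {i : A.index} (hy : y ∈ (A.chart i).source)
    (v w : TangentSpace (𝓡 (4 * n)) y) :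
    A.G y v w = (A.str i).G (A.chart i y) (fwd (4 * n) (A.chart i) y v)
      (fwd (4 * n) (A.chart i) y w) := by
  have h := A.compatible _ i y (A.mem_cover y) hy
  have h2 := h.2.2 (fwd (4 * n) (A.chartOf y) y v) (fwd (4 * n) (A.chartOf y) y w)
  rw [Function.comp_apply, (A.chartOf y).left_inv (A.mem_cover y)] at h2
  rw [fwd_chart hA hy, fwd_chart hA hy, h2]
  rfl

omit [IsManifold (𝓡 (4 * n)) ∞ N] in
theorem coordEndo_J (α : Fin 3) (i : A.index) {z : EuclideanSpace ℝ (Fin (4 * n))}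
    (hz : z ∈ (A.chart i).target) :
    coordEndo (4 * n) (A.chart i) (A.J α) z = (A.str i).J α z := by
  refine ContinuousLinearMap.ext fun v => ?_
  rw [coordEndo_apply, fwd_J hA α ((A.chart i).map_target hz), (hA i).fwd_bwd hz,
    (A.chart i).right_inv hz]

omit [IsManifold (𝓡 (4 * n)) ∞ N] in
theorem coordBilin_G (i : A.index) {z : EuclideanSpace ℝ (Fin (4 * n))}
    (hz : z ∈ (A.chart i).target) :
    coordBilin (4 * n) (A.chart i) A.G z = (A.str i).G z := by
  refine ContinuousLinearMap.ext fun v => ContinuousLinearMap.ext fun w => ?_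
  rw [coordBilin_apply, G_eq hA ((A.chart i).map_target hz), (hA i).fwd_bwd hz,
    (hA i).fwd_bwd hz, (A.chart i).right_inv hz]

variable (hA' : ∀ x : N, chartAt (EuclideanSpace ℝ (Fin (4 * n))) x = A.chart (A.cover x))

include hA'

theorem smooth_J (α : Fin 3) : SmoothEndoField (A.J α) := by
  refine smoothEndoField_of_coord fun x => ?_
  have hx := (A.chartOf x).map_source (A.mem_cover x)
  rw [hA']
  refine ((A.str (A.cover x)).smooth_J α _ hx).congr_of_eventuallyEq ?_
  filter_upwards [(A.chartOf x).open_target.mem_nhds hx] with z hz using coordEndo_J hA α _ hz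

/-- The hyper-Hermitian structure glued from local hyper-Kähler structures. -/
def glue : AlmostHyperHermitian n N where
  J := A.J
  G :=
    { inner := A.G
      symm := fun y v w => by
        rw [G_eq hA (A.mem_cover y), G_eq hA (A.mem_cover y)]
        exact (A.str _).G_symm _ ((A.chartOf y).map_source (A.mem_cover y)) _ _
      pos := fun y v hv => by
        rw [G_eq hA (A.mem_cover y)]
        refine (A.str _).G_pos _ ((A.chartOf y).map_source (A.mem_cover y)) _ fun h => hv ?_
        exact (hA _).fwd_injective (A.mem_cover y) (h.trans (map_zero _).symm)
      isVonNBounded := fun y => isVonNBounded_of_posDef (E := EuclideanSpace ℝ (Fin (4 * n)))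
        fun v hv => by
        refine lt_of_lt_of_eq ((A.str _).G_pos _ ((A.chartOf y).map_source (A.mem_cover y)) _
          fun h => hv ?_) (G_eq hA (A.mem_cover y) v v).symm
        exact (hA _).fwd_injective (A.mem_cover y) (h.trans (map_zero _).symm)
      contMDiff := contMDiff_bilin_of_coord fun x => by
        have hx := (A.chartOf x).map_source (A.mem_cover x)
        rw [hA']
        refine ((A.str (A.cover x)).smooth_G _ hx).congr_of_eventuallyEq ?_
        filter_upwards [(A.chartOf x).open_target.mem_nhds hx] with z hz using coordBilin_G hA _ hz }
  smooth_J := smooth_J hA hA'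
  J_J α β y v := by
    apply (hA _).fwd_injective (A.mem_cover y)
    rw [fwd_J hA _ (A.mem_cover y), fwd_J hA _ (A.mem_cover y), map_sub, map_sum, map_smul,
      (A.str _).J_J _ _ _ ((A.chartOf y).map_source (A.mem_cover y))]
    simp only [map_smul, fwd_J hA _ (A.mem_cover y)]
  compat α y v w := by
    change A.G y _ _ = A.G y v w
    rw [G_eq hA (A.mem_cover y), G_eq hA (A.mem_cover y), fwd_J hA _ (A.mem_cover y),
      fwd_J hA _ (A.mem_cover y),
      (A.str _).compat _ _ ((A.chartOf y).map_source (A.mem_cover y))]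

/-- Both conditions are tensorial, so in the chart around a point they become the corresponding
identities of the local structure. -/
theorem glue_isHyperKahler : (glue hA hA').IsHyperKahler := by
  refine fun α => ⟨fun x X Y hX hY => ?_, fun x X Y Z hX hY hZ => ?_⟩
  · have hx := A.mem_cover x
    have hcx := (A.chartOf x).map_source hx
    apply (hA _).fwd_injective hx
    have h1 : coordEndo (4 * n) (A.chartOf x) (A.J α) =ᶠ[𝓝 (A.chartOf x x)]
        (A.str (A.cover x)).J α := by
      filter_upwards [(A.chartOf x).open_target.mem_nhds hcx] with z hz using coordEndo_J hA α _ hz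
    rw [map_zero]
    refine ((hA _).fwd_nijenhuis hx hX hY (smooth_J hA hA' α)).trans ?_
    rw [nijenhuisCoord, h1.fderiv_eq, h1.eq_of_nhds]
    exact (A.str _).integrable α _ hcx _ _
  · have hx := A.mem_cover x
    have hcx := (A.chartOf x).map_source hx
    rw [(hA _).extD2_eq hx hX hY hZ
      (T := fun z => bilinComp ((A.str (A.cover x)).G z) ((A.str (A.cover x)).J α z))
      (fun y hy v w => by
        change A.G y v (A.J α y w) = _
        rw [G_eq hA hy, fwd_J hA α hy]
        rfl)
      ((contDiffAt_bilinComp ((A.str _).smooth_G _ hcx)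
        ((A.str _).smooth_J α _ hcx)).differentiableAt (by simp)) fun v w => by
        exact (A.str (A.cover x)).Ω_anti α hcx v w]
    rw [(A.str (A.cover x)).closed_Ω α _ hcx, mul_zero]

end HyperKahlerAtlas

end Gluing

/-! ### Projection onto a glued structure. -/

section Projection

variable {n : ℕ} {M : Type u} [TopologicalSpace M]
  [ChartedSpace (EuclideanSpace ℝ (Fin (4 * n + 3))) M] [IsManifold (𝓡 (4 * n + 3)) ∞ M]
  {S : AlmostContactMetric3 n M} (hS : S.Is3Cosymplectic)
  {N : Type v} [TopologicalSpace N] [ChartedSpace (EuclideanSpace ℝ (Fin (4 * n))) N]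
  [IsManifold (𝓡 (4 * n)) ∞ N]

/-- A linear identification of the adapted model with the model of the total space. -/
def adaptedModelEquiv (n : ℕ) : AdaptedModel n ≃L[ℝ] EuclideanSpace ℝ (Fin (4 * n + 3)) :=
  ContinuousLinearEquiv.ofFinrankEq (by simp; omega)

/-- In the two charts the map is a linear projection. The factors are swapped because the submersion
normal form puts the base coordinates first. -/
theorem isSubmersionAt_of_adapted {e : OpenPartialHomeomorph M (AdaptedModel n)}
    (he : IsSmoothChart (4 * n + 3) e)
    {κ : OpenPartialHomeomorph N (EuclideanSpace ℝ (Fin (4 * n)))}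
    (hκ : IsSmoothChart (4 * n) κ) {f : M → N} {x : M} (hx : x ∈ e.source)
    (hf : ∀ y ∈ e.source, f y ∈ κ.source ∧ κ (f y) = (e y).2) :
    Manifold.IsSubmersionAt (𝓡 (4 * n + 3)) (𝓡 (4 * n)) ∞ f x := by
  let L := adaptedModelEquiv n
  let e' : OpenPartialHomeomorph M (EuclideanSpace ℝ (Fin (4 * n + 3))) :=
    e.trans L.toHomeomorph.toOpenPartialHomeomorph
  have hsrc : e'.source = e.source := by simp [e']
  have he' : IsSmoothChart (4 * n + 3) e' :=
    he.trans (fun _ _ => L.contDiff.contDiffAt) fun _ _ => L.symm.contDiff.contDiffAt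
  refine Manifold.IsSubmersionAt.mk_of_charts
    (L.symm.trans (ContinuousLinearEquiv.prodComm ℝ (Fin 3 → ℝ) (EuclideanSpace ℝ (Fin (4 * n)))))
    e' κ (hsrc ▸ hx) (hf x hx).1
    ((IsManifold.mem_maximalAtlas_iff_contMDiffOn _).2 ⟨he'.smooth, he'.smooth_symm⟩)
    ((IsManifold.mem_maximalAtlas_iff_contMDiffOn _).2 ⟨hκ.smooth, hκ.smooth_symm⟩)
    (fun y hy => (hf y (hsrc ▸ hy)).1) fun w hw => ?_
  have hw' : w ∈ e'.target := by simpa using hw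
  have h1 := e'.map_target hw'
  rw [hsrc] at h1
  have h2 : e (e'.symm w) = L.symm w := by
    have h3 : L (e (e'.symm w)) = w := e'.right_inv hw'
    rw [← h3, L.symm_apply_apply, h3]
  refine (hf _ h1).2.trans ?_
  rw [h2]
  rfl

variable {A : HyperKahlerAtlas.{w} n N} (hA : ∀ i, IsSmoothChart (4 * n) (A.chart i))
  (hA' : ∀ x : N, chartAt (EuclideanSpace ℝ (Fin (4 * n))) x = A.chart (A.cover x))

/-- The structure projects under a map that reads as the projection onto the transverse coordinates
in adapted charts. -/
theorem projectsOn_glue {U : TopologicalSpace.Opens M} {f : M → N}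
    (h : ∀ x ∈ U, ∃ (e : OpenPartialHomeomorph M (AdaptedModel n)) (r : ℝ)
      (he : IsAdaptedChart S e r) (i : A.index), x ∈ e.source ∧
      (∀ y ∈ e.source, f y ∈ (A.chart i).source ∧ A.chart i (f y) = (e y).2) ∧
      (∀ α, (A.str i).J α = (he.transverse hS).J α) ∧ (A.str i).G = (he.transverse hS).G) :
    ProjectsOn S (HyperKahlerAtlas.glue hA hA') U f := by
  -- In charts the differential of `f` is the transverse component; kernel, metric and endomorphisms
  -- are then read off from the adapted chart.
  have key : ∀ (e : OpenPartialHomeomorph M (AdaptedModel n)) (he : IsSmoothChart (4 * n + 3) e)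
      (i : A.index), (∀ y ∈ e.source, f y ∈ (A.chart i).source ∧ A.chart i (f y) = (e y).2) →
      ∀ x ∈ e.source, ∀ v : TangentSpace (𝓡 (4 * n + 3)) x,
      fwd (4 * n) (A.chart i) (f x) (mfderiv (𝓡 (4 * n + 3)) (𝓡 (4 * n)) f x v)
        = (fwd (4 * n + 3) e x v).2 := by
    intro e he i hf x hx v
    have hfx : MDifferentiableAt (𝓡 (4 * n + 3)) (𝓡 (4 * n)) f x :=
      (isSubmersionAt_of_adapted he (hA i) hx hf).contMDiffAt.mdifferentiableAt (by simp)
    have h1 := mvfderiv_comp_chart he hx (f := Prod.snd) differentiableAt_snd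
      (h := A.chart i ∘ f) (by
        filter_upwards [e.open_source.mem_nhds hx] with y hy using (hf y hy).2) v
    rw [fderiv_snd] at h1
    have h2 : mfderiv (𝓡 (4 * n + 3)) 𝓘(ℝ, EuclideanSpace ℝ (Fin (4 * n))) (A.chart i ∘ f) x
        = (mfderiv (𝓡 (4 * n)) 𝓘(ℝ, EuclideanSpace ℝ (Fin (4 * n))) (A.chart i) (f x)).comp
          (mfderiv (𝓡 (4 * n + 3)) (𝓡 (4 * n)) f x) :=
      mfderiv_comp x ((hA i).mdifferentiable.mdifferentiableAt (hf x hx).1) hfx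
    exact (DFunLike.congr_fun h2 v).symm.trans h1
  refine ⟨fun x hx => ?_, fun x hx v => ?_, fun x hx v hv w hw => ?_, fun α x hx v => ?_⟩ <;>
    obtain ⟨e, r, he, i, hxe, hf, hJ, hG⟩ := h x hx
  · exact isSubmersionAt_of_adapted he.chart (hA i) hxe hf
  · rw [he.mem_vertical_iff hxe, ← key e he.chart i hf x hxe v]
    constructor
    · intro h
      rw [h, map_zero]
    · intro h
      exact (hA i).fwd_injective (hf x hxe).1 (h.trans (map_zero _).symm)
  · refine (HyperKahlerAtlas.G_eq hA (hf x hxe).1 _ _).trans ?_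
    have hv' : ∀ α, S.η α x v = 0 := fun α => (Submodule.mem_iInf _).1 hv α
    rw [key e he.chart i hf x hxe, key e he.chart i hf x hxe, (hf x hxe).2, hG,
      he.transverse_G hS hxe]
    simp [hv']
  · apply (hA i).fwd_injective (hf x hxe).1
    refine (key e he.chart i hf x hxe _).trans ?_
    refine Eq.trans ?_ (HyperKahlerAtlas.fwd_J hA α (hf x hxe).1 _).symm
    rw [key e he.chart i hf x hxe, (hf x hxe).2, hJ, he.transverse_J hS α hxe]

end Projection

/-! ### Disjoint unions of hyper-Kähler balls. -/

section DisjointUnion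

theorem StructurePreservingAt.of_eventuallyEq_id {F : Type*} [NormedAddCommGroup F]
    [NormedSpace ℝ F] {V V' : Set F} {D : LocalHyperKahler V} {D' : LocalHyperKahler V'}
    (hJ : D.J = D'.J) (hG : D.G = D'.G) {τ : F → F} {z : F} (hτ : τ =ᶠ[𝓝 z] id) :
    StructurePreservingAt D D' τ z := by
  refine StructurePreservingAt.congr (τ := id) ⟨contDiffAt_id, fun α v => ?_, fun v w => ?_⟩ hτ
  · simp [hJ]
  · simp [hG]

variable {n : ℕ} {ι : Type} (r : ι → ℝ)

/-- The disjoint union of a family of balls. -/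
abbrev BallSum (n : ℕ) {ι : Type} (r : ι → ℝ) : Type :=
  Σ i, Metric.ball (0 : EuclideanSpace ℝ (Fin (4 * n))) (r i)

variable {r} (hr : ∀ i, 0 < r i)

/-- The coordinates on a component of a disjoint union of balls. -/
def ballChart (i : ι) : OpenPartialHomeomorph (BallSum n r) (EuclideanSpace ℝ (Fin (4 * n))) :=
  haveI : Nonempty (Metric.ball (0 : EuclideanSpace ℝ (Fin (4 * n))) (r i)) :=
    ⟨⟨0, Metric.mem_ball_self (hr i)⟩⟩
  (Topology.IsOpenEmbedding.toOpenPartialHomeomorph (Sigma.mk i)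
      (Topology.IsOpenEmbedding.sigmaMk (σ := fun i =>
        Metric.ball (0 : EuclideanSpace ℝ (Fin (4 * n))) (r i)))).symm.trans
    (Topology.IsOpenEmbedding.toOpenPartialHomeomorph Subtype.val
      (Metric.isOpen_ball (x := (0 : EuclideanSpace ℝ (Fin (4 * n)))) (ε := r i)).isOpenEmbedding_subtypeVal)

theorem ballChart_source (i : ι) :
    (ballChart (n := n) hr i).source = {p : BallSum n r | p.1 = i} := by
  ext ⟨j, z⟩
  simp only [ballChart, OpenPartialHomeomorph.trans_source, Set.mem_inter_iff, Set.mem_preimage]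
  simp

theorem ballChart_target (i : ι) :
    (ballChart (n := n) hr i).target = Metric.ball 0 (r i) := by
  ext z
  simp [ballChart]

/-- A family of hyper-Kähler structures on balls, as a structure on their disjoint union. -/
def ballAtlas (D : ∀ i, LocalHyperKahler (Metric.ball (0 : EuclideanSpace ℝ (Fin (4 * n))) (r i))) :
    HyperKahlerAtlas n (BallSum n r) where
  index := ι
  chart := ballChart hr
  str i := (D i).mono (ballChart_target hr i).le
  cover p := p.1
  mem_cover p := (ballChart_source hr p.1).ge rfl
  compatible i j x hi hj := by
    -- Distinct components are disjoint, so the only transitions are identities.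
    obtain rfl : i = j := by
      rw [ballChart_source] at hi hj
      exact hi.symm.trans hj
    refine StructurePreservingAt.of_eventuallyEq_id rfl rfl ?_
    filter_upwards [(ballChart hr i).open_target.mem_nhds ((ballChart hr i).map_source hi)] with z hz
      using (ballChart hr i).right_inv hz

end DisjointUnion

/-! ### Local projections onto one hyper-Kähler manifold. -/

section LocalProjection

variable {n : ℕ} {M : Type u} [TopologicalSpace M] [SecondCountableTopology M]
  [ChartedSpace (EuclideanSpace ℝ (Fin (4 * n + 3))) M] [IsManifold (𝓡 (4 * n + 3)) ∞ M]

omit [SecondCountableTopology M] in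
theorem isSmoothChart_of_mem_atlas {N : Type v} [TopologicalSpace N]
    [ChartedSpace (EuclideanSpace ℝ (Fin (4 * n))) N] [IsManifold (𝓡 (4 * n)) ∞ N]
    {κ : OpenPartialHomeomorph N (EuclideanSpace ℝ (Fin (4 * n)))}
    (hκ : κ ∈ atlas (EuclideanSpace ℝ (Fin (4 * n))) N) : IsSmoothChart (4 * n) κ :=
  ⟨contMDiffOn_of_mem_maximalAtlas (IsManifold.subset_maximalAtlas hκ),
    contMDiffOn_symm_of_mem_maximalAtlas (IsManifold.subset_maximalAtlas hκ)⟩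

/-- A `3`-cosymplectic structure locally projects onto one hyper-Kähler manifold. -/
theorem exists_local_projections (S : AlmostContactMetric3 n M) (hS : S.Is3Cosymplectic) :
    ∃ (N : Type) (_ : TopologicalSpace N) (_ : T2Space N) (_ : SecondCountableTopology N)
        (_ : ChartedSpace (EuclideanSpace ℝ (Fin (4 * n))) N)
        (_ : IsManifold (𝓡 (4 * n)) ∞ N)
        (K : AlmostHyperHermitian n N)
        (ι : Type) (U : ι → TopologicalSpace.Opens M) (f : ι → M → N),
        K.IsHyperKahler ∧ (∀ x : M, ∃ i, x ∈ U i) ∧ ∀ i, ProjectsOn S K (U i) (f i) := by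
  choose e r he hxe _ using fun x => exists_adaptedChart hS x
  -- Countably many charts suffice, which makes the disjoint union second countable.
  obtain ⟨s, hs, hcov⟩ := TopologicalSpace.countable_cover_nhds fun x =>
    (e x).open_source.mem_nhds (hxe x)
  have := hs.toEncodable
  -- Reindexing by natural numbers puts the index set, hence the manifold, into `Type`, whatever the
  -- universe of `M`.
  let φ := Equiv.ofInjective (Encodable.encode (α := s)) Encodable.encode_injective
  let pt : Set.range (Encodable.encode (α := s)) → M := fun i => (φ.symm i : M)
  have hr : ∀ i, 0 < r (pt i) := fun i => (he (pt i)).pos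
  let A := ballAtlas (n := n) hr fun i => (he (pt i)).transverse hS
  let cs := A.chartedSpace
  have hm := A.isManifold
  have hA : ∀ i, IsSmoothChart (4 * n) (A.chart i) := fun i =>
    isSmoothChart_of_mem_atlas ⟨i, rfl⟩
  have hA' : ∀ x, chartAt (EuclideanSpace ℝ (Fin (4 * n))) x = A.chart (A.cover x) := fun _ => rfl
  refine ⟨BallSum n fun i => r (pt i), inferInstance, inferInstance, inferInstance, cs, hm,
    HyperKahlerAtlas.glue hA hA', _, fun i => ⟨(e (pt i)).source, (e (pt i)).open_source⟩,
    fun i x => (A.chart i).symm (e (pt i) x).2, HyperKahlerAtlas.glue_isHyperKahler hA hA',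
    fun x => ?_, fun i => projectsOn_glue hS hA hA' fun x hx =>
      ⟨e (pt i), r (pt i), he (pt i), i, hx, fun y hy => ?_, fun _ => rfl, rfl⟩⟩
  · obtain ⟨y, hy, hxy⟩ := Set.mem_iUnion₂.1 (hcov.ge (Set.mem_univ x))
    refine ⟨φ ⟨y, hy⟩, ?_⟩
    change x ∈ (e (φ.symm (φ ⟨y, hy⟩) : M)).source
    rwa [φ.symm_apply_apply]
  · have h1 : (e (pt i) y).2 ∈ (A.chart i).target := by
      refine (ballChart_target hr i).ge ?_
      have := (he (pt i)).mem_ball hy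
      rw [mem_ball_zero_iff] at this ⊢
      exact (norm_snd_le _).trans_lt this
    exact ⟨(A.chart i).map_target h1, (A.chart i).right_inv h1⟩

end LocalProjection

/-! ### Adapted charts of a regular structure. -/

section RegularCharts

variable {n : ℕ} {M : Type u} [TopologicalSpace M]
  [ChartedSpace (EuclideanSpace ℝ (Fin (4 * n + 3))) M] [IsManifold (𝓡 (4 * n + 3)) ∞ M]
  {S : AlmostContactMetric3 n M}

/-- The last `4n` coordinates. -/
def transverseCoords (n : ℕ) : EuclideanSpace ℝ (Fin (4 * n + 3)) →L[ℝ] (Fin (4 * n) → ℝ) :=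
  ContinuousLinearMap.pi fun j => EuclideanSpace.proj ⟨3 + j, by omega⟩

theorem transverseCoords_ext_iff {v w : EuclideanSpace ℝ (Fin (4 * n + 3))} :
    transverseCoords n v = transverseCoords n w ↔
      ∀ i : Fin (4 * n + 3), 3 ≤ (i : ℕ) → v i = w i := by
  constructor
  · intro h i hi
    have h1 := congrFun h ⟨i - 3, by omega⟩
    have h2 : (⟨3 + ((i : ℕ) - 3), by omega⟩ : Fin (4 * n + 3)) = i := Fin.ext (by simp; omega)
    change v ⟨3 + ((i : ℕ) - 3), _⟩ = w ⟨3 + ((i : ℕ) - 3), _⟩ at h1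
    rwa [h2] at h1
  · intro h
    ext j
    exact h ⟨3 + j, by omega⟩ (by simp)

/-- In a chart onto a ball, a map whose differential vanishes exactly on the first factor is
injective in the second variable near the centre. -/
theorem exists_injective_second_variable {A F F' : Type*} [NormedAddCommGroup A] [NormedSpace ℝ A]
    [NormedAddCommGroup F] [NormedSpace ℝ F] [FiniteDimensional ℝ F]
    [NormedAddCommGroup F'] [NormedSpace ℝ F'] [FiniteDimensional ℝ F']
    (hdim : Module.finrank ℝ F = Module.finrank ℝ F') {r : ℝ} (hr : 0 < r) {H : A × F → F'}
    (hH : ∀ p ∈ Metric.ball (0 : A × F) r, ContDiffAt ℝ ∞ H p)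
    (hker : ∀ p ∈ Metric.ball (0 : A × F) r, ∀ v, fderiv ℝ H p v = 0 ↔ v.2 = 0) :
    ∃ r' > 0, r' ≤ r ∧ ∀ p ∈ Metric.ball (0 : A × F) r', ∀ q ∈ Metric.ball (0 : A × F) r',
      H p = H q → p.2 = q.2 := by
  have : CompleteSpace F := FiniteDimensional.complete ℝ F
  have hconst : ∀ p ∈ Metric.ball (0 : A × F) r, H p = H (0, p.2) := fun p hp =>
    eq_of_fderiv_fst_eq_zero (fun p hp => (hH p hp).differentiableAt (by simp))
      (fun p hp s => (hker p hp _).2 rfl) hp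
  have hin : ∀ z ∈ Metric.ball (0 : F) r, ((0, z) : A × F) ∈ Metric.ball (0 : A × F) r :=
    fun z hz => by
      rw [mem_ball_zero_iff] at hz ⊢
      rwa [Prod.norm_mk, norm_zero, max_eq_right (norm_nonneg _)]
  have h0 := hin 0 (Metric.mem_ball_self hr)
  have hd : HasFDerivAt (fun z : F => H (0, z))
      (fderiv ℝ H (0, 0) ∘L ContinuousLinearMap.inr ℝ A F) 0 :=
    HasFDerivAt.comp (g := H) (f := fun z : F => ((0, z) : A × F)) 0
      ((hH _ h0).differentiableAt (by simp)).hasFDerivAt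
      (ContinuousLinearMap.inr ℝ A F).hasFDerivAt
  have hinj : Function.Injective (fderiv ℝ H (0, 0) ∘L ContinuousLinearMap.inr ℝ A F) := by
    rw [injective_iff_map_eq_zero]
    intro z hz
    exact (hker _ h0 (0, z)).1 hz
  -- The kernel condition makes the differential of `H (0, ·)` at `0` injective, hence bijective by
  -- dimension, and the inverse function theorem gives injectivity near `0`.
  let B : F ≃L[ℝ] F' := (LinearEquiv.ofInjectiveOfFinrankEq
    (fderiv ℝ H (0, 0) ∘L ContinuousLinearMap.inr ℝ A F).toLinearMap hinj
    hdim).toContinuousLinearEquiv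
  obtain ⟨Ψ, hΨ, hΨ0, -, -, -⟩ := exists_smooth_openPartialHomeomorph (f := fun z : F => H (0, z))
    (f' := B) (Metric.ball_mem_nhds (0 : F) hr) (fun z hz =>
      (hH _ (hin z hz)).comp z (contDiff_prodMk_right (0 : A)).contDiffAt) (by
      exact hd.congr_fderiv (ContinuousLinearMap.ext fun _ => rfl))
  obtain ⟨δ, hδ, hδΨ⟩ := Metric.isOpen_iff.1 Ψ.open_source 0 hΨ0
  refine ⟨min δ r, lt_min hδ hr, min_le_right _ _, fun p hp q hq hpq => ?_⟩
  have hsnd : ∀ p ∈ Metric.ball (0 : A × F) (min δ r), p.2 ∈ Ψ.source := fun p hp => by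
    refine hδΨ ?_
    rw [mem_ball_zero_iff] at hp ⊢
    exact (norm_snd_le p).trans_lt (hp.trans_le (min_le_left _ _))
  have hle : Metric.ball (0 : A × F) (min δ r) ⊆ Metric.ball (0 : A × F) r :=
    Metric.ball_subset_ball (min_le_right _ _)
  refine Ψ.injOn (hsnd p hp) (hsnd q hq) ?_
  rw [hΨ, hΨ, ← hconst p (hle hp), ← hconst q (hle hq), hpq]

/-- The foliated chart `c` given by regularity need not be adapted. Its transverse coordinates, as
functions on an adapted chart `e`, have the vertical space as kernel, so near the centre they
separate the plaques of `e`. As they agree at points of one leaf, a smaller `e` inherits the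
one-plaque property. -/
theorem exists_regular_adaptedChart (hS : S.Is3Cosymplectic) (hreg : S.IsRegular) (x : M) :
    ∃ (e : OpenPartialHomeomorph M (AdaptedModel n)) (r : ℝ), IsAdaptedChart S e r ∧
      x ∈ e.source ∧ ∀ y ∈ e.source, ∀ z ∈ e.source, S.leafSetoid y z → (e y).2 = (e z).2 := by
  obtain ⟨e, r, he, hxe, hex⟩ := exists_adaptedChart hS x
  obtain ⟨c, hxc, -, ⟨hcat, -, hcv⟩, hcl⟩ := hreg x
  have hc : IsSmoothChart (4 * n + 3) c :=
    ⟨contMDiffOn_of_mem_maximalAtlas hcat, contMDiffOn_symm_of_mem_maximalAtlas hcat⟩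
  have hx0 : e.symm 0 = x := by rw [← hex, e.left_inv hxe]
  obtain ⟨δ, hδ, hδc⟩ := Metric.isOpen_iff.1 (e.symm.isOpen_inter_preimage c.open_source) 0
    ⟨hex ▸ e.map_source hxe, by simpa [hx0] using hxc⟩
  let H : AdaptedModel n → (Fin (4 * n) → ℝ) := fun p => transverseCoords n (c (e.symm p))
  have hσ : ∀ p ∈ Metric.ball (0 : AdaptedModel n) δ, ContDiffAt ℝ ∞ (c ∘ e.symm) p :=
    fun p hp => he.chart.contDiffAt_of_comp (hδc hp).1 (h := c)
      ((hc.smooth _ (hδc hp).2).contMDiffAt (c.open_source.mem_nhds (hδc hp).2)) fun _ _ => rfl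
  obtain ⟨r', hr', hr'δ, hinj⟩ := exists_injective_second_variable (H := H) (by simp) hδ
    (fun p hp => (transverseCoords n).contDiff.contDiffAt.comp p (hσ p hp)) (fun p hp v => by
      have hpt : p ∈ e.target := (hδc hp).1
      have hy := e.map_target hpt
      have hd := (hσ p hp).differentiableAt (by simp)
      have h1 : fderiv ℝ H p v = transverseCoords n (fderiv ℝ (c ∘ e.symm) p v) :=
        DFunLike.congr_fun ((transverseCoords n).hasFDerivAt.comp p hd.hasFDerivAt).fderiv v
      obtain ⟨v₀, rfl⟩ := he.chart.fwd_surjective hy v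
      have h2 := mvfderiv_comp_chart he.chart hy (f := c ∘ e.symm)
        (by rwa [e.right_inv hpt]) (h := c) (by
          filter_upwards [e.open_source.mem_nhds hy] with w hw
          simp [e.left_inv hw]) v₀
      rw [e.right_inv hpt] at h2
      rw [h1, ← h2, ← he.mem_vertical_iff hy, hcv _ (hδc hp).2,
        ← (transverseCoords n).map_zero, transverseCoords_ext_iff]
      rfl)
  have hr'r : min r' r ≤ r := min_le_right _ _
  refine ⟨_, min r' r, he.restrict (lt_min hr' he.pos) hr'r, ?_, fun y hy z hz hyz => ?_⟩
  · simp [hxe, hex, hr', he.pos]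
  · have hmem : ∀ y ∈ (e.symm.restrOpen (Metric.ball 0 (min r' r)) Metric.isOpen_ball).symm.source,
        y ∈ e.source ∧ e y ∈ Metric.ball 0 r' ∧ y ∈ c.source := fun y hy => by
      have h1 : y ∈ e.source ∧ e y ∈ Metric.ball 0 (min r' r) := by
        simpa using hy
      have h2 : e y ∈ Metric.ball 0 r' := Metric.ball_subset_ball (min_le_left _ _) h1.2
      refine ⟨h1.1, h2, ?_⟩
      have h3 := (hδc (Metric.ball_subset_ball hr'δ h2)).2
      rwa [Set.mem_preimage, e.left_inv h1.1] at h3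
    obtain ⟨hy1, hy2, hy3⟩ := hmem y hy
    obtain ⟨hz1, hz2, hz3⟩ := hmem z hz
    refine hinj _ hy2 _ hz2 ?_
    change transverseCoords n (c (e.symm (e y))) = transverseCoords n (c (e.symm (e z)))
    rw [e.left_inv hy1, e.left_inv hz1, transverseCoords_ext_iff]
    exact hcl y hy3 z hz3 hyz

end RegularCharts

/-! ### Leaves as chains of plaques, and openness of the projection. -/

section Leaves

variable {n : ℕ} {M : Type u} [TopologicalSpace M]
  [ChartedSpace (EuclideanSpace ℝ (Fin (4 * n + 3))) M] [IsManifold (𝓡 (4 * n + 3)) ∞ M]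
  {S : AlmostContactMetric3 n M}

/-- Two points on the same plaque of an adapted chart are joined by a vertical curve. -/
theorem IsAdaptedChart.verticallyJoined {e : OpenPartialHomeomorph M (AdaptedModel n)} {r : ℝ}
    (he : IsAdaptedChart S e r) {y z : M} (hy : y ∈ e.source) (hz : z ∈ e.source)
    (hyz : (e y).2 = (e z).2) : S.VerticallyJoined y z := by
  -- The smooth transition takes values in `[0, 1]` on all of `ℝ`, so the curve stays in the convex
  -- target although it is defined for every real time.
  let γ : ℝ → AdaptedModel n := fun t => e y + Real.smoothTransition t • (e z - e y)
  have hγs : ContDiff ℝ ∞ γ :=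
    contDiff_const.add ((Real.smoothTransition.contDiff (n := ⊤)).smul contDiff_const)
  have hγt : ∀ t, γ t ∈ e.target := fun t => by
    have h1 := he.mem_ball hy
    have h2 := he.mem_ball hz
    rw [he.target_eq]
    exact (convex_ball (0 : AdaptedModel n) r).add_smul_sub_mem h1 h2
      ⟨Real.smoothTransition.nonneg t, Real.smoothTransition.le_one t⟩
  have hγ2 : ∀ t, (γ t).2 = (e y).2 := fun t => by
    simp [γ, hyz]
  have hc : ∀ t, ContMDiffAt 𝓘(ℝ, ℝ) (𝓡 (4 * n + 3)) ∞ (fun t => e.symm (γ t)) t := fun t =>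
    ((he.chart.smooth_symm _ (hγt t)).contMDiffAt (e.open_target.mem_nhds (hγt t))).comp t
      hγs.contDiffAt.contMDiffAt
  refine ⟨fun t => e.symm (γ t), hc, ?_, ?_, fun t => ?_⟩
  · simp [γ, e.left_inv hy]
  · simp [γ, e.left_inv hz]
  · have hct := e.map_target (hγt t)
    rw [he.mem_vertical_iff hct]
    have h1 : mfderiv 𝓘(ℝ, ℝ) 𝓘(ℝ, AdaptedModel n) (e ∘ fun t => e.symm (γ t)) t
        = (mfderiv (𝓡 (4 * n + 3)) 𝓘(ℝ, AdaptedModel n) e (e.symm (γ t))).comp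
          (mfderiv 𝓘(ℝ, ℝ) (𝓡 (4 * n + 3)) (fun t => e.symm (γ t)) t) :=
      mfderiv_comp t (he.chart.mdifferentiable.mdifferentiableAt hct)
        ((hc t).mdifferentiableAt (by simp))
    have h2 : (e ∘ fun t => e.symm (γ t)) = γ := funext fun t => e.right_inv (hγt t)
    rw [h2, mfderiv_eq_fderiv] at h1
    have h3 : fwd (4 * n + 3) e (e.symm (γ t))
        (mfderiv 𝓘(ℝ, ℝ) (𝓡 (4 * n + 3)) (fun t => e.symm (γ t)) t (1 : ℝ))
        = fderiv ℝ γ t 1 := (DFunLike.congr_fun h1 (1 : ℝ)).symm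
    rw [h3]
    have h4 : HasFDerivAt (fun t => (γ t).2) _ t :=
      hasFDerivAt_snd.comp (f := γ) t (hγs.differentiable (by simp) t).hasFDerivAt
    have h5 : HasFDerivAt (fun t => (γ t).2) (0 : ℝ →L[ℝ] EuclideanSpace ℝ (Fin (4 * n))) t := by
      rw [funext hγ2]
      exact hasFDerivAt_const _ _
    exact DFunLike.congr_fun (h4.unique h5) (1 : ℝ)

/-- Along a vertical curve the transverse coordinates are locally constant. -/
theorem IsAdaptedChart.eventually_snd_eq {e : OpenPartialHomeomorph M (AdaptedModel n)} {r : ℝ}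
    (he : IsAdaptedChart S e r) {c : ℝ → M} (hc : ContMDiff 𝓘(ℝ, ℝ) (𝓡 (4 * n + 3)) ∞ c)
    (hv : ∀ t : ℝ, mfderiv 𝓘(ℝ, ℝ) (𝓡 (4 * n + 3)) c t (1 : ℝ) ∈ S.vertical (c t))
    {t₀ : ℝ} (ht₀ : c t₀ ∈ e.source) :
    ∀ᶠ t in 𝓝 t₀, c t ∈ e.source ∧ (e (c t)).2 = (e (c t₀)).2 := by
  obtain ⟨δ, hδ, hsub⟩ := Metric.isOpen_iff.1 (e.open_source.preimage hc.continuous) t₀ ht₀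
  have hd : ∀ t ∈ Metric.ball t₀ δ, HasDerivAt (fun t => (e (c t)).2) 0 t := fun t ht => by
    have hct : c t ∈ e.source := hsub ht
    have hec : ContMDiffAt 𝓘(ℝ, ℝ) 𝓘(ℝ, AdaptedModel n) ∞ (e ∘ c) t :=
      ((he.chart.smooth _ hct).contMDiffAt (e.open_source.mem_nhds hct)).comp t (hc t)
    have h1 : mfderiv 𝓘(ℝ, ℝ) 𝓘(ℝ, AdaptedModel n) (e ∘ c) t
        = (mfderiv (𝓡 (4 * n + 3)) 𝓘(ℝ, AdaptedModel n) e (c t)).comp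
          (mfderiv 𝓘(ℝ, ℝ) (𝓡 (4 * n + 3)) c t) :=
      mfderiv_comp t (he.chart.mdifferentiable.mdifferentiableAt hct)
        ((hc t).mdifferentiableAt (by simp))
    rw [mfderiv_eq_fderiv] at h1
    have h3 : fwd (4 * n + 3) e (c t) (mfderiv 𝓘(ℝ, ℝ) (𝓡 (4 * n + 3)) c t (1 : ℝ))
        = fderiv ℝ (e ∘ c) t 1 := (DFunLike.congr_fun h1 (1 : ℝ)).symm
    have h4 : HasFDerivAt (fun t => (e (c t)).2) _ t :=
      hasFDerivAt_snd.comp (f := e ∘ c) t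
        ((contMDiffAt_iff_contDiffAt.1 hec).differentiableAt (by simp)).hasFDerivAt
    refine h4.hasDerivAt.congr_deriv ?_
    have h5 := (he.mem_vertical_iff hct _).1 (hv t)
    rw [h3] at h5
    exact h5
  filter_upwards [Metric.ball_mem_nhds t₀ hδ] with t ht
  refine ⟨hsub ht, Metric.isOpen_ball.is_const_of_deriv_eq_zero
    (f := fun t => (e (c t)).2) (convex_ball t₀ δ).isPreconnected
    (fun t ht => (hd t ht).differentiableAt.differentiableWithinAt)
    (fun t ht => (hd t ht).deriv) ht (Metric.mem_ball_self hδ)⟩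

variable {e : M → OpenPartialHomeomorph M (AdaptedModel n)}

/-- Two points lie on a common plaque of a chart of the given family. -/
def SamePlaque (e : M → OpenPartialHomeomorph M (AdaptedModel n)) (y z : M) : Prop :=
  ∃ x, y ∈ (e x).source ∧ z ∈ (e x).source ∧ (e x y).2 = (e x z).2

theorem SamePlaque.symm {y z : M} (h : SamePlaque e y z) : SamePlaque e z y := by
  obtain ⟨x, h1, h2, h3⟩ := h
  exact ⟨x, h2, h1, h3.symm⟩

/-- Points of a leaf are connected by a finite chain of plaques. -/
theorem reflTransGen_samePlaque_of_leaf {r : M → ℝ} (he : ∀ x, IsAdaptedChart S (e x) (r x))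
    (hx : ∀ x, x ∈ (e x).source) {y z : M} (h : S.leafSetoid y z) :
    Relation.ReflTransGen (SamePlaque e) y z := by
  have hsymm : ∀ {y z}, Relation.ReflTransGen (SamePlaque e) y z →
      Relation.ReflTransGen (SamePlaque e) z y := fun {y z} h =>
    have : Std.Symm (SamePlaque e) := ⟨fun _ _ => SamePlaque.symm⟩
    Std.Symm.symm _ _ h
  induction h with
  | rel y z h =>
    obtain ⟨c, hc, rfl, rfl, hv⟩ := h
    have hnear : ∀ t₀, ∀ᶠ t in 𝓝 t₀, SamePlaque e (c t₀) (c t) := fun t₀ => by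
      filter_upwards [(he (c t₀)).eventually_snd_eq hc hv (hx (c t₀))] with t ht
      exact ⟨c t₀, hx _, ht.1, ht.2.symm⟩
    -- Plaque chains extend locally in both directions, so this set is clopen in `ℝ`.
    let T : Set ℝ := {t | Relation.ReflTransGen (SamePlaque e) (c 0) (c t)}
    have hopen : IsOpen T := isOpen_iff_mem_nhds.2 fun t ht => by
      filter_upwards [hnear t] with t' ht' using ht.tail ht'
    have hclosed : IsClosed T := ⟨isOpen_iff_mem_nhds.2 fun t ht => by
      filter_upwards [hnear t] with t' ht' h using ht (h.tail ht'.symm)⟩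
    have huniv : T = Set.univ := IsClopen.eq_univ ⟨hclosed, hopen⟩ ⟨0, Relation.ReflTransGen.refl⟩
    exact huniv.ge (Set.mem_univ 1)
  | refl y => exact Relation.ReflTransGen.refl
  | symm y z _ ih => exact hsymm ih
  | trans x y z _ _ ih1 ih2 => exact ih1.trans ih2

theorem SamePlaque.leafProj_eq {r : M → ℝ} (he : ∀ x, IsAdaptedChart S (e x) (r x)) {y z : M}
    (h : SamePlaque e y z) : S.leafProj y = S.leafProj z := by
  obtain ⟨x, h1, h2, h3⟩ := h
  exact Quotient.sound (Relation.EqvGen.rel _ _ ((he x).verticallyJoined h1 h2 h3))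

/-- The projection onto the leaf space is open. -/
theorem isOpenMap_leafProj {r : M → ℝ} (he : ∀ x, IsAdaptedChart S (e x) (r x))
    (hx : ∀ x, x ∈ (e x).source) : IsOpenMap S.leafProj := by
  -- Being a neighbourhood propagates along a chain of plaques for the saturation of a set.
  have key : ∀ {y z : M}, Relation.ReflTransGen (SamePlaque e) y z → ∀ U ∈ 𝓝 y,
      S.leafProj ⁻¹' (S.leafProj '' U) ∈ 𝓝 z := by
    intro y z h
    induction h with
    | refl => exact fun U hU => Filter.mem_of_superset hU (Set.subset_preimage_image _ _)
    | @tail z z' _ hzz' ih =>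
      intro U hU
      obtain ⟨x, h1, h2, h3⟩ := hzz'
      -- Slides `w` along its plaque onto the transversal through `z`; it is continuous at `z'`,
      -- sends `z'` to `z`, and near `z'` stays in the same leaf.
      let ρ : M → M := fun w => (e x).symm ((e x z).1, (e x w).2)
      have h4 : ((e x z).1, (e x z').2) = e x z := by rw [← h3]
      have hρz : ρ z' = z := by
        change (e x).symm ((e x z).1, (e x z').2) = z
        rw [h4, (e x).left_inv h1]
      have hpair : ContinuousAt (fun w => ((e x z).1, (e x w).2)) z' :=
        continuousAt_const.prodMk
          (continuous_snd.continuousAt.comp ((e x).continuousAt h2))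
      have hρ : ContinuousAt ρ z' := by
        refine ContinuousAt.comp (g := (e x).symm) ?_ hpair
        rw [h4]
        exact (e x).continuousAt_symm ((e x).map_source h1)
      have ht : ∀ᶠ w in 𝓝 z', ((e x z).1, (e x w).2) ∈ (e x).target :=
        hpair.eventually (by beta_reduce; rw [h4]; exact (e x).open_target.mem_nhds ((e x).map_source h1))
      filter_upwards [hρ.preimage_mem_nhds (hρz ▸ ih U hU), ht, (e x).open_source.mem_nhds h2]
        with w hw hwt hws
      have h5 : S.leafProj w = S.leafProj (ρ w) :=
        SamePlaque.leafProj_eq he ⟨x, hws, (e x).map_target hwt, by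
          change _ = (e x ((e x).symm _)).2
          rw [(e x).right_inv hwt]⟩
      rw [Set.mem_preimage, h5]
      exact hw
  intro U hU
  rw [← (isQuotientMap_quotient_mk' : Topology.IsQuotientMap S.leafProj).isOpen_preimage]
  refine isOpen_iff_mem_nhds.2 fun z hz => ?_
  obtain ⟨y, hy, hyz⟩ := hz
  exact key (reflTransGen_samePlaque_of_leaf he hx (Quotient.exact hyz)) U (hU.mem_nhds hy)

end Leaves

/-! ### The hyper-Kähler atlas of the leaf space. -/

section LeafSpaceAtlas

variable {n : ℕ} {M : Type u} [TopologicalSpace M]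
  [ChartedSpace (EuclideanSpace ℝ (Fin (4 * n + 3))) M] [IsManifold (𝓡 (4 * n + 3)) ∞ M]
  {S : AlmostContactMetric3 n M} {e : M → OpenPartialHomeomorph M (AdaptedModel n)} {r : M → ℝ}

/-- A family of adapted charts, one around each point, which each leaf meets in at most one
plaque. -/
structure IsRegularFamily (S : AlmostContactMetric3 n M)
    (e : M → OpenPartialHomeomorph M (AdaptedModel n)) (r : M → ℝ) : Prop where
  adapted : ∀ x, IsAdaptedChart S (e x) (r x)
  mem_source : ∀ x, x ∈ (e x).source
  plaque : ∀ x, ∀ y ∈ (e x).source, ∀ z ∈ (e x).source, S.leafProj y = S.leafProj z →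
    (e x y).2 = (e x z).2

namespace IsRegularFamily

variable (h : IsRegularFamily S e r)

include h

theorem isOpenMap : IsOpenMap S.leafProj := isOpenMap_leafProj h.adapted h.mem_source

theorem zero_mk_mem (x : M) {z : EuclideanSpace ℝ (Fin (4 * n))} (hz : z ∈ Metric.ball 0 (r x)) :
    ((0, z) : AdaptedModel n) ∈ (e x).target := by
  rw [(h.adapted x).target_eq]
  exact LocalCosymp.zero_mk_mem.2 hz

theorem snd_mem (x : M) {y : M} (hy : y ∈ (e x).source) : (e x y).2 ∈ Metric.ball 0 (r x) := by
  have := (h.adapted x).mem_ball hy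
  rw [mem_ball_zero_iff] at this ⊢
  exact (norm_snd_le _).trans_lt this

theorem leafProj_symm (x : M) {y : M} (hy : y ∈ (e x).source) :
    S.leafProj ((e x).symm (0, (e x y).2)) = S.leafProj y := by
  have h1 := h.zero_mk_mem x (h.snd_mem x hy)
  exact SamePlaque.leafProj_eq h.adapted ⟨x, (e x).map_target h1, hy, by rw [(e x).right_inv h1]⟩

theorem injOn (x : M) : Set.InjOn (fun z => S.leafProj ((e x).symm (0, z)))
    (Metric.ball (0 : EuclideanSpace ℝ (Fin (4 * n))) (r x)) := fun z hz w hw hzw => by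
  have h1 := h.zero_mk_mem x hz
  have h2 := h.zero_mk_mem x hw
  have h3 := h.plaque x _ ((e x).map_target h1) _ ((e x).map_target h2) hzw
  rwa [(e x).right_inv h1, (e x).right_inv h2] at h3

/-- The inverse of the chart of the leaf space given by a transversal. -/
def transversal (x : M) :
    OpenPartialHomeomorph (EuclideanSpace ℝ (Fin (4 * n))) S.LeafSpace :=
  OpenPartialHomeomorph.ofContinuousOpenRestrict (h.injOn x).toPartialEquiv (by
    refine Continuous.comp_continuousOn (g := S.leafProj) continuous_quotient_mk' ?_
    refine (e x).continuousOn_symm.comp (f := fun z => ((0, z) : AdaptedModel n))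
      (Continuous.prodMk_right _).continuousOn fun z hz => h.zero_mk_mem x hz) (by
    rintro W ⟨W', hW', rfl⟩
    -- The image of a piece of the transversal is the image of the open union of plaques through it,
    -- so openness of `leafProj` applies.
    have h1 : (Metric.ball (0 : EuclideanSpace ℝ (Fin (4 * n))) (r x)).domRestrict
        (fun z => S.leafProj ((e x).symm (0, z))) '' (Subtype.val ⁻¹' W')
        = S.leafProj '' ((e x).source ∩ e x ⁻¹' (Prod.snd ⁻¹' W')) := by
      ext q
      constructor
      · rintro ⟨⟨z, hz⟩, hzW, rfl⟩
        have h2 := h.zero_mk_mem x hz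
        refine ⟨(e x).symm (0, z), ⟨(e x).map_target h2, ?_⟩, rfl⟩
        rw [Set.mem_preimage, (e x).right_inv h2]
        exact hzW
      · rintro ⟨y, ⟨hy, hyW⟩, rfl⟩
        exact ⟨⟨(e x y).2, h.snd_mem x hy⟩, hyW, h.leafProj_symm x hy⟩
    refine (congrArg IsOpen h1).mpr (h.isOpenMap _ ?_)
    exact (e x).isOpen_inter_preimage (hW'.preimage continuous_snd))
    Metric.isOpen_ball

theorem leafProj_mem (x : M) {y : M} (hy : y ∈ (e x).source) :
    S.leafProj y ∈ (h.transversal x).target :=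
  ⟨(e x y).2, h.snd_mem x hy, h.leafProj_symm x hy⟩

theorem transversal_symm_leafProj (x : M) {y : M} (hy : y ∈ (e x).source) :
    (h.transversal x).symm (S.leafProj y) = (e x y).2 := by
  have h1 : (h.transversal x) (e x y).2 = S.leafProj y := h.leafProj_symm x hy
  rw [← h1]
  exact (h.transversal x).left_inv (h.snd_mem x hy)

theorem exists_rep (x : M) {q : S.LeafSpace} (hq : q ∈ (h.transversal x).target) :
    ∃ y ∈ (e x).source, S.leafProj y = q := by
  obtain ⟨z, hz, rfl⟩ := hq
  exact ⟨_, (e x).map_target (h.zero_mk_mem x hz), rfl⟩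

variable (hS : S.Is3Cosymplectic)

/-- Near a point common to both domains in `M`, the transition of the leaf space is the change of
transverse coordinates. -/
theorem structurePreservingAt_self {a b y : M} (ha : y ∈ (e a).source) (hb : y ∈ (e b).source) :
    StructurePreservingAt ((h.adapted a).transverse hS) ((h.adapted b).transverse hS)
      ((h.transversal b).symm ∘ h.transversal a) (e a y).2 := by
  refine (h.adapted a).structurePreservingAt hS (h.adapted b) ha hb ?_
  filter_upwards [(e a).open_source.mem_nhds ha, (e b).open_source.mem_nhds hb] with w hwa hwb
  rw [Function.comp_apply, ← h.transversal_symm_leafProj a hwa,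
    (h.transversal a).right_inv (h.leafProj_mem a hwa), h.transversal_symm_leafProj b hwb]

/-- The points `y` and `z` of one leaf may lie in charts with disjoint domains. Along the chain the
transition factors locally through intermediate transversals, and each factor is covered by
`structurePreservingAt_self`. -/
theorem structurePreservingAt_of_chain {y z : M}
    (hyz : Relation.ReflTransGen (SamePlaque e) y z) :
    ∀ {a b : M}, y ∈ (e a).source → z ∈ (e b).source →
      StructurePreservingAt ((h.adapted a).transverse hS) ((h.adapted b).transverse hS)
        ((h.transversal b).symm ∘ h.transversal a) (e a y).2 := by
  have hleaf : ∀ z, Relation.ReflTransGen (SamePlaque e) y z → S.leafProj y = S.leafProj z := by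
    intro z hz
    induction hz with
    | refl => rfl
    | tail _ h2 ih => exact ih.trans (SamePlaque.leafProj_eq h.adapted h2)
  induction hyz with
  | refl => exact fun ha hb => h.structurePreservingAt_self hS ha hb
  | @tail z z' hyz hzz' ih =>
    intro a b ha hb
    obtain ⟨c, hc, hc', hcc'⟩ := hzz'
    have h1 := ih ha hc
    have h2 := h.structurePreservingAt_self hS hc' hb
    have hy : h.transversal a (e a y).2 = S.leafProj y := h.leafProj_symm a ha
    have h3 : ((h.transversal c).symm ∘ h.transversal a) (e a y).2 = (e c z').2 := by
      rw [Function.comp_apply, hy, hleaf z hyz, h.transversal_symm_leafProj c hc, hcc']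
    rw [← h3] at h2
    refine (h2.comp h1).congr ?_
    have hcont : ContinuousAt (h.transversal a) (e a y).2 :=
      (h.transversal a).continuousAt (h.snd_mem a ha)
    have hmem : (h.transversal c).target ∈ 𝓝 (h.transversal a (e a y).2) := by
      rw [hy, hleaf z hyz]
      exact (h.transversal c).open_target.mem_nhds (h.leafProj_mem c hc)
    filter_upwards [hcont.preimage_mem_nhds hmem] with w hw
    simp only [Function.comp_apply]
    rw [(h.transversal c).right_inv hw]

/-- The hyper-Kähler atlas of the leaf space. -/
def atlas : HyperKahlerAtlas n S.LeafSpace where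
  index := M
  chart x := (h.transversal x).symm
  str x := (h.adapted x).transverse hS
  cover q := q.out
  mem_cover q := by
    have := h.leafProj_mem q.out (h.mem_source q.out)
    rwa [show S.leafProj q.out = q from q.out_eq] at this
  compatible a b q ha hb := by
    obtain ⟨y, hy, hyq⟩ := h.exists_rep a ha
    obtain ⟨z, hz, hzq⟩ := h.exists_rep b hb
    have h1 := reflTransGen_samePlaque_of_leaf h.adapted h.mem_source
      (Quotient.exact (hyq.trans hzq.symm))
    have h2 := h.structurePreservingAt_of_chain hS h1 hy hz
    rw [← h.transversal_symm_leafProj a hy, hyq] at h2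
    exact h2

end IsRegularFamily

/-- The leaf space of a regular `3`-cosymplectic structure is a hyper-Kähler manifold, and the
structure projects onto it. -/
theorem exists_leafSpace_structure [SecondCountableTopology M] (hS : S.Is3Cosymplectic)
    (hreg : S.IsRegular) : SecondCountableTopology S.LeafSpace ∧
      ∃ (_ : ChartedSpace (EuclideanSpace ℝ (Fin (4 * n))) S.LeafSpace)
        (_ : IsManifold (𝓡 (4 * n)) ∞ S.LeafSpace) (K : AlmostHyperHermitian n S.LeafSpace),
        K.IsHyperKahler ∧ ProjectsOn S K ⊤ S.leafProj := by
  choose e r he hx hleaf using fun x => exists_regular_adaptedChart hS hreg x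
  have h : IsRegularFamily S e r :=
    ⟨he, hx, fun x y hy z hz hyz => hleaf x y hy z hz (Quotient.exact hyz)⟩
  -- Images of a countable basis under an open quotient map form a basis.
  refine ⟨TopologicalSpace.Quotient.secondCountableTopology h.isOpenMap, ?_⟩
  let A := h.atlas hS
  let cs := A.chartedSpace
  have hm := A.isManifold
  have hA : ∀ i, IsSmoothChart (4 * n) (A.chart i) := fun i =>
    isSmoothChart_of_mem_atlas ⟨i, rfl⟩
  have hA' : ∀ x, chartAt (EuclideanSpace ℝ (Fin (4 * n))) x = A.chart (A.cover x) := fun _ => rfl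
  exact ⟨cs, hm, HyperKahlerAtlas.glue hA hA', HyperKahlerAtlas.glue_isHyperKahler hA hA',
    projectsOn_glue hS hA hA' fun x _ => ⟨e x, r x, he x, x, hx x,
      fun y hy => ⟨h.leafProj_mem x hy, h.transversal_symm_leafProj x hy⟩, fun _ => rfl, rfl⟩⟩

end LeafSpaceAtlas

end ThreeCosymp

end

theorem mainTheorem6 (n : ℕ) (M : Type u) [TopologicalSpace M] [T2Space M]
    [SecondCountableTopology M]
    [ChartedSpace (EuclideanSpace ℝ (Fin (4 * n + 3))) M] [IsManifold (𝓡 (4 * n + 3)) ∞ M]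
    (S : ThreeCosymp.AlmostContactMetric3 n M) (hS : S.Is3Cosymplectic) :
    (S.IsRegular →
      SecondCountableTopology S.LeafSpace ∧
      ∃ (_ : ChartedSpace (EuclideanSpace ℝ (Fin (4 * n))) S.LeafSpace)
        (_ : IsManifold (𝓡 (4 * n)) ∞ S.LeafSpace)
        (K : ThreeCosymp.AlmostHyperHermitian n S.LeafSpace),
        K.IsHyperKahler ∧ ThreeCosymp.ProjectsOn S K ⊤ S.leafProj) ∧
    (∃ (N : Type) (_ : TopologicalSpace N) (_ : T2Space N) (_ : SecondCountableTopology N)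
        (_ : ChartedSpace (EuclideanSpace ℝ (Fin (4 * n))) N)
        (_ : IsManifold (𝓡 (4 * n)) ∞ N)
        (K : ThreeCosymp.AlmostHyperHermitian n N)
        (ι : Type) (U : ι → TopologicalSpace.Opens M) (f : ι → M → N),
        K.IsHyperKahler ∧ (∀ x : M, ∃ i, x ∈ U i) ∧
        ∀ i, ThreeCosymp.ProjectsOn S K (U i) (f i)) :=
  ⟨ThreeCosymp.exists_leafSpace_structure hS, ThreeCosymp.exists_local_projections S hS⟩
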